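/- Throughout, a 2-category is strict, and products and exponentials are taken in the strict 2-categorical sense: $\mathcal A(E,X\times Y)\cong \mathcal A(E,X)\times\mathcal A(E,Y)$, $\mathcal A(E,1)\cong \mathbf 1$ and $\mathrm{ev}\circ(-\times 1):\mathcal A(E,X^X)\to\mathcal A(E\times X,X)$ are isomorphisms of categories for every $E$. Let $\mathcal A$ be a 2-category with finite products. Below, the variables $A,B,C,\dots$ and $X$ in a 2-cell stand for the projections of the evident product of $0$-cells. * $\mathrm{Mon}_l(\mathcal A)$ is the 2-category of monoidal objects $(\mathcal C,\otimes,I,\alpha,\lambda,\rho)$ in $\mathcal A$ (with $\alpha:A\otimes(B\otimes C)\to(A\otimes B)\otimes C$, $\lambda: I\otimes A\to A$, $\rho:A\otimes I\to A$ invertible and satisfying the pentagon and triangle identities), lax monoidal 1-cells $(F,\phi,\bar\phi)$, where $\phi:F(A)\otimes' F(B)\to F(A\otimes B)$ and $\bar\phi:I'\to F(I)$ satisfy the usual associativity and two unit axioms, and monoidal transformations. $(F,\phi,\bar\phi)$ is strong if $\phi$ and $\bar\phi$ are invertible. * For a $0$-cell $Z$ of a 2-category $\mathcal B$, the lax slice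 $\mathcal B/_lZ$ has as 0-cells the 1-cells $b:B\to Z$, as 1-cells $(B,b)\to(C,c)$ the pairs $(F:B\to C,\ \theta:c\circ F\to b)$, and as 2-cells $(F,\theta)\to(F',\theta')$ the 2-cells $\tau:F\to F'$ with $\theta'\circ c(\tau)=\theta$. * For a $0$-cell $X$ of $\mathcal A$, the 2-category $\mathrm{Act}_l\mathrm{Mon}_l(\mathcal A,X)$ has as 0-cells the monoidal objects $\mathcal C$ with a lax action on $X$, that is, a 1-cell $\star:\mathcal C\times X\to X$ and 2-cells $\psi:A\star(B\star X)\to(A\otimes B)\star X$, $\bar\psi:X\to I\star X$ such that $\psi_{A\otimes B,C,X}\circ\psi_{A,B,C\star X}=(\alpha_{A,B,C}\star 1)\circ\psi_{A,B\otimes C,X}\circ(1_A\star\psi_{B,C,X})$, $(\lambda_A\star1)\circ\psi_{I,A,X}\circ\bar\psi_{A\star X}=1_{A\star X}$ and $(\rho_A\star1)\circ\psi_{A,I,X}\circ(1_A\star\bar\psi_X)=1_{A\star X}$. A 1-cell $(\mathcal C,\star,\psi,\bar\psi)\to(\mathcal C',\star',\psi',\bar\psi')$ is a lax monoidal 1-cell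 $(F,\phi,\bar\phi):\mathcal C\to\mathcal C'$ with a 2-cell $\xi:F(A)\star' X\to A\star X$ such that $\xi_{A\otimes B,X}\circ(\phi_{A,B}\star'1)\circ\psi'_{F(A),F(B),X}=\psi_{A,B,X}\circ\xi_{A,B\star X}\circ(1_{F(A)}\star'\xi_{B,X})$ and $\xi_{I,X}\circ(\bar\phi\star'1)\circ\bar\psi'=\bar\psi$. A 2-cell $(F,\phi,\bar\phi,\xi)\to(F',\phi',\bar\phi',\xi')$ is a monoidal transformation $\tau:F\to F'$ with $\xi'\circ(\tau\star'1_X)=\xi$. An action is strong if $\psi$ and $\bar\psi$ are invertible. **Proposition.** Let $X$ be a 0-cell of $\mathcal A$ for which the exponential $X^X$ exists, and regard $X^X$ as a (strict) monoidal object with composition as tensor and the transpose of the identity of $X$ as unit. Then there is an isomorphism of 2-categories $$\Phi:\ \mathrm{Mon}_l(\mathcal A)/_l X^X\ \longrightarrow\ \mathrm{Act}_l\mathrm{Mon}_l(\mathcal A,X)$$ (a strict 2-functor with a strict inverse) which commutes with the forgetful 2-functors to $\mathrm{Mon}_l(\mathcal A)$ and is given by exponential transposition: it sends a lax monoidal 1-cell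 $(r,\varphi,\bar\varphi):\mathcal C\to X^X$ to the action of $\mathcal C$ on $X$ in which $\star=\mathrm{ev}\circ(r\times 1_X)$ and $\psi,\bar\psi$ are the transposes of $\varphi,\bar\varphi$, and it sends a 1-cell $(F,\theta)$ to $(F,\xi)$ with $\xi$ the transpose of $\theta$. Moreover, $(r,\varphi,\bar\varphi)$ is strong if and only if the corresponding action is strong. -/

import Mathlib

open CategoryTheory Bicategory

universe w v u

set_option linter.unusedSectionVars false

/- A 2-category is a `Bicategory` that is `Bicategory.Strict`. The priorities only make Lean find
the 1-cells of a 2-category through its `Bicategory` structure. -/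
attribute [instance 2000] CategoryTheory.CategoryStruct.toQuiver
attribute [instance 2000] CategoryTheory.Bicategory.toCategoryStruct

namespace TwoCat

section Cast

variable {C : Type*} [Category C]

/-- Transport of a morphism along equalities of its source and of its target. -/
def castHom {a b a' b' : C} (σ : a ⟶ b) (ha : a = a') (hb : b = b') : a' ⟶ b' :=
  eqToHom ha.symm ≫ σ ≫ eqToHom hb

theorem castHom_heq {a b a' b' : C} (σ : a ⟶ b) (ha : a = a') (hb : b = b') :
    HEq (castHom σ ha hb) σ := by
  subst ha hb; simp [castHom]

theorem hcomp {a b c a' b' c' : C} {σ : a ⟶ b} {τ : b ⟶ c} {σ' : a' ⟶ b'} {τ' : b' ⟶ c'}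
    (ha : a = a') (hb : b = b') (hc : c = c') (h : HEq σ σ') (k : HEq τ τ') :
    HEq (σ ≫ τ) (σ' ≫ τ') := by
  subst ha hb hc; cases h; cases k; rfl

theorem hid {a a' : C} (h : a = a') : HEq (𝟙 a) (𝟙 a') := by subst h; rfl

end Cast

section Strict

variable {A : Type u} [Bicategory.{w, v} A]

theorem assoc₂ {a b : A} {f g h k : a ⟶ b} (σ : f ⟶ g) (τ : g ⟶ h) (υ : h ⟶ k) :
    (σ ≫ τ) ≫ υ = σ ≫ τ ≫ υ := Category.assoc _ _ _

theorem hwl {a b c : A} {f f' : a ⟶ b} {g h g' h' : b ⟶ c} {σ : g ⟶ h} {σ' : g' ⟶ h'}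
    (hf : f = f') (hg : g = g') (hh : h = h') (k : HEq σ σ') : HEq (f ◁ σ) (f' ◁ σ') := by
  subst hf hg hh; cases k; rfl

theorem hwr {a b c : A} {f g f' g' : a ⟶ b} {h h' : b ⟶ c} {σ : f ⟶ g} {σ' : f' ⟶ g'}
    (hf : f = f') (hg : g = g') (hh : h = h') (k : HEq σ σ') : HEq (σ ▷ h) (σ' ▷ h') := by
  subst hf hg hh; cases k; rfl

variable [Bicategory.Strict A]

theorem comp_wl {a b c d : A} (f : a ⟶ b) (g : b ⟶ c) {h k : c ⟶ d} (σ : h ⟶ k) :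
    HEq ((f ≫ g) ◁ σ) (f ◁ g ◁ σ) := by
  rw [comp_whiskerLeft, Strict.associator_eqToIso, Strict.associator_eqToIso]
  exact castHom_heq (f ◁ g ◁ σ) (Strict.assoc f g h).symm (Strict.assoc f g k).symm

theorem wr_comp {a b c d : A} {f g : a ⟶ b} (σ : f ⟶ g) (h : b ⟶ c) (k : c ⟶ d) :
    HEq (σ ▷ (h ≫ k)) (σ ▷ h ▷ k) := by
  rw [whiskerRight_comp, Strict.associator_eqToIso, Strict.associator_eqToIso]
  exact castHom_heq (σ ▷ h ▷ k) (Strict.assoc f h k) (Strict.assoc g h k)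

theorem wl_wr {a b c d : A} (f : a ⟶ b) {g h : b ⟶ c} (σ : g ⟶ h) (k : c ⟶ d) :
    HEq ((f ◁ σ) ▷ k) (f ◁ σ ▷ k) := by
  rw [whisker_assoc, Strict.associator_eqToIso, Strict.associator_eqToIso]
  exact castHom_heq (f ◁ σ ▷ k) (Strict.assoc f g k).symm (Strict.assoc f h k).symm

theorem id_wl {a b : A} {f g : a ⟶ b} (σ : f ⟶ g) : HEq (𝟙 a ◁ σ) σ := by
  rw [id_whiskerLeft, Strict.leftUnitor_eqToIso, Strict.leftUnitor_eqToIso]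
  exact castHom_heq σ (Strict.id_comp f).symm (Strict.id_comp g).symm

theorem wr_id {a b : A} {f g : a ⟶ b} (σ : f ⟶ g) : HEq (σ ▷ 𝟙 b) σ := by
  rw [whiskerRight_id, Strict.rightUnitor_eqToIso, Strict.rightUnitor_eqToIso]
  exact castHom_heq σ (Strict.comp_id f).symm (Strict.comp_id g).symm

end Strict

/-- Chosen finite products of a 2-category, in the strict 2-categorical sense: postcomposition with
the projections is an isomorphism of categories `A(E, X × Y) ≅ A(E, X) × A(E, Y)`, and `A(E, 1)` is
the terminal category. -/
class FiniteProducts (A : Type u) [Bicategory.{w, v} A] where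
  one : A
  toOne (E : A) : E ⟶ one
  toOne_uniq {E : A} (f : E ⟶ one) : f = toOne E
  toOne_ext {E : A} {f g : E ⟶ one} (σ τ : f ⟶ g) : σ = τ
  prod : A → A → A
  fst (X Y : A) : prod X Y ⟶ X
  snd (X Y : A) : prod X Y ⟶ Y
  pair {E X Y : A} (a : E ⟶ X) (b : E ⟶ Y) : E ⟶ prod X Y
  pair_fst {E X Y : A} (a : E ⟶ X) (b : E ⟶ Y) : pair a b ≫ fst X Y = a
  pair_snd {E X Y : A} (a : E ⟶ X) (b : E ⟶ Y) : pair a b ≫ snd X Y = b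
  pair_uniq {E X Y : A} {f g : E ⟶ prod X Y} :
    f ≫ fst X Y = g ≫ fst X Y → f ≫ snd X Y = g ≫ snd X Y → f = g
  lift {E X Y : A} {f g : E ⟶ prod X Y} (σ : f ≫ fst X Y ⟶ g ≫ fst X Y)
    (τ : f ≫ snd X Y ⟶ g ≫ snd X Y) : f ⟶ g
  lift_fst {E X Y : A} {f g : E ⟶ prod X Y} (σ : f ≫ fst X Y ⟶ g ≫ fst X Y)
    (τ : f ≫ snd X Y ⟶ g ≫ snd X Y) : lift σ τ ▷ fst X Y = σ
  lift_snd {E X Y : A} {f g : E ⟶ prod X Y} (σ : f ≫ fst X Y ⟶ g ≫ fst X Y)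
    (τ : f ≫ snd X Y ⟶ g ≫ snd X Y) : lift σ τ ▷ snd X Y = τ
  lift_uniq {E X Y : A} {f g : E ⟶ prod X Y} {σ τ : f ⟶ g} :
    σ ▷ fst X Y = τ ▷ fst X Y → σ ▷ snd X Y = τ ▷ snd X Y → σ = τ

open FiniteProducts

attribute [simp] pair_fst pair_snd

section Products

variable {A : Type u} [Bicategory.{w, v} A] [FiniteProducts A]

/-- The pairing `⟨σ, τ⟩` of 2-cells. -/
def pair₂ {E X Y : A} {a a' : E ⟶ X} {b b' : E ⟶ Y} (σ : a ⟶ a') (τ : b ⟶ b') :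
    pair a b ⟶ pair a' b' :=
  lift (castHom σ (pair_fst a b).symm (pair_fst a' b').symm)
    (castHom τ (pair_snd a b).symm (pair_snd a' b').symm)

/-- A 1-cell `m : X × Y ⟶ Z`, written as a binary operation `m(a, b)` on 1-cells with a common
domain (the stage). -/
def op {E X Y Z : A} (m : prod X Y ⟶ Z) (a : E ⟶ X) (b : E ⟶ Y) : E ⟶ Z :=
  pair a b ≫ m

/-- The action of `m : X × Y ⟶ Z` on 2-cells: the 2-cell `m(σ, τ) : m(a, b) ⟶ m(a', b')`. -/
def op₂ {E X Y Z : A} (m : prod X Y ⟶ Z) {a a' : E ⟶ X} {b b' : E ⟶ Y} (σ : a ⟶ a')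
    (τ : b ⟶ b') : op m a b ⟶ op m a' b' :=
  pair₂ σ τ ▷ m

/-- The constant 1-cell `E ⟶ 1 ⟶ X` at `u : 1 ⟶ X`. -/
def const {X : A} (u : (one : A) ⟶ X) (E : A) : E ⟶ X := toOne E ≫ u

/-- The first projection of a ternary product. -/
def p₁ (X Y Z : A) : prod X (prod Y Z) ⟶ X := fst X (prod Y Z)

/-- The second projection of a ternary product. -/
def p₂ (X Y Z : A) : prod X (prod Y Z) ⟶ Y := snd X (prod Y Z) ≫ fst Y Z

/-- The third projection of a ternary product. -/
def p₃ (X Y Z : A) : prod X (prod Y Z) ⟶ Z := snd X (prod Y Z) ≫ snd Y Z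

/-- The first projection of a quaternary product. -/
def q₁ (X Y Z W : A) : prod X (prod Y (prod Z W)) ⟶ X := fst X (prod Y (prod Z W))

/-- The second projection of a quaternary product. -/
def q₂ (X Y Z W : A) : prod X (prod Y (prod Z W)) ⟶ Y :=
  snd X (prod Y (prod Z W)) ≫ p₁ Y Z W

/-- The third projection of a quaternary product. -/
def q₃ (X Y Z W : A) : prod X (prod Y (prod Z W)) ⟶ Z :=
  snd X (prod Y (prod Z W)) ≫ p₂ Y Z W

/-- The fourth projection of a quaternary product. -/
def q₄ (X Y Z W : A) : prod X (prod Y (prod Z W)) ⟶ W :=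
  snd X (prod Y (prod Z W)) ≫ p₃ Y Z W

variable [Bicategory.Strict A]

theorem pair_fst_assoc {E X Y Z : A} (a : E ⟶ X) (b : E ⟶ Y) (f : X ⟶ Z) :
    pair a b ≫ fst X Y ≫ f = a ≫ f := by rw [← Strict.assoc, pair_fst]

theorem pair_snd_assoc {E X Y Z : A} (a : E ⟶ X) (b : E ⟶ Y) (f : Y ⟶ Z) :
    pair a b ≫ snd X Y ≫ f = b ≫ f := by rw [← Strict.assoc, pair_snd]

theorem comp_pair {D E X Y : A} (f : D ⟶ E) (a : E ⟶ X) (b : E ⟶ Y) :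
    f ≫ pair a b = pair (f ≫ a) (f ≫ b) :=
  pair_uniq (by simp) (by simp)

theorem comp_pair_assoc {D E X Y Z : A} (f : D ⟶ E) (a : E ⟶ X) (b : E ⟶ Y)
    (g : prod X Y ⟶ Z) :
    f ≫ pair a b ≫ g = pair (f ≫ a) (f ≫ b) ≫ g := by
  rw [← Strict.assoc, comp_pair]

theorem comp_op {D E X Y Z : A} (f : D ⟶ E) (m : prod X Y ⟶ Z) (a : E ⟶ X) (b : E ⟶ Y) :
    f ≫ op m a b = op m (f ≫ a) (f ≫ b) := by
  rw [op, comp_pair_assoc]; rfl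

theorem comp_op_assoc {D E X Y Z W : A} (f : D ⟶ E) (m : prod X Y ⟶ Z) (a : E ⟶ X) (b : E ⟶ Y)
    (g : Z ⟶ W) : f ≫ op m a b ≫ g = op m (f ≫ a) (f ≫ b) ≫ g := by
  rw [← Strict.assoc, comp_op]

theorem comp_const {D E X : A} (f : D ⟶ E) (u : (one : A) ⟶ X) :
    f ≫ const u E = const u D := by
  rw [const, ← Strict.assoc, toOne_uniq (f ≫ toOne E)]; rfl

theorem comp_const_assoc {D E X Y : A} (f : D ⟶ E) (u : (one : A) ⟶ X) (g : X ⟶ Y) :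
    f ≫ const u E ≫ g = const u D ≫ g := by
  rw [← Strict.assoc, comp_const]

theorem toOne_comp_assoc {E X Y : A} (u : (one : A) ⟶ X) (g : X ⟶ Y) :
    toOne E ≫ u ≫ g = const u E ≫ g := by rw [← Strict.assoc]; rfl

theorem const_comp {E X Y : A} (u : (one : A) ⟶ X) (g : X ⟶ Y) :
    const u E ≫ g = const (u ≫ g) E := by rw [const, Strict.assoc]; rfl

theorem comp_fst_pair {E X Y : A} (f : E ⟶ prod X Y) : pair (f ≫ fst X Y) (f ≫ snd X Y) = f :=
  pair_uniq (by simp) (by simp)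

theorem pair_fst_snd (X Y : A) : pair (fst X Y) (snd X Y) = 𝟙 _ :=
  pair_uniq (by simp) (by simp)

theorem op_fst_snd {X Y Z : A} (m : prod X Y ⟶ Z) : op m (fst X Y) (snd X Y) = m := by
  rw [op, pair_fst_snd, Strict.id_comp]

theorem pair_p₁ {E X Y Z : A} (a : E ⟶ X) (b : E ⟶ Y) (c : E ⟶ Z) :
    pair a (pair b c) ≫ p₁ X Y Z = a := by simp [p₁]

theorem pair_p₂ {E X Y Z : A} (a : E ⟶ X) (b : E ⟶ Y) (c : E ⟶ Z) :
    pair a (pair b c) ≫ p₂ X Y Z = b := by simp [p₂, pair_snd_assoc]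

theorem pair_p₃ {E X Y Z : A} (a : E ⟶ X) (b : E ⟶ Y) (c : E ⟶ Z) :
    pair a (pair b c) ≫ p₃ X Y Z = c := by simp [p₃, pair_snd_assoc]

theorem pair_p₁_assoc {E X Y Z W : A} (a : E ⟶ X) (b : E ⟶ Y) (c : E ⟶ Z) (g : X ⟶ W) :
    pair a (pair b c) ≫ p₁ X Y Z ≫ g = a ≫ g := by rw [← Strict.assoc, pair_p₁]

theorem pair_p₂_assoc {E X Y Z W : A} (a : E ⟶ X) (b : E ⟶ Y) (c : E ⟶ Z) (g : Y ⟶ W) :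
    pair a (pair b c) ≫ p₂ X Y Z ≫ g = b ≫ g := by rw [← Strict.assoc, pair_p₂]

theorem pair_p₃_assoc {E X Y Z W : A} (a : E ⟶ X) (b : E ⟶ Y) (c : E ⟶ Z) (g : Z ⟶ W) :
    pair a (pair b c) ≫ p₃ X Y Z ≫ g = c ≫ g := by rw [← Strict.assoc, pair_p₃]

attribute [simp] Strict.assoc Strict.id_comp Strict.comp_id pair_fst_assoc pair_snd_assoc
  comp_pair comp_pair_assoc comp_op comp_op_assoc comp_const comp_const_assoc
  toOne_comp_assoc pair_p₁ pair_p₂ pair_p₃ pair_p₁_assoc pair_p₂_assoc pair_p₃_assoc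

-- 2-cells

theorem pair₂_fst {E X Y : A} {a a' : E ⟶ X} {b b' : E ⟶ Y} (σ : a ⟶ a') (τ : b ⟶ b') :
    HEq (pair₂ σ τ ▷ fst X Y) σ := by
  rw [pair₂, lift_fst]; exact castHom_heq _ _ _

theorem pair₂_snd {E X Y : A} {a a' : E ⟶ X} {b b' : E ⟶ Y} (σ : a ⟶ a') (τ : b ⟶ b') :
    HEq (pair₂ σ τ ▷ snd X Y) τ := by
  rw [pair₂, lift_snd]; exact castHom_heq _ _ _

theorem hext {E X Y : A} {f g f' g' : E ⟶ prod X Y} {σ : f ⟶ g} {τ : f' ⟶ g'} (hf : f = f')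
    (hg : g = g') (h₁ : HEq (σ ▷ fst X Y) (τ ▷ fst X Y)) (h₂ : HEq (σ ▷ snd X Y) (τ ▷ snd X Y)) :
    HEq σ τ := by
  subst hf hg
  exact heq_of_eq (lift_uniq (eq_of_heq h₁) (eq_of_heq h₂))

theorem pair₂_id {E X Y : A} (a : E ⟶ X) (b : E ⟶ Y) : pair₂ (𝟙 a) (𝟙 b) = 𝟙 (pair a b) := by
  refine eq_of_heq (hext rfl rfl ?_ ?_)
  · exact (pair₂_fst _ _).trans (by rw [id_whiskerRight, pair_fst])
  · exact (pair₂_snd _ _).trans (by rw [id_whiskerRight, pair_snd])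

theorem pair₂_comp {E X Y : A} {a a' a'' : E ⟶ X} {b b' b'' : E ⟶ Y} (σ : a ⟶ a') (τ : b ⟶ b')
    (σ' : a' ⟶ a'') (τ' : b' ⟶ b'') :
    pair₂ (σ ≫ σ') (τ ≫ τ') = pair₂ σ τ ≫ pair₂ σ' τ' := by
  refine eq_of_heq (hext rfl rfl ?_ ?_)
  · rw [comp_whiskerRight]
    exact (pair₂_fst _ _).trans (hcomp (by simp) (by simp) (by simp) (pair₂_fst _ _).symm
      (pair₂_fst _ _).symm)
  · rw [comp_whiskerRight]
    exact (pair₂_snd _ _).trans (hcomp (by simp) (by simp) (by simp) (pair₂_snd _ _).symm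
      (pair₂_snd _ _).symm)

theorem wl_pair₂ {D E X Y : A} (f : D ⟶ E) {a a' : E ⟶ X} {b b' : E ⟶ Y} (σ : a ⟶ a')
    (τ : b ⟶ b') : HEq (f ◁ pair₂ σ τ) (pair₂ (f ◁ σ) (f ◁ τ)) := by
  refine hext (by simp) (by simp) ?_ ?_
  · exact (wl_wr _ _ _).trans ((hwl rfl (by simp) (by simp) (pair₂_fst _ _)).trans
      (pair₂_fst _ _).symm)
  · exact (wl_wr _ _ _).trans ((hwl rfl (by simp) (by simp) (pair₂_snd _ _)).trans
      (pair₂_snd _ _).symm)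

theorem wr_pair {D E X Y : A} {f f' : D ⟶ E} (σ : f ⟶ f') (a : E ⟶ X) (b : E ⟶ Y) :
    HEq (σ ▷ pair a b) (pair₂ (σ ▷ a) (σ ▷ b)) := by
  refine hext (by simp) (by simp) ?_ ?_
  · exact (wr_comp _ _ _).symm.trans ((hwr rfl rfl (by simp) HEq.rfl).trans
      (pair₂_fst _ _).symm)
  · exact (wr_comp _ _ _).symm.trans ((hwr rfl rfl (by simp) HEq.rfl).trans
      (pair₂_snd _ _).symm)

theorem hpair₂ {E X Y : A} {a a' c c' : E ⟶ X} {b b' d d' : E ⟶ Y} {σ : a ⟶ a'} {τ : b ⟶ b'}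
    {σ' : c ⟶ c'} {τ' : d ⟶ d'} (ha : a = c) (ha' : a' = c') (hb : b = d) (hb' : b' = d')
    (h : HEq σ σ') (k : HEq τ τ') : HEq (pair₂ σ τ) (pair₂ σ' τ') := by
  subst ha ha' hb hb'; cases h; cases k; rfl

theorem hop₂ {E X Y Z : A} (m : prod X Y ⟶ Z) {a a' c c' : E ⟶ X} {b b' d d' : E ⟶ Y}
    {σ : a ⟶ a'} {τ : b ⟶ b'} {σ' : c ⟶ c'} {τ' : d ⟶ d'} (ha : a = c) (ha' : a' = c')
    (hb : b = d) (hb' : b' = d') (h : HEq σ σ') (k : HEq τ τ') :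
    HEq (op₂ m σ τ) (op₂ m σ' τ') := by
  subst ha ha' hb hb'; cases h; cases k; rfl

theorem op₂_id {E X Y Z : A} (m : prod X Y ⟶ Z) (a : E ⟶ X) (b : E ⟶ Y) :
    op₂ m (𝟙 a) (𝟙 b) = 𝟙 (op m a b) := by
  rw [op₂, pair₂_id, id_whiskerRight]; rfl

theorem op₂_comp {E X Y Z : A} (m : prod X Y ⟶ Z) {a a' a'' : E ⟶ X} {b b' b'' : E ⟶ Y}
    (σ : a ⟶ a') (τ : b ⟶ b') (σ' : a' ⟶ a'') (τ' : b' ⟶ b'') :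
    op₂ m (σ ≫ σ') (τ ≫ τ') = op₂ m σ τ ≫ op₂ m σ' τ' := by
  rw [op₂, pair₂_comp, comp_whiskerRight]; rfl

theorem wl_op₂ {D E X Y Z : A} (f : D ⟶ E) (m : prod X Y ⟶ Z) {a a' : E ⟶ X} {b b' : E ⟶ Y}
    (σ : a ⟶ a') (τ : b ⟶ b') : HEq (f ◁ op₂ m σ τ) (op₂ m (f ◁ σ) (f ◁ τ)) :=
  (wl_wr _ _ _).symm.trans (hwr (by simp) (by simp) rfl (wl_pair₂ _ _ _))

theorem wr_op {D E X Y Z : A} {f f' : D ⟶ E} (σ : f ⟶ f') (m : prod X Y ⟶ Z) (a : E ⟶ X)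
    (b : E ⟶ Y) : HEq (σ ▷ op m a b) (op₂ m (σ ▷ a) (σ ▷ b)) :=
  (wr_comp _ _ _).trans (hwr (by simp) (by simp) rfl (wr_pair _ _ _))

end Products

section Stages

variable {A : Type u} [Bicategory.{w, v} A] [FiniteProducts A] [Bicategory.Strict A]

/-- The component at `(a, b, c)` of a 2-cell
`m(x, n(y, z)) ⟶ m'(k(x, y), z)`, i.e. its whiskering along `⟨a, b, c⟩`. -/
def assocAt {X Y Z U V W : A} {m : prod X V ⟶ W} {n : prod Y Z ⟶ V} {m' : prod U Z ⟶ W}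
    {k : prod X Y ⟶ U}
    (α : op m (p₁ X Y Z) (op n (p₂ X Y Z) (p₃ X Y Z)) ⟶
      op m' (op k (p₁ X Y Z) (p₂ X Y Z)) (p₃ X Y Z))
    {E : A} (a : E ⟶ X) (b : E ⟶ Y) (c : E ⟶ Z) :
    op m a (op n b c) ⟶ op m' (op k a b) c :=
  castHom (pair a (pair b c) ◁ α) (by simp) (by simp)

/-- The component at `a` of a 2-cell `m(u, y) ⟶ y`. -/
def leftUnitAt {X Y : A} {m : prod X Y ⟶ Y} {u : (one : A) ⟶ X}
    (l : op m (const u Y) (𝟙 Y) ⟶ 𝟙 Y) {E : A} (a : E ⟶ Y) : op m (const u E) a ⟶ a :=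
  castHom (a ◁ l) (by simp) (by simp)

/-- The component at `a` of a 2-cell `y ⟶ m(u, y)`. -/
def leftCounitAt {X Y : A} {m : prod X Y ⟶ Y} {u : (one : A) ⟶ X}
    (l : 𝟙 Y ⟶ op m (const u Y) (𝟙 Y)) {E : A} (a : E ⟶ Y) : a ⟶ op m (const u E) a :=
  castHom (a ◁ l) (by simp) (by simp)

/-- The component at `a` of a 2-cell `m(x, u) ⟶ x`. -/
def rightUnitAt {X Y : A} {m : prod X Y ⟶ X} {u : (one : A) ⟶ Y}
    (r : op m (𝟙 X) (const u X) ⟶ 𝟙 X) {E : A} (a : E ⟶ X) : op m a (const u E) ⟶ a :=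
  castHom (a ◁ r) (by simp) (by simp)

/-- The component at `(a, b)` of a 2-cell `n(F x, F y) ⟶ F (m(x, y))`. -/
def laxAt {C D : A} {m : prod C C ⟶ C} {n : prod D D ⟶ D} {F : C ⟶ D}
    (φ : op n (fst C C ≫ F) (snd C C ≫ F) ⟶ op m (fst C C) (snd C C) ≫ F)
    {E : A} (a b : E ⟶ C) : op n (a ≫ F) (b ≫ F) ⟶ op m a b ≫ F :=
  castHom (pair a b ◁ φ) (by simp) (by simp)

/-- The 2-cell `φ₀ : z ⟶ F u` between points, regarded as a 2-cell between constant 1-cells at the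
stage `E`. -/
def constAt {C D : A} {u : (one : A) ⟶ C} {z : (one : A) ⟶ D} {F : C ⟶ D} (φ₀ : z ⟶ u ≫ F)
    (E : A) : const z E ⟶ const u E ≫ F :=
  castHom (toOne E ◁ φ₀) rfl (by simp)

/-- The component at `(a, x)` of a 2-cell `s'(F c, x) ⟶ s(c, x)`. -/
def actAt {C D X : A} {s : prod C X ⟶ X} {s' : prod D X ⟶ X} {F : C ⟶ D}
    (ξ : op s' (fst C X ≫ F) (snd C X) ⟶ op s (fst C X) (snd C X))
    {E : A} (a : E ⟶ C) (x : E ⟶ X) : op s' (a ≫ F) x ⟶ op s a x :=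
  castHom (pair a x ◁ ξ) (by simp) (by simp)

theorem assocAt_heq {X Y Z U V W : A} {m : prod X V ⟶ W} {n : prod Y Z ⟶ V} {m' : prod U Z ⟶ W}
    {k : prod X Y ⟶ U}
    (α : op m (p₁ X Y Z) (op n (p₂ X Y Z) (p₃ X Y Z)) ⟶
      op m' (op k (p₁ X Y Z) (p₂ X Y Z)) (p₃ X Y Z))
    {E : A} (a : E ⟶ X) (b : E ⟶ Y) (c : E ⟶ Z) :
    HEq (assocAt α a b c) (pair a (pair b c) ◁ α) := castHom_heq _ _ _

theorem wl_assocAt {X Y Z U V W : A} {m : prod X V ⟶ W} {n : prod Y Z ⟶ V} {m' : prod U Z ⟶ W}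
    {k : prod X Y ⟶ U}
    (α : op m (p₁ X Y Z) (op n (p₂ X Y Z) (p₃ X Y Z)) ⟶
      op m' (op k (p₁ X Y Z) (p₂ X Y Z)) (p₃ X Y Z))
    {D E : A} (f : D ⟶ E) (a : E ⟶ X) (b : E ⟶ Y) (c : E ⟶ Z) :
    HEq (f ◁ assocAt α a b c) (assocAt α (f ≫ a) (f ≫ b) (f ≫ c)) :=
  (hwl rfl (by simp) (by simp) (assocAt_heq α a b c)).trans
    ((comp_wl _ _ _).symm.trans
      ((hwl (by simp) rfl rfl HEq.rfl).trans (assocAt_heq α _ _ _).symm))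

theorem hassocAt {X Y Z U V W : A} {m : prod X V ⟶ W} {n : prod Y Z ⟶ V} {m' : prod U Z ⟶ W}
    {k : prod X Y ⟶ U}
    (α : op m (p₁ X Y Z) (op n (p₂ X Y Z) (p₃ X Y Z)) ⟶
      op m' (op k (p₁ X Y Z) (p₂ X Y Z)) (p₃ X Y Z))
    {E : A} {a a' : E ⟶ X} {b b' : E ⟶ Y} {c c' : E ⟶ Z} (ha : a = a') (hb : b = b')
    (hc : c = c') : HEq (assocAt α a b c) (assocAt α a' b' c') := by
  subst ha hb hc; rfl

theorem wl_leftUnitAt {X Y : A} {m : prod X Y ⟶ Y} {u : (one : A) ⟶ X}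
    (l : op m (const u Y) (𝟙 Y) ⟶ 𝟙 Y) {D E : A} (f : D ⟶ E) (a : E ⟶ Y) :
    HEq (f ◁ leftUnitAt l a) (leftUnitAt l (f ≫ a)) :=
  (hwl rfl (by simp) (by simp) (castHom_heq _ _ _)).trans
    ((comp_wl _ _ _).symm.trans (castHom_heq _ _ _).symm)

theorem wl_leftCounitAt {X Y : A} {m : prod X Y ⟶ Y} {u : (one : A) ⟶ X}
    (l : 𝟙 Y ⟶ op m (const u Y) (𝟙 Y)) {D E : A} (f : D ⟶ E) (a : E ⟶ Y) :
    HEq (f ◁ leftCounitAt l a) (leftCounitAt l (f ≫ a)) :=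
  (hwl rfl (by simp) (by simp) (castHom_heq _ _ _)).trans
    ((comp_wl _ _ _).symm.trans (castHom_heq _ _ _).symm)

theorem wl_rightUnitAt {X Y : A} {m : prod X Y ⟶ X} {u : (one : A) ⟶ Y}
    (r : op m (𝟙 X) (const u X) ⟶ 𝟙 X) {D E : A} (f : D ⟶ E) (a : E ⟶ X) :
    HEq (f ◁ rightUnitAt r a) (rightUnitAt r (f ≫ a)) :=
  (hwl rfl (by simp) (by simp) (castHom_heq _ _ _)).trans
    ((comp_wl _ _ _).symm.trans (castHom_heq _ _ _).symm)

section

variable {C D : A} {m : prod C C ⟶ C} {n : prod D D ⟶ D} {F : C ⟶ D}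
  (φ : op n (fst C C ≫ F) (snd C C ≫ F) ⟶ op m (fst C C) (snd C C) ≫ F)

theorem wl_laxAt {E' E : A} (f : E' ⟶ E) (a b : E ⟶ C) :
    HEq (f ◁ laxAt φ a b) (laxAt φ (f ≫ a) (f ≫ b)) :=
  (hwl rfl (by simp) (by simp) (castHom_heq _ _ _)).trans
    ((comp_wl _ _ _).symm.trans
      ((hwl (by simp) rfl rfl HEq.rfl).trans (castHom_heq _ _ _).symm))

theorem hlaxAt {E : A} {a b a' b' : E ⟶ C} (ha : a = a') (hb : b = b') :
    HEq (laxAt φ a b) (laxAt φ a' b') := by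
  subst ha hb; rfl

theorem laxAt_fst_snd : laxAt φ (fst C C) (snd C C) = φ :=
  eq_of_heq ((castHom_heq _ _ _).trans
    ((hwl (pair_fst_snd C C) rfl rfl HEq.rfl).trans (id_wl _)))

theorem laxAt_naturality {E : A} {a b a' b' : E ⟶ C} (σ : a ⟶ a') (τ : b ⟶ b') :
    op₂ n (σ ▷ F) (τ ▷ F) ≫ laxAt φ a' b' = laxAt φ a b ≫ op₂ m σ τ ▷ F := by
  have h := whisker_exchange (pair₂ σ τ) φ
  refine eq_of_heq (HEq.trans ?_ ((heq_of_eq h.symm).trans ?_))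
  · refine hcomp (by simp) (by simp) (by simp) ?_ (castHom_heq _ _ _)
    refine HEq.trans (hop₂ n (by simp) (by simp) (by simp) (by simp) ?_ ?_) (wr_op _ _ _ _).symm
    · exact (hwr (by simp) (by simp) rfl (pair₂_fst σ τ).symm).trans (wr_comp _ _ _).symm
    · exact (hwr (by simp) (by simp) rfl (pair₂_snd σ τ).symm).trans (wr_comp _ _ _).symm
  · refine hcomp (by simp) (by simp) (by simp) (castHom_heq _ _ _).symm ?_
    refine (wr_comp _ _ _).trans (hwr (by simp) (by simp) rfl ?_)
    exact (wr_op _ _ _ _).trans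
      (hop₂ m (by simp) (by simp) (by simp) (by simp) (pair₂_fst σ τ) (pair₂_snd σ τ))

end

theorem wl_constAt {C D : A} {u : (one : A) ⟶ C} {z : (one : A) ⟶ D} {F : C ⟶ D}
    (φ₀ : z ⟶ u ≫ F) {E' E : A} (f : E' ⟶ E) : HEq (f ◁ constAt φ₀ E) (constAt φ₀ E') :=
  (hwl rfl (by simp [const]) (by simp) (castHom_heq _ _ _)).trans
    ((comp_wl _ _ _).symm.trans
      ((hwl (toOne_uniq _) rfl rfl HEq.rfl).trans (castHom_heq _ _ _).symm))

section

variable {C D X : A} {s : prod C X ⟶ X} {s' : prod D X ⟶ X} {F : C ⟶ D}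
    (ξ : op s' (fst C X ≫ F) (snd C X) ⟶ op s (fst C X) (snd C X))

theorem wl_actAt {E' E : A} (f : E' ⟶ E) (a : E ⟶ C) (x : E ⟶ X) :
    HEq (f ◁ actAt ξ a x) (actAt ξ (f ≫ a) (f ≫ x)) :=
  (hwl rfl (by simp) (by simp) (castHom_heq _ _ _)).trans
    ((comp_wl _ _ _).symm.trans
      ((hwl (by simp) rfl rfl HEq.rfl).trans (castHom_heq _ _ _).symm))

theorem hactAt {E : A} {a a' : E ⟶ C} {x x' : E ⟶ X} (ha : a = a') (hx : x = x') :
    HEq (actAt ξ a x) (actAt ξ a' x') := by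
  subst ha hx; rfl

theorem actAt_fst_snd : actAt ξ (fst C X) (snd C X) = ξ :=
  eq_of_heq ((castHom_heq _ _ _).trans
    ((hwl (pair_fst_snd C X) rfl rfl HEq.rfl).trans (id_wl _)))

theorem actAt_naturality {E : A} {a a' : E ⟶ C} {x x' : E ⟶ X} (σ : a ⟶ a') (τ : x ⟶ x') :
    op₂ s' (σ ▷ F) τ ≫ actAt ξ a' x' = actAt ξ a x ≫ op₂ s σ τ := by
  have h := whisker_exchange (pair₂ σ τ) ξ
  refine eq_of_heq (HEq.trans ?_ ((heq_of_eq h.symm).trans ?_))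
  · refine hcomp (by simp) (by simp) (by simp) ?_ (castHom_heq _ _ _)
    refine HEq.trans (hop₂ s' (by simp) (by simp) (by simp) (by simp) ?_ ?_)
      (wr_op _ _ _ _).symm
    · exact (hwr (by simp) (by simp) rfl (pair₂_fst σ τ).symm).trans (wr_comp _ _ _).symm
    · exact (pair₂_snd σ τ).symm
  · refine hcomp (by simp) (by simp) (by simp) (castHom_heq _ _ _).symm ?_
    exact (wr_op _ _ _ _).trans
      (hop₂ s (by simp) (by simp) (by simp) (by simp) (pair₂_fst σ τ) (pair₂_snd σ τ))

end

theorem assocAt_p {X Y Z U V W : A} {m : prod X V ⟶ W} {n : prod Y Z ⟶ V} {m' : prod U Z ⟶ W}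
    {k : prod X Y ⟶ U}
    (α : op m (p₁ X Y Z) (op n (p₂ X Y Z) (p₃ X Y Z)) ⟶
      op m' (op k (p₁ X Y Z) (p₂ X Y Z)) (p₃ X Y Z)) :
    assocAt α (p₁ X Y Z) (p₂ X Y Z) (p₃ X Y Z) = α := by
  refine eq_of_heq ((assocAt_heq _ _ _ _).trans ((hwl ?_ rfl rfl HEq.rfl).trans (id_wl _)))
  exact pair_uniq (by simp [p₁]) (pair_uniq (by simp [p₂]) (by simp [p₃]))

end Stages

open FiniteProducts

/-- A monoidal object: a 0-cell `C` with 1-cells `⊗ : C × C ⟶ C` and `I : 1 ⟶ C` and invertible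
2-cells `A ⊗ (B ⊗ C) ⟶ (A ⊗ B) ⊗ C`, `I ⊗ A ⟶ A` and `A ⊗ I ⟶ A` (the variables are the projections
of a power of `C`) satisfying the pentagon and triangle axioms. -/
structure MonoidalObject (A : Type u) [Bicategory.{w, v} A] [Bicategory.Strict A]
    [FiniteProducts A] where
  carrier : A
  tensor : prod carrier carrier ⟶ carrier
  unit : (one : A) ⟶ carrier
  assoc : op tensor (p₁ carrier carrier carrier) (op tensor (p₂ _ _ _) (p₃ _ _ _)) ≅
    op tensor (op tensor (p₁ _ _ _) (p₂ _ _ _)) (p₃ _ _ _)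
  lam : op tensor (const unit carrier) (𝟙 carrier) ≅ 𝟙 carrier
  rho : op tensor (𝟙 carrier) (const unit carrier) ≅ 𝟙 carrier
  pentagon :
    op₂ tensor (𝟙 (q₁ carrier carrier carrier carrier))
        (assocAt assoc.hom (q₂ _ _ _ _) (q₃ _ _ _ _) (q₄ _ _ _ _)) ≫
      assocAt assoc.hom (q₁ _ _ _ _) (op tensor (q₂ _ _ _ _) (q₃ _ _ _ _)) (q₄ _ _ _ _) ≫
        op₂ tensor (assocAt assoc.hom (q₁ _ _ _ _) (q₂ _ _ _ _) (q₃ _ _ _ _))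
          (𝟙 (q₄ _ _ _ _)) =
    assocAt assoc.hom (q₁ _ _ _ _) (q₂ _ _ _ _) (op tensor (q₃ _ _ _ _) (q₄ _ _ _ _)) ≫
      assocAt assoc.hom (op tensor (q₁ _ _ _ _) (q₂ _ _ _ _)) (q₃ _ _ _ _) (q₄ _ _ _ _)
  triangle :
    assocAt assoc.hom (fst carrier carrier) (const unit _) (snd carrier carrier) ≫
      op₂ tensor (rightUnitAt rho.hom (fst _ _)) (𝟙 (snd _ _)) =
    op₂ tensor (𝟙 (fst _ _)) (leftUnitAt lam.hom (snd _ _))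

section Mon

variable {A : Type u} [Bicategory.{w, v} A] [Bicategory.Strict A] [FiniteProducts A]

/-- A lax monoidal 1-cell: a 1-cell `F` with 2-cells `φ : F A ⊗' F B ⟶ F (A ⊗ B)` and
`φ₀ : I' ⟶ F I` compatible with the associativity and unit 2-cells. -/
@[ext]
structure LaxHom (M N : MonoidalObject A) where
  hom : M.carrier ⟶ N.carrier
  φ : op N.tensor (fst M.carrier M.carrier ≫ hom) (snd M.carrier M.carrier ≫ hom) ⟶
    op M.tensor (fst M.carrier M.carrier) (snd M.carrier M.carrier) ≫ hom
  φ₀ : N.unit ⟶ M.unit ≫ hom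
  map_assoc :
    assocAt N.assoc.hom (p₁ _ _ _ ≫ hom) (p₂ _ _ _ ≫ hom) (p₃ _ _ _ ≫ hom) ≫
      op₂ N.tensor (laxAt φ (p₁ M.carrier M.carrier M.carrier) (p₂ _ _ _)) (𝟙 (p₃ _ _ _ ≫ hom)) ≫
        laxAt φ (op M.tensor (p₁ _ _ _) (p₂ _ _ _)) (p₃ _ _ _) =
    op₂ N.tensor (𝟙 (p₁ _ _ _ ≫ hom)) (laxAt φ (p₂ _ _ _) (p₃ _ _ _)) ≫
      laxAt φ (p₁ _ _ _) (op M.tensor (p₂ _ _ _) (p₃ _ _ _)) ≫ M.assoc.hom ▷ hom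
  map_lam :
    op₂ N.tensor (constAt φ₀ M.carrier) (𝟙 (𝟙 M.carrier ≫ hom)) ≫
      laxAt φ (const M.unit M.carrier) (𝟙 M.carrier) ≫ M.lam.hom ▷ hom =
    leftUnitAt N.lam.hom (𝟙 M.carrier ≫ hom)
  map_rho :
    op₂ N.tensor (𝟙 (𝟙 M.carrier ≫ hom)) (constAt φ₀ M.carrier) ≫
      laxAt φ (𝟙 M.carrier) (const M.unit M.carrier) ≫ M.rho.hom ▷ hom =
    rightUnitAt N.rho.hom (𝟙 M.carrier ≫ hom)

/-- A monoidal transformation between lax monoidal 1-cells: a 2-cell `F ⟶ G` compatible with the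
structure 2-cells. -/
@[ext]
structure LaxHom₂ {M N : MonoidalObject A} (F G : LaxHom M N) where
  hom : F.hom ⟶ G.hom
  map_tensor :
    op₂ N.tensor (fst M.carrier M.carrier ◁ hom) (snd M.carrier M.carrier ◁ hom) ≫ G.φ =
      F.φ ≫ op M.tensor (fst _ _) (snd _ _) ◁ hom
  map_unit : F.φ₀ ≫ M.unit ◁ hom = G.φ₀

/-- A lax action of a monoidal object on a 0-cell `X`: a 1-cell `⋆ : C × X ⟶ X` with 2-cells
`ψ : A ⋆ (B ⋆ X) ⟶ (A ⊗ B) ⋆ X` and `ψ₀ : X ⟶ I ⋆ X` (not necessarily invertible), compatible with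
the associativity and unit 2-cells of the monoidal object. -/
@[ext]
structure Action (M : MonoidalObject A) (X : A) where
  act : prod M.carrier X ⟶ X
  ψ : op act (p₁ M.carrier M.carrier X) (op act (p₂ _ _ _) (p₃ _ _ _)) ⟶
    op act (op M.tensor (p₁ _ _ _) (p₂ _ _ _)) (p₃ _ _ _)
  ψ₀ : 𝟙 X ⟶ op act (const M.unit X) (𝟙 X)
  act_assoc :
    op₂ act (𝟙 (q₁ M.carrier M.carrier M.carrier X))
        (assocAt ψ (q₂ _ _ _ _) (q₃ _ _ _ _) (q₄ _ _ _ _)) ≫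
      assocAt ψ (q₁ _ _ _ _) (op M.tensor (q₂ _ _ _ _) (q₃ _ _ _ _)) (q₄ _ _ _ _) ≫
        op₂ act (assocAt M.assoc.hom (q₁ _ _ _ _) (q₂ _ _ _ _) (q₃ _ _ _ _))
          (𝟙 (q₄ _ _ _ _)) =
    assocAt ψ (q₁ _ _ _ _) (q₂ _ _ _ _) (op act (q₃ _ _ _ _) (q₄ _ _ _ _)) ≫
      assocAt ψ (op M.tensor (q₁ _ _ _ _) (q₂ _ _ _ _)) (q₃ _ _ _ _) (q₄ _ _ _ _)
  act_lam :
    leftCounitAt ψ₀ (op act (fst M.carrier X) (snd M.carrier X)) ≫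
      assocAt ψ (const M.unit _) (fst _ _) (snd _ _) ≫
        op₂ act (leftUnitAt M.lam.hom (fst _ _)) (𝟙 (snd _ _)) =
    𝟙 (op act (fst M.carrier X) (snd M.carrier X))
  act_rho :
    op₂ act (𝟙 (fst M.carrier X)) (leftCounitAt ψ₀ (snd M.carrier X)) ≫
      assocAt ψ (fst _ _) (const M.unit _) (snd _ _) ≫
        op₂ act (rightUnitAt M.rho.hom (fst _ _)) (𝟙 (snd _ _)) =
    𝟙 (op act (fst M.carrier X) (snd M.carrier X))

/-- A morphism of lax actions on `X`: a lax monoidal 1-cell `F` with a 2-cell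
`ξ : F A ⋆' X ⟶ A ⋆ X` compatible with the structure 2-cells of the actions. -/
structure ActHom {M N : MonoidalObject A} {X : A} (s : Action M X) (t : Action N X) where
  toLaxHom : LaxHom M N
  ξ : op t.act (fst M.carrier X ≫ toLaxHom.hom) (snd M.carrier X) ⟶
    op s.act (fst M.carrier X) (snd M.carrier X)
  map_act :
    assocAt t.ψ (p₁ M.carrier M.carrier X ≫ toLaxHom.hom) (p₂ _ _ _ ≫ toLaxHom.hom) (p₃ _ _ _) ≫
      op₂ t.act (laxAt toLaxHom.φ (p₁ _ _ _) (p₂ _ _ _)) (𝟙 (p₃ _ _ _)) ≫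
        actAt ξ (op M.tensor (p₁ _ _ _) (p₂ _ _ _)) (p₃ _ _ _) =
    op₂ t.act (𝟙 (p₁ _ _ _ ≫ toLaxHom.hom)) (actAt ξ (p₂ _ _ _) (p₃ _ _ _)) ≫
      actAt ξ (p₁ _ _ _) (op s.act (p₂ _ _ _) (p₃ _ _ _)) ≫ s.ψ
  map_unit :
    t.ψ₀ ≫ op₂ t.act (constAt toLaxHom.φ₀ X) (𝟙 (𝟙 X)) ≫ actAt ξ (const M.unit X) (𝟙 X) = s.ψ₀

end Mon

namespace LaxHom

variable {A : Type u} [Bicategory.{w, v} A] [Bicategory.Strict A] [FiniteProducts A]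
  {M N P Q : MonoidalObject A}

theorem hext {F G : LaxHom M N} (h : F.hom = G.hom) (hφ : HEq F.φ G.φ) (h₀ : HEq F.φ₀ G.φ₀) :
    F = G := by
  cases F; cases G; cases h; cases hφ; cases h₀; rfl

theorem map_assoc_at (F : LaxHom M N) {E : A} (a b c : E ⟶ M.carrier) :
    assocAt N.assoc.hom (a ≫ F.hom) (b ≫ F.hom) (c ≫ F.hom) ≫
      op₂ N.tensor (laxAt F.φ a b) (𝟙 (c ≫ F.hom)) ≫ laxAt F.φ (op M.tensor a b) c =
    op₂ N.tensor (𝟙 (a ≫ F.hom)) (laxAt F.φ b c) ≫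
      laxAt F.φ a (op M.tensor b c) ≫ assocAt M.assoc.hom a b c ▷ F.hom := by
  have h := congrArg (fun σ => pair a (pair b c) ◁ σ) F.map_assoc
  simp only [whiskerLeft_comp] at h
  refine eq_of_heq (HEq.trans ?_ ((heq_of_eq h).trans ?_))
  · refine hcomp (by simp) (by simp) (by simp) ?_
      (hcomp (by simp) (by simp) (by simp) ?_ ?_)
    · exact (hassocAt _ (by simp) (by simp) (by simp)).trans (wl_assocAt _ _ _ _ _).symm
    · refine HEq.trans (hop₂ _ (by simp) (by simp) (by simp) (by simp) ?_ ?_) (wl_op₂ _ _ _ _).symm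
      · exact (hlaxAt _ (by simp) (by simp)).trans (wl_laxAt _ _ _ _).symm
      · rw [whiskerLeft_id]; exact hid (by simp)
    · exact (hlaxAt _ (by simp) (by simp)).trans (wl_laxAt _ _ _ _).symm
  · refine hcomp (by simp) (by simp) (by simp) ?_
      (hcomp (by simp) (by simp) (by simp) ?_ ?_)
    · refine HEq.trans (wl_op₂ _ _ _ _) (hop₂ _ (by simp) (by simp) (by simp) (by simp) ?_ ?_)
      · rw [whiskerLeft_id]; exact hid (by simp)
      · exact (wl_laxAt _ _ _ _).trans (hlaxAt _ (by simp) (by simp))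
    · exact (wl_laxAt _ _ _ _).trans (hlaxAt _ (by simp) (by simp))
    · exact (wl_wr _ _ _).symm.trans (hwr (by simp) (by simp) rfl (assocAt_heq _ _ _ _).symm)

theorem map_lam_at (F : LaxHom M N) {E : A} (a : E ⟶ M.carrier) :
    op₂ N.tensor (constAt F.φ₀ E) (𝟙 (a ≫ F.hom)) ≫
      laxAt F.φ (const M.unit E) a ≫ leftUnitAt M.lam.hom a ▷ F.hom =
    leftUnitAt N.lam.hom (a ≫ F.hom) := by
  have h := congrArg (fun σ => a ◁ σ) F.map_lam
  simp only [whiskerLeft_comp] at h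
  refine eq_of_heq (HEq.trans ?_ ((heq_of_eq h).trans ?_))
  · refine hcomp (by simp) (by simp) (by simp) ?_
      (hcomp (by simp) (by simp) (by simp) ?_ ?_)
    · refine HEq.trans (hop₂ _ (by simp) (by simp) (by simp) (by simp) ?_ ?_) (wl_op₂ _ _ _ _).symm
      · exact (wl_constAt _ _).symm
      · rw [whiskerLeft_id]; exact hid (by simp)
    · exact (hlaxAt _ (by simp) (by simp)).trans (wl_laxAt _ _ _ _).symm
    · exact (hwr (by simp) (by simp) rfl (castHom_heq _ _ _)).trans (wl_wr _ _ _)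
  · refine (wl_leftUnitAt _ _ _).trans ?_
    rw [Strict.id_comp]

theorem map_rho_at (F : LaxHom M N) {E : A} (a : E ⟶ M.carrier) :
    op₂ N.tensor (𝟙 (a ≫ F.hom)) (constAt F.φ₀ E) ≫
      laxAt F.φ a (const M.unit E) ≫ rightUnitAt M.rho.hom a ▷ F.hom =
    rightUnitAt N.rho.hom (a ≫ F.hom) := by
  have h := congrArg (fun σ => a ◁ σ) F.map_rho
  simp only [whiskerLeft_comp] at h
  refine eq_of_heq (HEq.trans ?_ ((heq_of_eq h).trans ?_))
  · refine hcomp (by simp) (by simp) (by simp) ?_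
      (hcomp (by simp) (by simp) (by simp) ?_ ?_)
    · refine HEq.trans (hop₂ _ (by simp) (by simp) (by simp) (by simp) ?_ ?_) (wl_op₂ _ _ _ _).symm
      · rw [whiskerLeft_id]; exact hid (by simp)
      · exact (wl_constAt _ _).symm
    · exact (hlaxAt _ (by simp) (by simp)).trans (wl_laxAt _ _ _ _).symm
    · exact (hwr (by simp) (by simp) rfl (castHom_heq _ _ _)).trans (wl_wr _ _ _)
  · refine (wl_rightUnitAt _ _ _).trans ?_
    rw [Strict.id_comp]

/-- The tensor 2-cell of a composite of lax monoidal 1-cells. -/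
def compφ (F : LaxHom M N) (G : LaxHom N P) :
    op P.tensor (fst M.carrier M.carrier ≫ F.hom ≫ G.hom)
        (snd M.carrier M.carrier ≫ F.hom ≫ G.hom) ⟶
      op M.tensor (fst M.carrier M.carrier) (snd M.carrier M.carrier) ≫ F.hom ≫ G.hom :=
  castHom (laxAt G.φ (fst M.carrier M.carrier ≫ F.hom) (snd M.carrier M.carrier ≫ F.hom) ≫
    F.φ ▷ G.hom) (by simp) (by simp)

/-- The unit 2-cell of a composite of lax monoidal 1-cells. -/
def compφ₀ (F : LaxHom M N) (G : LaxHom N P) : P.unit ⟶ M.unit ≫ F.hom ≫ G.hom :=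
  castHom (G.φ₀ ≫ F.φ₀ ▷ G.hom) rfl (by simp)

theorem compφ_heq (F : LaxHom M N) (G : LaxHom N P) :
    HEq (compφ F G) (laxAt G.φ (fst M.carrier M.carrier ≫ F.hom)
      (snd M.carrier M.carrier ≫ F.hom) ≫ F.φ ▷ G.hom) := castHom_heq _ _ _

theorem compφ₀_heq (F : LaxHom M N) (G : LaxHom N P) :
    HEq (compφ₀ F G) (G.φ₀ ≫ F.φ₀ ▷ G.hom) := castHom_heq _ _ _

theorem laxAt_compφ (F : LaxHom M N) (G : LaxHom N P) {E : A} (a b : E ⟶ M.carrier) :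
    HEq (laxAt (compφ F G) a b)
      (laxAt G.φ (a ≫ F.hom) (b ≫ F.hom) ≫ laxAt F.φ a b ▷ G.hom) := by
  refine (castHom_heq _ _ _).trans ((hwl rfl (by simp) (by simp) (castHom_heq _ _ _)).trans ?_)
  rw [whiskerLeft_comp]
  refine hcomp (by simp) (by simp) (by simp) ?_ ?_
  · exact (wl_laxAt _ _ _ _).trans (hlaxAt _ (by simp) (by simp))
  · exact (wl_wr _ _ _).symm.trans (hwr (by simp) (by simp) rfl (castHom_heq _ _ _).symm)

theorem constAt_compφ₀ (F : LaxHom M N) (G : LaxHom N P) (E : A) :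
    HEq (constAt (compφ₀ F G) E) (constAt G.φ₀ E ≫ constAt F.φ₀ E ▷ G.hom) := by
  refine (castHom_heq _ _ _).trans ((hwl rfl rfl (by simp) (castHom_heq _ _ _)).trans ?_)
  rw [whiskerLeft_comp]
  refine hcomp rfl (by simp) (by simp) (castHom_heq _ _ _).symm ?_
  exact (wl_wr _ _ _).symm.trans (hwr rfl (by simp) rfl (castHom_heq _ _ _).symm)

theorem comp_key (F : LaxHom M N) (G : LaxHom N P) {E : A} (a b c : E ⟶ M.carrier) :
    assocAt P.assoc.hom ((a ≫ F.hom) ≫ G.hom) ((b ≫ F.hom) ≫ G.hom) ((c ≫ F.hom) ≫ G.hom) ≫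
      op₂ P.tensor (laxAt G.φ (a ≫ F.hom) (b ≫ F.hom) ≫ laxAt F.φ a b ▷ G.hom)
        (𝟙 ((c ≫ F.hom) ≫ G.hom) ≫ 𝟙 ((c ≫ F.hom) ≫ G.hom)) ≫
        (laxAt G.φ (op M.tensor a b ≫ F.hom) (c ≫ F.hom) ≫
          laxAt F.φ (op M.tensor a b) c ▷ G.hom) =
    op₂ P.tensor (𝟙 ((a ≫ F.hom) ≫ G.hom) ≫ 𝟙 ((a ≫ F.hom) ≫ G.hom))
        (laxAt G.φ (b ≫ F.hom) (c ≫ F.hom) ≫ laxAt F.φ b c ▷ G.hom) ≫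
      (laxAt G.φ (a ≫ F.hom) (op M.tensor b c ≫ F.hom) ≫
        laxAt F.φ a (op M.tensor b c) ▷ G.hom) ≫ assocAt M.assoc.hom a b c ▷ F.hom ▷ G.hom := by
  have hG := G.map_assoc_at (a ≫ F.hom) (b ≫ F.hom) (c ≫ F.hom)
  have hF := congrArg (fun σ => σ ▷ G.hom) (F.map_assoc_at a b c)
  simp only [comp_whiskerRight] at hF
  have n₁ := laxAt_naturality G.φ (laxAt F.φ a b) (𝟙 (c ≫ F.hom))
  have n₂ := laxAt_naturality G.φ (𝟙 (a ≫ F.hom)) (laxAt F.φ b c)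
  rw [id_whiskerRight] at n₁ n₂
  rw [op₂_comp, op₂_comp]
  simp only [assoc₂]
  rw [reassoc_of% n₁, reassoc_of% n₂, reassoc_of% hG, hF]

/-- Composition of lax monoidal 1-cells. -/
@[simps]
def comp (F : LaxHom M N) (G : LaxHom N P) : LaxHom M P where
  hom := F.hom ≫ G.hom
  φ := compφ F G
  φ₀ := compφ₀ F G
  map_assoc := by
    have key := comp_key F G (p₁ M.carrier M.carrier M.carrier) (p₂ _ _ _) (p₃ _ _ _)
    rw [assocAt_p] at key
    refine eq_of_heq (HEq.trans ?_ ((heq_of_eq key).trans ?_))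
    · refine hcomp (by simp) (by simp) (by simp) (hassocAt _ (by simp) (by simp) (by simp))
        (hcomp (by simp) (by simp) (by simp) ?_ (laxAt_compφ _ _ _ _))
      refine hop₂ _ (by simp) (by simp) (by simp) (by simp) (laxAt_compφ _ _ _ _) ?_
      rw [Category.comp_id]; exact hid (by simp)
    · refine hcomp (by simp) (by simp) (by simp) ?_ (hcomp (by simp) (by simp) (by simp)
        (laxAt_compφ _ _ _ _).symm (wr_comp _ _ _).symm)
      refine hop₂ _ (by simp) (by simp) (by simp) (by simp) ?_ (laxAt_compφ _ _ _ _).symm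
      rw [Category.comp_id]; exact hid (by simp)
  map_lam := by
    have hG := G.map_lam_at (𝟙 M.carrier ≫ F.hom)
    have hF := congrArg (fun σ => σ ▷ G.hom) F.map_lam
    simp only [comp_whiskerRight] at hF
    have n₁ := laxAt_naturality G.φ (constAt F.φ₀ M.carrier) (𝟙 (𝟙 M.carrier ≫ F.hom))
    have key : op₂ P.tensor (constAt G.φ₀ M.carrier ≫ constAt F.φ₀ M.carrier ▷ G.hom)
          (𝟙 ((𝟙 M.carrier ≫ F.hom) ≫ G.hom) ≫ 𝟙 ((𝟙 M.carrier ≫ F.hom) ≫ G.hom)) ≫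
        (laxAt G.φ (const M.unit M.carrier ≫ F.hom) (𝟙 M.carrier ≫ F.hom) ≫
          laxAt F.φ (const M.unit M.carrier) (𝟙 M.carrier) ▷ G.hom) ≫
          M.lam.hom ▷ F.hom ▷ G.hom =
        leftUnitAt P.lam.hom ((𝟙 M.carrier ≫ F.hom) ≫ G.hom) := by
      rw [id_whiskerRight] at n₁
      rw [op₂_comp]
      simp only [assoc₂]
      rw [reassoc_of% n₁, hF, hG]
    refine eq_of_heq (HEq.trans ?_ ((heq_of_eq key).trans ?_))
    · refine hcomp (by simp) (by simp) (by simp) ?_ (hcomp (by simp) (by simp) (by simp)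
        (laxAt_compφ _ _ _ _) (wr_comp _ _ _))
      refine hop₂ _ rfl (by simp) (by simp) (by simp) (constAt_compφ₀ _ _ _) ?_
      rw [Category.comp_id]; exact hid (by simp)
    · rw [Strict.assoc]
  map_rho := by
    have hG := G.map_rho_at (𝟙 M.carrier ≫ F.hom)
    have hF := congrArg (fun σ => σ ▷ G.hom) F.map_rho
    simp only [comp_whiskerRight] at hF
    have n₁ := laxAt_naturality G.φ (𝟙 (𝟙 M.carrier ≫ F.hom)) (constAt F.φ₀ M.carrier)
    have key : op₂ P.tensor
          (𝟙 ((𝟙 M.carrier ≫ F.hom) ≫ G.hom) ≫ 𝟙 ((𝟙 M.carrier ≫ F.hom) ≫ G.hom))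
          (constAt G.φ₀ M.carrier ≫ constAt F.φ₀ M.carrier ▷ G.hom) ≫
        (laxAt G.φ (𝟙 M.carrier ≫ F.hom) (const M.unit M.carrier ≫ F.hom) ≫
          laxAt F.φ (𝟙 M.carrier) (const M.unit M.carrier) ▷ G.hom) ≫
          M.rho.hom ▷ F.hom ▷ G.hom =
        rightUnitAt P.rho.hom ((𝟙 M.carrier ≫ F.hom) ≫ G.hom) := by
      rw [id_whiskerRight] at n₁
      rw [op₂_comp]
      simp only [assoc₂]
      rw [reassoc_of% n₁, hF, hG]
    refine eq_of_heq (HEq.trans ?_ ((heq_of_eq key).trans ?_))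
    · refine hcomp (by simp) (by simp) (by simp) ?_ (hcomp (by simp) (by simp) (by simp)
        (laxAt_compφ _ _ _ _) (wr_comp _ _ _))
      refine hop₂ _ (by simp) (by simp) rfl (by simp) ?_ (constAt_compφ₀ _ _ _)
      rw [Category.comp_id]; exact hid (by simp)
    · rw [Strict.assoc]

/-- The tensor 2-cell of the identity. -/
def idφ (M : MonoidalObject A) :
    op M.tensor (fst M.carrier M.carrier ≫ 𝟙 M.carrier) (snd M.carrier M.carrier ≫ 𝟙 M.carrier) ⟶
      op M.tensor (fst M.carrier M.carrier) (snd M.carrier M.carrier) ≫ 𝟙 M.carrier :=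
  castHom (𝟙 (op M.tensor (fst _ _) (snd _ _))) (by simp) (by simp)

/-- The unit 2-cell of the identity. -/
def idφ₀ (M : MonoidalObject A) : M.unit ⟶ M.unit ≫ 𝟙 M.carrier :=
  castHom (𝟙 M.unit) rfl (by simp)

theorem idφ_heq (M : MonoidalObject A) :
    HEq (idφ M) (𝟙 (op M.tensor (fst _ _) (snd _ _))) := castHom_heq _ _ _

theorem idφ₀_heq (M : MonoidalObject A) : HEq (idφ₀ M) (𝟙 M.unit) := castHom_heq _ _ _

theorem laxAt_idφ {E : A} (a b : E ⟶ M.carrier) :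
    HEq (laxAt (idφ M) a b) (𝟙 (op M.tensor a b)) := by
  refine (castHom_heq _ _ _).trans ((hwl rfl (by simp) (by simp) (castHom_heq _ _ _)).trans ?_)
  rw [whiskerLeft_id]
  exact hid (by simp)

theorem constAt_idφ₀ (M : MonoidalObject A) (E : A) :
    HEq (constAt (idφ₀ M) E) (𝟙 (const M.unit E)) := by
  refine (castHom_heq _ _ _).trans ((hwl rfl rfl (by simp) (castHom_heq _ _ _)).trans ?_)
  rw [whiskerLeft_id]
  rfl

/-- The identity lax monoidal 1-cell. -/
@[simps]
def id (M : MonoidalObject A) : LaxHom M M where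
  hom := 𝟙 M.carrier
  φ := idφ M
  φ₀ := idφ₀ M
  map_assoc := by
    have key {a b c : prod M.carrier (prod M.carrier M.carrier) ⟶ M.carrier} :
        assocAt M.assoc.hom a b c ≫ op₂ M.tensor (𝟙 (op M.tensor a b)) (𝟙 c) ≫
          𝟙 (op M.tensor (op M.tensor a b) c) =
        op₂ M.tensor (𝟙 a) (𝟙 (op M.tensor b c)) ≫ 𝟙 (op M.tensor a (op M.tensor b c)) ≫
          assocAt M.assoc.hom a b c := by
      simp only [op₂_id, Category.id_comp, Category.comp_id]
    have key := key (a := p₁ M.carrier M.carrier M.carrier) (b := p₂ _ _ _) (c := p₃ _ _ _)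
    rw [assocAt_p] at key
    refine eq_of_heq (HEq.trans ?_ ((heq_of_eq key).trans ?_))
    · refine hcomp (by simp) (by simp) (by simp) ?_ (hcomp (by simp) (by simp) (by simp) ?_ ?_)
      · exact (hassocAt _ (by simp) (by simp) (by simp)).trans (heq_of_eq (assocAt_p _))
      · exact hop₂ _ (by simp) (by simp) (by simp) (by simp) (laxAt_idφ _ _) (hid (by simp))
      · exact laxAt_idφ _ _
    · refine hcomp (by simp) (by simp) (by simp) ?_ (hcomp (by simp) (by simp) (by simp) ?_ ?_)
      · exact hop₂ _ (by simp) (by simp) (by simp) (by simp) (hid (by simp))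
          (laxAt_idφ _ _).symm
      · exact (laxAt_idφ _ _).symm
      · exact (wr_id _).symm
  map_lam := by
    have key : op₂ M.tensor (𝟙 (const M.unit M.carrier)) (𝟙 (𝟙 M.carrier)) ≫
        𝟙 (op M.tensor (const M.unit M.carrier) (𝟙 M.carrier)) ≫ M.lam.hom = M.lam.hom := by
      rw [op₂_id, Category.id_comp, Category.id_comp]
    refine eq_of_heq (HEq.trans ?_ ((heq_of_eq key).trans ?_))
    · refine hcomp (by simp) (by simp) (by simp) ?_ (hcomp (by simp) (by simp) (by simp) ?_ ?_)
      · exact hop₂ _ (by simp) (by simp) (by simp) (by simp) (constAt_idφ₀ _ _) (hid (by simp))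
      · exact laxAt_idφ _ _
      · exact wr_id _
    · refine HEq.symm ((castHom_heq _ _ _).trans ?_)
      rw [Strict.id_comp]; exact id_wl _
  map_rho := by
    have key : op₂ M.tensor (𝟙 (𝟙 M.carrier)) (𝟙 (const M.unit M.carrier)) ≫
        𝟙 (op M.tensor (𝟙 M.carrier) (const M.unit M.carrier)) ≫ M.rho.hom = M.rho.hom := by
      rw [op₂_id, Category.id_comp, Category.id_comp]
    refine eq_of_heq (HEq.trans ?_ ((heq_of_eq key).trans ?_))
    · refine hcomp (by simp) (by simp) (by simp) ?_ (hcomp (by simp) (by simp) (by simp) ?_ ?_)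
      · exact hop₂ _ (by simp) (by simp) (by simp) (by simp) (hid (by simp)) (constAt_idφ₀ _ _)
      · exact laxAt_idφ _ _
      · exact wr_id _
    · refine HEq.symm ((castHom_heq _ _ _).trans ?_)
      rw [Strict.id_comp]; exact id_wl _

theorem id_comp' (F : LaxHom M N) : comp (id M) F = F := by
  refine hext (Strict.id_comp _) ?_ ?_
  · refine (compφ_heq _ _).trans ?_
    have key : F.φ ≫ 𝟙 _ = F.φ := Category.comp_id _
    refine HEq.trans ?_ (heq_of_eq key)
    refine hcomp (by simp) (by simp) (by simp) ?_ ?_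
    · exact (hlaxAt _ (by simp) (by simp)).trans (heq_of_eq (laxAt_fst_snd _))
    · refine (hwr (by simp) (by simp) rfl (idφ_heq _)).trans ?_
      rw [id_whiskerRight]
  · refine (compφ₀_heq _ _).trans ?_
    have key : F.φ₀ ≫ 𝟙 _ = F.φ₀ := Category.comp_id _
    refine HEq.trans ?_ (heq_of_eq key)
    refine hcomp (by simp) (by simp) (by simp) HEq.rfl ?_
    refine (hwr (by simp) (by simp) rfl (idφ₀_heq _)).trans ?_
    rw [id_whiskerRight]

theorem comp_id' (F : LaxHom M N) : comp F (id N) = F := by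
  refine hext (Strict.comp_id _) ?_ ?_
  · refine (compφ_heq _ _).trans ?_
    have key : 𝟙 _ ≫ F.φ = F.φ := Category.id_comp _
    exact HEq.trans (hcomp (by simp) (by simp) (by simp) (laxAt_idφ _ _) (wr_id _))
      (heq_of_eq key)
  · refine (compφ₀_heq _ _).trans ?_
    have key : 𝟙 _ ≫ F.φ₀ = F.φ₀ := Category.id_comp _
    exact HEq.trans (hcomp (by simp) (by simp) (by simp) (idφ₀_heq _) (wr_id _))
      (heq_of_eq key)

theorem comp_assoc' (F : LaxHom M N) (G : LaxHom N P) (H : LaxHom P Q) :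
    comp (comp F G) H = comp F (comp G H) := by
  refine hext (Strict.assoc _ _ _) ?_ ?_
  · refine (compφ_heq _ _).trans (HEq.trans ?_ (compφ_heq _ _).symm)
    have key : laxAt H.φ ((fst M.carrier M.carrier ≫ F.hom) ≫ G.hom)
          ((snd M.carrier M.carrier ≫ F.hom) ≫ G.hom) ≫
        (laxAt G.φ (fst M.carrier M.carrier ≫ F.hom)
          (snd M.carrier M.carrier ≫ F.hom) ≫ F.φ ▷ G.hom) ▷ H.hom =
        (laxAt H.φ ((fst M.carrier M.carrier ≫ F.hom) ≫ G.hom)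
          ((snd M.carrier M.carrier ≫ F.hom) ≫ G.hom) ≫
        laxAt G.φ (fst M.carrier M.carrier ≫ F.hom)
          (snd M.carrier M.carrier ≫ F.hom) ▷ H.hom) ≫ F.φ ▷ G.hom ▷ H.hom := by
      rw [comp_whiskerRight, assoc₂]
    refine HEq.trans ?_ ((heq_of_eq key).trans ?_)
    · exact hcomp (by simp) (by simp) (by simp) (hlaxAt _ (by simp) (by simp))
        (hwr (by simp) (by simp) rfl (compφ_heq _ _))
    · exact hcomp (by simp) (by simp) (by simp) (laxAt_compφ _ _ _ _).symm (wr_comp _ _ _).symm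
  · refine (compφ₀_heq _ _).trans (HEq.trans ?_ (compφ₀_heq _ _).symm)
    have key : H.φ₀ ≫ (G.φ₀ ≫ F.φ₀ ▷ G.hom) ▷ H.hom =
        (H.φ₀ ≫ G.φ₀ ▷ H.hom) ≫ F.φ₀ ▷ G.hom ▷ H.hom := by
      rw [comp_whiskerRight, assoc₂]
    refine HEq.trans ?_ ((heq_of_eq key).trans ?_)
    · exact hcomp rfl rfl (by simp) HEq.rfl (hwr rfl (by simp) rfl (compφ₀_heq _ _))
    · exact hcomp rfl (by simp) (by simp) (compφ₀_heq _ _).symm (wr_comp _ _ _).symm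

end LaxHom

namespace LaxHom₂

variable {A : Type u} [Bicategory.{w, v} A] [Bicategory.Strict A] [FiniteProducts A]
  {M N P Q : MonoidalObject A}

theorem map_tensor_at {F G : LaxHom M N} (τ : LaxHom₂ F G) {E : A} (a b : E ⟶ M.carrier) :
    op₂ N.tensor (a ◁ τ.hom) (b ◁ τ.hom) ≫ laxAt G.φ a b =
      laxAt F.φ a b ≫ op M.tensor a b ◁ τ.hom := by
  have h := congrArg (fun σ => pair a b ◁ σ) τ.map_tensor
  simp only [whiskerLeft_comp] at h
  refine eq_of_heq (HEq.trans ?_ ((heq_of_eq h).trans ?_))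
  · refine hcomp (by simp) (by simp) (by simp) ?_ (castHom_heq _ _ _)
    refine HEq.trans (hop₂ _ (by simp) (by simp) (by simp) (by simp) ?_ ?_) (wl_op₂ _ _ _ _).symm
    · exact (hwl (by simp) rfl rfl HEq.rfl).trans (comp_wl _ _ _)
    · exact (hwl (by simp) rfl rfl HEq.rfl).trans (comp_wl _ _ _)
  · refine hcomp (by simp) (by simp) (by simp) (castHom_heq _ _ _).symm ?_
    exact (comp_wl _ _ _).symm.trans (hwl (by simp) rfl rfl HEq.rfl)

theorem map_unit_at {F G : LaxHom M N} (τ : LaxHom₂ F G) (E : A) :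
    constAt F.φ₀ E ≫ const M.unit E ◁ τ.hom = constAt G.φ₀ E := by
  have h := congrArg (fun σ => toOne E ◁ σ) τ.map_unit
  simp only [whiskerLeft_comp] at h
  refine eq_of_heq (HEq.trans ?_ ((heq_of_eq h).trans (castHom_heq _ _ _).symm))
  exact hcomp rfl (by simp) (by simp) (castHom_heq _ _ _) (comp_wl _ _ _)

/-- The 2-cell given by an equality of lax monoidal 1-cells. -/
def ofEq {F G : LaxHom M N} (h : F = G) (σ : F.hom ⟶ G.hom)
    (hσ : σ = eqToHom (congrArg LaxHom.hom h)) : LaxHom₂ F G where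
  hom := σ
  map_tensor := by
    subst h; subst hσ
    simp [op₂_id]
  map_unit := by
    subst h; subst hσ
    simp

@[simp]
theorem ofEq_hom {F G : LaxHom M N} (h : F = G) (σ : F.hom ⟶ G.hom)
    (hσ : σ = eqToHom (congrArg LaxHom.hom h)) : (ofEq h σ hσ).hom = σ := rfl

@[simps]
def id (F : LaxHom M N) : LaxHom₂ F F where
  hom := 𝟙 F.hom
  map_tensor := by simp [op₂_id]
  map_unit := by simp

@[simps]
def comp {F G H : LaxHom M N} (σ : LaxHom₂ F G) (τ : LaxHom₂ G H) : LaxHom₂ F H where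
  hom := σ.hom ≫ τ.hom
  map_tensor := by
    rw [whiskerLeft_comp, whiskerLeft_comp, op₂_comp, assoc₂, τ.map_tensor,
      ← assoc₂, σ.map_tensor, assoc₂, ← whiskerLeft_comp]
  map_unit := by
    rw [whiskerLeft_comp, ← assoc₂, σ.map_unit, τ.map_unit]

/-- Left whiskering of monoidal transformations. -/
@[simps]
def whiskerLeft (F : LaxHom M N) {G H : LaxHom N P} (τ : LaxHom₂ G H) :
    LaxHom₂ (LaxHom.comp F G) (LaxHom.comp F H) where
  hom := F.hom ◁ τ.hom
  map_tensor := by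
    have h := τ.map_tensor_at (fst M.carrier M.carrier ≫ F.hom) (snd M.carrier M.carrier ≫ F.hom)
    have e := whisker_exchange F.φ τ.hom
    have key : op₂ P.tensor ((fst M.carrier M.carrier ≫ F.hom) ◁ τ.hom)
          ((snd M.carrier M.carrier ≫ F.hom) ◁ τ.hom) ≫
        (laxAt H.φ (fst M.carrier M.carrier ≫ F.hom) (snd M.carrier M.carrier ≫ F.hom) ≫
          F.φ ▷ H.hom) =
        (laxAt G.φ (fst M.carrier M.carrier ≫ F.hom) (snd M.carrier M.carrier ≫ F.hom) ≫
          F.φ ▷ G.hom) ≫ (op M.tensor (fst _ _) (snd _ _) ≫ F.hom) ◁ τ.hom := by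
      rw [reassoc_of% h, e, assoc₂]
    refine eq_of_heq (HEq.trans ?_ ((heq_of_eq key).trans ?_))
    · exact hcomp (by simp) (by simp) (by simp) (hop₂ _ (by simp) (by simp) (by simp) (by simp)
        (comp_wl _ _ _).symm (comp_wl _ _ _).symm) (LaxHom.compφ_heq _ _)
    · exact hcomp (by simp) (by simp) (by simp) (LaxHom.compφ_heq _ _).symm (comp_wl _ _ _)
  map_unit := by
    have e := whisker_exchange F.φ₀ τ.hom
    have key : (G.φ₀ ≫ F.φ₀ ▷ G.hom) ≫ (M.unit ≫ F.hom) ◁ τ.hom = H.φ₀ ≫ F.φ₀ ▷ H.hom := by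
      rw [assoc₂, ← e, ← assoc₂, τ.map_unit]
    refine eq_of_heq (HEq.trans ?_ ((heq_of_eq key).trans (LaxHom.compφ₀_heq _ _).symm))
    exact hcomp rfl (by simp) (by simp) (LaxHom.compφ₀_heq _ _) (comp_wl _ _ _).symm

/-- Right whiskering of monoidal transformations. -/
@[simps]
def whiskerRight {F G : LaxHom M N} (τ : LaxHom₂ F G) (H : LaxHom N P) :
    LaxHom₂ (LaxHom.comp F H) (LaxHom.comp G H) where
  hom := τ.hom ▷ H.hom
  map_tensor := by
    have h := congrArg (fun σ => σ ▷ H.hom) τ.map_tensor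
    simp only [comp_whiskerRight] at h
    have n := laxAt_naturality H.φ (fst M.carrier M.carrier ◁ τ.hom)
      (snd M.carrier M.carrier ◁ τ.hom)
    have key : op₂ P.tensor ((fst M.carrier M.carrier ◁ τ.hom) ▷ H.hom)
          ((snd M.carrier M.carrier ◁ τ.hom) ▷ H.hom) ≫
        (laxAt H.φ (fst M.carrier M.carrier ≫ G.hom) (snd M.carrier M.carrier ≫ G.hom) ≫
          G.φ ▷ H.hom) =
        (laxAt H.φ (fst M.carrier M.carrier ≫ F.hom) (snd M.carrier M.carrier ≫ F.hom) ≫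
          F.φ ▷ H.hom) ≫ (op M.tensor (fst _ _) (snd _ _) ◁ τ.hom) ▷ H.hom := by
      rw [reassoc_of% n, h, assoc₂]
    refine eq_of_heq (HEq.trans ?_ ((heq_of_eq key).trans ?_))
    · exact hcomp (by simp) (by simp) (by simp) (hop₂ _ (by simp) (by simp) (by simp) (by simp)
        (wl_wr _ _ _).symm (wl_wr _ _ _).symm) (LaxHom.compφ_heq _ _)
    · exact hcomp (by simp) (by simp) (by simp) (LaxHom.compφ_heq _ _).symm (wl_wr _ _ _)
  map_unit := by
    have h := congrArg (fun σ => σ ▷ H.hom) τ.map_unit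
    simp only [comp_whiskerRight] at h
    have key : (H.φ₀ ≫ F.φ₀ ▷ H.hom) ≫ (M.unit ◁ τ.hom) ▷ H.hom = H.φ₀ ≫ G.φ₀ ▷ H.hom := by
      rw [assoc₂, h]
    refine eq_of_heq (HEq.trans ?_ ((heq_of_eq key).trans (LaxHom.compφ₀_heq _ _).symm))
    exact hcomp rfl (by simp) (by simp) (LaxHom.compφ₀_heq _ _) (wl_wr _ _ _).symm

end LaxHom₂

namespace MonoidalObject

variable {A : Type u} [Bicategory.{w, v} A] [Bicategory.Strict A] [FiniteProducts A]

instance : CategoryStruct (MonoidalObject A) where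
  Hom := LaxHom
  id := LaxHom.id
  comp := LaxHom.comp

instance (M N : MonoidalObject A) : Category (M ⟶ N) where
  Hom F G := LaxHom₂ F G
  id F := LaxHom₂.id F
  comp σ τ := LaxHom₂.comp σ τ
  id_comp _ := LaxHom₂.ext (Category.id_comp _)
  comp_id _ := LaxHom₂.ext (Category.comp_id _)
  assoc _ _ _ := LaxHom₂.ext (Category.assoc _ _ _)

/-- An invertible 2-cell of `Mon_l(A)` given by an equality of 1-cells. -/
@[simps]
def isoOfEq {M N : MonoidalObject A} {F G : M ⟶ N} (h : F = G) (e : LaxHom.hom F ≅ LaxHom.hom G)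
    (he : e = eqToIso (congrArg LaxHom.hom h)) : F ≅ G where
  hom := LaxHom₂.ofEq h e.hom (by rw [he]; rfl)
  inv := LaxHom₂.ofEq h.symm e.inv (by rw [he]; rfl)
  hom_inv_id := LaxHom₂.ext e.hom_inv_id
  inv_hom_id := LaxHom₂.ext e.inv_hom_id

/-- The 2-category `Mon_l(A)` of monoidal objects, lax monoidal 1-cells and monoidal
transformations. -/
instance : Bicategory (MonoidalObject A) where
  whiskerLeft F _ _ τ := LaxHom₂.whiskerLeft F τ
  whiskerRight τ H := LaxHom₂.whiskerRight τ H
  associator F G H := isoOfEq (LaxHom.comp_assoc' F G H) (α_ (LaxHom.hom F) _ _)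
    (Strict.associator_eqToIso _ _ _)
  leftUnitor F := isoOfEq (LaxHom.id_comp' F) (λ_ (LaxHom.hom F)) (Strict.leftUnitor_eqToIso _)
  rightUnitor F := isoOfEq (LaxHom.comp_id' F) (ρ_ (LaxHom.hom F)) (Strict.rightUnitor_eqToIso _)
  whiskerLeft_id _ _ := LaxHom₂.ext (whiskerLeft_id _ _)
  whiskerLeft_comp _ _ _ _ _ _ := LaxHom₂.ext (whiskerLeft_comp _ _ _)
  id_whiskerLeft _ := LaxHom₂.ext (id_whiskerLeft _)
  comp_whiskerLeft _ _ _ _ _ := LaxHom₂.ext (comp_whiskerLeft _ _ _)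
  id_whiskerRight _ _ := LaxHom₂.ext (id_whiskerRight _ _)
  comp_whiskerRight _ _ _ := LaxHom₂.ext (comp_whiskerRight _ _ _)
  whiskerRight_id _ := LaxHom₂.ext (whiskerRight_id _)
  whiskerRight_comp _ _ _ := LaxHom₂.ext (whiskerRight_comp _ _ _)
  whisker_assoc _ _ _ _ _ := LaxHom₂.ext (whisker_assoc _ _ _)
  whisker_exchange _ _ := LaxHom₂.ext (whisker_exchange _ _)
  pentagon _ _ _ _ := LaxHom₂.ext (Bicategory.pentagon _ _ _ _)
  triangle _ _ := LaxHom₂.ext (Bicategory.triangle _ _)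

theorem isoOfEq_eq {M N : MonoidalObject A} {F G : M ⟶ N} (h : F = G)
    (e : LaxHom.hom F ≅ LaxHom.hom G) (he : e = eqToIso (congrArg LaxHom.hom h)) :
    isoOfEq h e he = eqToIso h := by
  subst h; subst he; rfl

instance : Bicategory.Strict (MonoidalObject A) where
  id_comp F := LaxHom.id_comp' F
  comp_id F := LaxHom.comp_id' F
  assoc F G H := LaxHom.comp_assoc' F G H
  leftUnitor_eqToIso _ := isoOfEq_eq _ _ _
  rightUnitor_eqToIso _ := isoOfEq_eq _ _ _
  associator_eqToIso _ _ _ := isoOfEq_eq _ _ _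

end MonoidalObject

/-- A 0-cell of the lax slice of a 2-category `B` over a 0-cell `Z`: a 1-cell with codomain `Z`. -/
structure LaxSlice {B : Type u} [Bicategory.{w, v} B] (Z : B) where
  left : B
  arr : left ⟶ Z

namespace LaxSlice

variable {B : Type u} [Bicategory.{w, v} B] {Z : B}

/-- A 1-cell `(F, θ) : (B, b) ⟶ (C, c)` of the lax slice: `F : B ⟶ C` and `θ : c ∘ F ⟶ b`. -/
structure Hom (b c : LaxSlice Z) where
  left : b.left ⟶ c.left
  θ : left ≫ c.arr ⟶ b.arr

/-- A 2-cell `τ : (F, θ) ⟶ (F', θ')` of the lax slice: a 2-cell `τ : F ⟶ F'` with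
`θ' ∘ c(τ) = θ`. -/
@[ext]
structure Hom₂ {b c : LaxSlice Z} (f g : Hom b c) where
  left : f.left ⟶ g.left
  w : left ▷ c.arr ≫ g.θ = f.θ

@[simps]
def Hom.id (b : LaxSlice Z) : Hom b b where
  left := 𝟙 b.left
  θ := (λ_ b.arr).hom

@[simps]
def Hom.comp {b c d : LaxSlice Z} (f : Hom b c) (g : Hom c d) : Hom b d where
  left := f.left ≫ g.left
  θ := (α_ f.left g.left d.arr).hom ≫ f.left ◁ g.θ ≫ f.θ

theorem Hom.hext {b c : LaxSlice Z} {f g : Hom b c} (h : f.left = g.left) (hθ : HEq f.θ g.θ) :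
    f = g := by
  cases f; cases g; cases h; cases hθ; rfl

@[simps]
def Hom₂.whiskerLeft {b c d : LaxSlice Z} (f : Hom b c) {g h : Hom c d} (τ : Hom₂ g h) :
    Hom₂ (f.comp g) (f.comp h) where
  left := f.left ◁ τ.left
  w := by
    change (f.left ◁ τ.left) ▷ d.arr ≫ (α_ f.left h.left d.arr).hom ≫ f.left ◁ h.θ ≫ f.θ =
      (α_ f.left g.left d.arr).hom ≫ f.left ◁ g.θ ≫ f.θ
    rw [← τ.w, associator_naturality_middle_assoc, whiskerLeft_comp, assoc₂]

@[simps]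
def Hom₂.whiskerRight {b c d : LaxSlice Z} {f g : Hom b c} (τ : Hom₂ f g) (h : Hom c d) :
    Hom₂ (f.comp h) (g.comp h) where
  left := τ.left ▷ h.left
  w := by
    change τ.left ▷ h.left ▷ d.arr ≫ (α_ g.left h.left d.arr).hom ≫ g.left ◁ h.θ ≫ g.θ =
      (α_ f.left h.left d.arr).hom ≫ f.left ◁ h.θ ≫ f.θ
    rw [← τ.w, associator_naturality_left_assoc, ← whisker_exchange_assoc]

/-- A compatible invertible 2-cell of `B` is an invertible 2-cell of the lax slice. -/
theorem Hom₂.w_inv {b c : LaxSlice Z} {f g : Hom b c} (e : f.left ≅ g.left)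
    (h : e.hom ▷ c.arr ≫ g.θ = f.θ) : e.inv ▷ c.arr ≫ f.θ = g.θ := by
  rw [← h, inv_hom_whiskerRight_assoc]

theorem Hom.assoc_w {a b c d : LaxSlice Z} (f : Hom a b) (g : Hom b c) (h : Hom c d) :
    (α_ f.left g.left h.left).hom ▷ d.arr ≫ (f.comp (g.comp h)).θ = ((f.comp g).comp h).θ := by
  change (α_ f.left g.left h.left).hom ▷ d.arr ≫ (α_ f.left (g.left ≫ h.left) d.arr).hom ≫
      f.left ◁ ((α_ g.left h.left d.arr).hom ≫ g.left ◁ h.θ ≫ g.θ) ≫ f.θ =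
    (α_ (f.left ≫ g.left) h.left d.arr).hom ≫ (f.left ≫ g.left) ◁ h.θ ≫
      (α_ f.left g.left c.arr).hom ≫ f.left ◁ g.θ ≫ f.θ
  simp

theorem Hom.left_w {a b : LaxSlice Z} (f : Hom a b) :
    (λ_ f.left).hom ▷ b.arr ≫ f.θ = ((Hom.id a).comp f).θ := by
  change _ = (α_ (𝟙 a.left) f.left b.arr).hom ≫ 𝟙 a.left ◁ f.θ ≫ (λ_ a.arr).hom
  simp

theorem Hom.right_w {a b : LaxSlice Z} (f : Hom a b) :
    (ρ_ f.left).hom ▷ b.arr ≫ f.θ = (f.comp (Hom.id b)).θ := by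
  change _ = (α_ f.left (𝟙 b.left) b.arr).hom ≫ f.left ◁ (λ_ b.arr).hom ≫ f.θ
  simp

instance : CategoryStruct (LaxSlice Z) where
  Hom := Hom
  id := Hom.id
  comp := Hom.comp

instance (b c : LaxSlice Z) : Category (b ⟶ c) where
  Hom f g := Hom₂ f g
  id f := ⟨𝟙 _, by simp⟩
  comp σ τ := ⟨σ.left ≫ τ.left, by rw [comp_whiskerRight, assoc₂, τ.w, σ.w]⟩
  id_comp _ := Hom₂.ext (Category.id_comp _)
  comp_id _ := Hom₂.ext (Category.comp_id _)
  assoc _ _ _ := Hom₂.ext (Category.assoc _ _ _)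

@[simps]
def mkIso {b c : LaxSlice Z} {f g : b ⟶ c} (e : Hom.left f ≅ Hom.left g)
    (h : e.hom ▷ c.arr ≫ Hom.θ g = Hom.θ f) : f ≅ g where
  hom := Hom₂.mk e.hom h
  inv := Hom₂.mk e.inv (Hom₂.w_inv e h)
  hom_inv_id := Hom₂.ext e.hom_inv_id
  inv_hom_id := Hom₂.ext e.inv_hom_id

/-- The lax slice 2-category of `B` over `Z`. -/
instance : Bicategory (LaxSlice Z) where
  whiskerLeft f _ _ τ := Hom₂.whiskerLeft f τ
  whiskerRight τ h := Hom₂.whiskerRight τ h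
  associator f g h := mkIso (α_ (Hom.left f) (Hom.left g) (Hom.left h)) (Hom.assoc_w f g h)
  leftUnitor f := mkIso (λ_ (Hom.left f)) (Hom.left_w f)
  rightUnitor f := mkIso (ρ_ (Hom.left f)) (Hom.right_w f)
  whiskerLeft_id _ _ := Hom₂.ext (whiskerLeft_id _ _)
  whiskerLeft_comp _ _ _ _ _ _ := Hom₂.ext (whiskerLeft_comp _ _ _)
  id_whiskerLeft _ := Hom₂.ext (id_whiskerLeft _)
  comp_whiskerLeft _ _ _ _ _ := Hom₂.ext (comp_whiskerLeft _ _ _)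
  id_whiskerRight _ _ := Hom₂.ext (id_whiskerRight _ _)
  comp_whiskerRight _ _ _ := Hom₂.ext (comp_whiskerRight _ _ _)
  whiskerRight_id _ := Hom₂.ext (whiskerRight_id _)
  whiskerRight_comp _ _ _ := Hom₂.ext (whiskerRight_comp _ _ _)
  whisker_assoc _ _ _ _ _ := Hom₂.ext (whisker_assoc _ _ _)
  whisker_exchange _ _ := Hom₂.ext (whisker_exchange _ _)
  pentagon _ _ _ _ := Hom₂.ext (Bicategory.pentagon _ _ _ _)
  triangle _ _ := Hom₂.ext (Bicategory.triangle _ _)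

theorem mkIso_eq {b c : LaxSlice Z} {f g : b ⟶ c} (h : f = g) (e : Hom.left f ≅ Hom.left g)
    (w : e.hom ▷ c.arr ≫ Hom.θ g = Hom.θ f) (he : e = eqToIso (congrArg Hom.left h)) :
    mkIso e w = eqToIso h := by
  subst h; subst he; rfl

theorem Hom.ext_of_iso {b c : LaxSlice Z} {f g : Hom b c} (h : f.left = g.left)
    (w : eqToHom h ▷ c.arr ≫ g.θ = f.θ) : f = g := by
  obtain ⟨f, θ⟩ := f
  obtain ⟨g, θ'⟩ := g
  dsimp at h
  subst h
  simp at w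
  rw [w]

theorem Hom.eq_of_iso {b c : LaxSlice Z} {f g : b ⟶ c} (i : f ≅ g) (h : Hom.left f = Hom.left g)
    (hi : Hom₂.left i.hom = eqToHom h) : f = g :=
  Hom.ext_of_iso h (by rw [← hi]; exact Hom₂.w i.hom)

instance [Bicategory.Strict B] : Bicategory.Strict (LaxSlice Z) where
  id_comp f := Hom.eq_of_iso (λ_ f) (Strict.id_comp _)
    (congrArg Iso.hom (Strict.leftUnitor_eqToIso (Hom.left f)))
  comp_id f := Hom.eq_of_iso (ρ_ f) (Strict.comp_id _)
    (congrArg Iso.hom (Strict.rightUnitor_eqToIso (Hom.left f)))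
  assoc f g h := Hom.eq_of_iso (α_ f g h) (Strict.assoc _ _ _)
    (congrArg Iso.hom (Strict.associator_eqToIso (Hom.left f) (Hom.left g) (Hom.left h)))
  leftUnitor_eqToIso _ := mkIso_eq _ _ _ (Strict.leftUnitor_eqToIso _)
  rightUnitor_eqToIso _ := mkIso_eq _ _ _ (Strict.rightUnitor_eqToIso _)
  associator_eqToIso _ _ _ := mkIso_eq _ _ _ (Strict.associator_eqToIso _ _ _)

end LaxSlice

/-! Actions on a fixed 0-cell -/

namespace ActHom

variable {A : Type u} [Bicategory.{w, v} A] [Bicategory.Strict A] [FiniteProducts A] {X : A}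
  {M N P Q : MonoidalObject A} {s : Action M X} {t : Action N X} {r : Action P X} {q : Action Q X}

theorem hext {f g : ActHom s t} (h : f.toLaxHom = g.toLaxHom) (hξ : HEq f.ξ g.ξ) : f = g := by
  cases f; cases g; cases h; cases hξ; rfl

theorem map_act_at (f : ActHom s t) {E : A} (a b : E ⟶ M.carrier) (x : E ⟶ X) :
    assocAt t.ψ (a ≫ f.toLaxHom.hom) (b ≫ f.toLaxHom.hom) x ≫
      op₂ t.act (laxAt f.toLaxHom.φ a b) (𝟙 x) ≫ actAt f.ξ (op M.tensor a b) x =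
    op₂ t.act (𝟙 (a ≫ f.toLaxHom.hom)) (actAt f.ξ b x) ≫
      actAt f.ξ a (op s.act b x) ≫ assocAt s.ψ a b x := by
  have h := congrArg (fun σ => pair a (pair b x) ◁ σ) f.map_act
  simp only [whiskerLeft_comp] at h
  refine eq_of_heq (HEq.trans ?_ ((heq_of_eq h).trans ?_))
  · refine hcomp (by simp) (by simp) (by simp) ?_
      (hcomp (by simp) (by simp) (by simp) ?_ ?_)
    · exact (hassocAt _ (by simp) (by simp) (by simp)).trans (wl_assocAt _ _ _ _ _).symm
    · refine HEq.trans (hop₂ _ (by simp) (by simp) (by simp) (by simp) ?_ ?_) (wl_op₂ _ _ _ _).symm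
      · exact (hlaxAt _ (by simp) (by simp)).trans (wl_laxAt _ _ _ _).symm
      · rw [whiskerLeft_id]; exact hid (by simp)
    · exact (hactAt _ (by simp) (by simp)).trans (wl_actAt _ _ _ _).symm
  · refine hcomp (by simp) (by simp) (by simp) ?_
      (hcomp (by simp) (by simp) (by simp) ?_ ?_)
    · refine HEq.trans (wl_op₂ _ _ _ _) (hop₂ _ (by simp) (by simp) (by simp) (by simp) ?_ ?_)
      · rw [whiskerLeft_id]; exact hid (by simp)
      · exact (wl_actAt _ _ _ _).trans (hactAt _ (by simp) (by simp))
    · exact (wl_actAt _ _ _ _).trans (hactAt _ (by simp) (by simp))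
    · exact (assocAt_heq _ _ _ _).symm

/-- The structure 2-cell of a composite of morphisms of actions. -/
def compξ (f : ActHom s t) (g : ActHom t r) :
    op r.act (fst M.carrier X ≫ (f.toLaxHom.comp g.toLaxHom).hom) (snd M.carrier X) ⟶
      op s.act (fst M.carrier X) (snd M.carrier X) :=
  castHom (actAt g.ξ (fst M.carrier X ≫ f.toLaxHom.hom) (snd M.carrier X) ≫ f.ξ)
    (by simp) rfl

theorem compξ_heq (f : ActHom s t) (g : ActHom t r) :
    HEq (compξ f g) (actAt g.ξ (fst M.carrier X ≫ f.toLaxHom.hom) (snd M.carrier X) ≫ f.ξ) :=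
  castHom_heq _ _ _

theorem actAt_compξ (f : ActHom s t) (g : ActHom t r) {E : A} (a : E ⟶ M.carrier) (x : E ⟶ X) :
    HEq (actAt (compξ f g) a x) (actAt g.ξ (a ≫ f.toLaxHom.hom) x ≫ actAt f.ξ a x) := by
  refine (castHom_heq _ _ _).trans ((hwl rfl (by simp) (by simp) (compξ_heq _ _)).trans ?_)
  rw [whiskerLeft_comp]
  refine hcomp (by simp) (by simp) (by simp) ?_ (castHom_heq _ _ _).symm
  exact (wl_actAt _ _ _ _).trans (hactAt _ (by simp) (by simp))

theorem comp_key (f : ActHom s t) (g : ActHom t r) {E : A} (a b : E ⟶ M.carrier) (x : E ⟶ X) :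
    assocAt r.ψ ((a ≫ f.toLaxHom.hom) ≫ g.toLaxHom.hom)
        ((b ≫ f.toLaxHom.hom) ≫ g.toLaxHom.hom) x ≫
      op₂ r.act (laxAt g.toLaxHom.φ (a ≫ f.toLaxHom.hom) (b ≫ f.toLaxHom.hom) ≫
        laxAt f.toLaxHom.φ a b ▷ g.toLaxHom.hom) (𝟙 x ≫ 𝟙 x) ≫
        (actAt g.ξ (op M.tensor a b ≫ f.toLaxHom.hom) x ≫ actAt f.ξ (op M.tensor a b) x) =
    op₂ r.act (𝟙 ((a ≫ f.toLaxHom.hom) ≫ g.toLaxHom.hom) ≫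
        𝟙 ((a ≫ f.toLaxHom.hom) ≫ g.toLaxHom.hom))
        (actAt g.ξ (b ≫ f.toLaxHom.hom) x ≫ actAt f.ξ b x) ≫
      (actAt g.ξ (a ≫ f.toLaxHom.hom) (op s.act b x) ≫ actAt f.ξ a (op s.act b x)) ≫
        assocAt s.ψ a b x := by
  have hg := g.map_act_at (a ≫ f.toLaxHom.hom) (b ≫ f.toLaxHom.hom) x
  have hf := f.map_act_at a b x
  have n₁ := actAt_naturality g.ξ (laxAt f.toLaxHom.φ a b) (𝟙 x)
  have n₂ := actAt_naturality g.ξ (𝟙 (a ≫ f.toLaxHom.hom)) (actAt f.ξ b x)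
  rw [id_whiskerRight] at n₂
  rw [op₂_comp, op₂_comp]
  simp only [assoc₂]
  rw [reassoc_of% n₁, reassoc_of% n₂, reassoc_of% hg, hf]

/-- Composition of morphisms of actions. -/
@[simps]
def comp (f : ActHom s t) (g : ActHom t r) : ActHom s r where
  toLaxHom := f.toLaxHom.comp g.toLaxHom
  ξ := compξ f g
  map_act := by
    have key := comp_key f g (p₁ M.carrier M.carrier X) (p₂ _ _ _) (p₃ _ _ _)
    rw [assocAt_p] at key
    refine eq_of_heq (HEq.trans ?_ ((heq_of_eq key).trans ?_))
    · refine hcomp (by simp) (by simp) (by simp) (hassocAt _ (by simp) (by simp) (by simp))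
        (hcomp (by simp) (by simp) (by simp) ?_ (actAt_compξ _ _ _ _))
      refine hop₂ _ (by simp) (by simp) (by simp) (by simp) (LaxHom.laxAt_compφ _ _ _ _) ?_
      rw [Category.comp_id]
    · refine hcomp (by simp) (by simp) (by simp) ?_ (hcomp (by simp) (by simp) (by simp)
        (actAt_compξ _ _ _ _).symm HEq.rfl)
      refine hop₂ _ (by simp) (by simp) (by simp) (by simp) ?_ (actAt_compξ _ _ _ _).symm
      rw [Category.comp_id]; exact hid (by simp)
  map_unit := by
    have hg := g.map_unit
    have hf := f.map_unit
    have n₁ := actAt_naturality g.ξ (constAt f.toLaxHom.φ₀ X) (𝟙 (𝟙 X))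
    have key : r.ψ₀ ≫ op₂ r.act (constAt g.toLaxHom.φ₀ X ≫
          constAt f.toLaxHom.φ₀ X ▷ g.toLaxHom.hom) (𝟙 (𝟙 X) ≫ 𝟙 (𝟙 X)) ≫
        (actAt g.ξ (const M.unit X ≫ f.toLaxHom.hom) (𝟙 X) ≫
          actAt f.ξ (const M.unit X) (𝟙 X)) = s.ψ₀ := by
      rw [op₂_comp]
      simp only [assoc₂]
      rw [reassoc_of% n₁, reassoc_of% hg, hf]
    refine eq_of_heq (HEq.trans ?_ (heq_of_eq key))
    refine hcomp rfl rfl rfl HEq.rfl (hcomp rfl (by simp) rfl ?_ (actAt_compξ _ _ _ _))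
    refine hop₂ _ rfl (by simp) rfl rfl (LaxHom.constAt_compφ₀ _ _ _) ?_
    rw [Category.comp_id]

/-- The structure 2-cell of the identity. -/
def idξ (s : Action M X) :
    op s.act (fst M.carrier X ≫ (LaxHom.id M).hom) (snd M.carrier X) ⟶
      op s.act (fst M.carrier X) (snd M.carrier X) :=
  castHom (𝟙 (op s.act (fst M.carrier X) (snd M.carrier X))) (by simp) rfl

theorem idξ_heq (s : Action M X) :
    HEq (idξ s) (𝟙 (op s.act (fst M.carrier X) (snd M.carrier X))) :=
  castHom_heq _ _ _

theorem actAt_idξ (s : Action M X) {E : A} (a : E ⟶ M.carrier) (x : E ⟶ X) :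
    HEq (actAt (idξ s) a x) (𝟙 (op s.act a x)) := by
  refine (castHom_heq _ _ _).trans ((hwl rfl (by simp) (by simp) (idξ_heq _)).trans ?_)
  rw [whiskerLeft_id]
  exact hid (by simp)

/-- The identity morphism of actions. -/
@[simps]
def id (s : Action M X) : ActHom s s where
  toLaxHom := LaxHom.id M
  ξ := idξ s
  map_act := by
    have key {a b : prod M.carrier (prod M.carrier X) ⟶ M.carrier}
        {x : prod M.carrier (prod M.carrier X) ⟶ X} :
        assocAt s.ψ a b x ≫ op₂ s.act (𝟙 (op M.tensor a b)) (𝟙 x) ≫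
          𝟙 (op s.act (op M.tensor a b) x) =
        op₂ s.act (𝟙 a) (𝟙 (op s.act b x)) ≫ 𝟙 (op s.act a (op s.act b x)) ≫
          assocAt s.ψ a b x := by
      simp only [op₂_id, Category.id_comp, Category.comp_id]
    have key := key (a := p₁ M.carrier M.carrier X) (b := p₂ _ _ _) (x := p₃ _ _ _)
    rw [assocAt_p] at key
    refine eq_of_heq (HEq.trans ?_ ((heq_of_eq key).trans ?_))
    · refine hcomp (by simp) (by simp) (by simp) ?_ (hcomp (by simp) (by simp) (by simp) ?_ ?_)
      · exact (hassocAt _ (by simp) (by simp) (by simp)).trans (heq_of_eq (assocAt_p _))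
      · exact hop₂ _ (by simp) (by simp) (by simp) (by simp) (LaxHom.laxAt_idφ _ _) HEq.rfl
      · exact actAt_idξ _ _ _
    · refine hcomp (by simp) (by simp) (by simp) ?_ (hcomp (by simp) (by simp) (by simp) ?_ HEq.rfl)
      · exact hop₂ _ (by simp) (by simp) (by simp) (by simp) (hid (by simp))
          (actAt_idξ _ _ _).symm
      · exact (actAt_idξ _ _ _).symm
  map_unit := by
    have key : s.ψ₀ ≫ op₂ s.act (𝟙 (const M.unit X)) (𝟙 (𝟙 X)) ≫
        𝟙 (op s.act (const M.unit X) (𝟙 X)) = s.ψ₀ := by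
      simp only [op₂_id, Category.comp_id]
    refine eq_of_heq (HEq.trans ?_ (heq_of_eq key))
    refine hcomp rfl rfl rfl HEq.rfl (hcomp rfl (by simp) rfl ?_ (actAt_idξ _ _ _))
    exact hop₂ _ rfl (by simp) rfl rfl (LaxHom.constAt_idφ₀ _ _) HEq.rfl

theorem id_comp' (f : ActHom s t) : comp (id s) f = f := by
  refine hext (LaxHom.id_comp' _) ((compξ_heq _ _).trans ?_)
  have key : f.ξ ≫ 𝟙 _ = f.ξ := Category.comp_id _
  refine HEq.trans ?_ (heq_of_eq key)
  refine hcomp (by simp) (by simp) (by simp) ?_ (idξ_heq _)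
  exact (hactAt _ (by simp) (by simp)).trans (heq_of_eq (actAt_fst_snd _))

theorem comp_id' (f : ActHom s t) : comp f (id t) = f := by
  refine hext (LaxHom.comp_id' _) ((compξ_heq _ _).trans ?_)
  have key : 𝟙 _ ≫ f.ξ = f.ξ := Category.id_comp _
  exact HEq.trans (hcomp (by simp) (by simp) (by simp) (actAt_idξ _ _ _) HEq.rfl) (heq_of_eq key)

theorem comp_assoc' (f : ActHom s t) (g : ActHom t r) (h : ActHom r q) :
    comp (comp f g) h = comp f (comp g h) := by
  refine hext (LaxHom.comp_assoc' _ _ _)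
    ((compξ_heq _ _).trans (HEq.trans ?_ (compξ_heq _ _).symm))
  have key : actAt h.ξ ((fst M.carrier X ≫ f.toLaxHom.hom) ≫ g.toLaxHom.hom) (snd M.carrier X) ≫
      (actAt g.ξ (fst M.carrier X ≫ f.toLaxHom.hom) (snd M.carrier X) ≫ f.ξ) =
      (actAt h.ξ ((fst M.carrier X ≫ f.toLaxHom.hom) ≫ g.toLaxHom.hom) (snd M.carrier X) ≫
      actAt g.ξ (fst M.carrier X ≫ f.toLaxHom.hom) (snd M.carrier X)) ≫ f.ξ := by
    rw [assoc₂]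
  refine HEq.trans ?_ ((heq_of_eq key).trans ?_)
  · exact hcomp (by simp) (by simp) (by simp) (hactAt _ (by simp) (by simp)) (compξ_heq _ _)
  · exact hcomp (by simp) (by simp) (by simp) (actAt_compξ _ _ _ _).symm HEq.rfl

end ActHom

/-- A transformation of morphisms of actions: a monoidal transformation compatible with the
structure 2-cells `ξ`. -/
structure ActHom₂ {A : Type u} [Bicategory.{w, v} A] [Bicategory.Strict A] [FiniteProducts A]
    {X : A} {M N : MonoidalObject A} {s : Action M X} {t : Action N X} (f g : ActHom s t) where
  toLaxHom₂ : LaxHom₂ f.toLaxHom g.toLaxHom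
  map_act : op₂ t.act (fst M.carrier X ◁ toLaxHom₂.hom) (𝟙 (snd M.carrier X)) ≫ g.ξ = f.ξ

namespace ActHom₂

variable {A : Type u} [Bicategory.{w, v} A] [Bicategory.Strict A] [FiniteProducts A] {X : A}
  {M N P Q : MonoidalObject A} {s : Action M X} {t : Action N X} {r : Action P X} {q : Action Q X}

theorem ext {f g : ActHom s t} {σ τ : ActHom₂ f g} (h : σ.toLaxHom₂.hom = τ.toLaxHom₂.hom) :
    σ = τ := by
  obtain ⟨σ, _⟩ := σ
  obtain ⟨τ, _⟩ := τ
  obtain rfl : σ = τ := LaxHom₂.ext h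
  rfl

theorem map_act_at {f g : ActHom s t} (τ : ActHom₂ f g) {E : A} (a : E ⟶ M.carrier) (x : E ⟶ X) :
    op₂ t.act (a ◁ τ.toLaxHom₂.hom) (𝟙 x) ≫ actAt g.ξ a x = actAt f.ξ a x := by
  have h := congrArg (fun σ => pair a x ◁ σ) τ.map_act
  simp only [whiskerLeft_comp] at h
  refine eq_of_heq (HEq.trans ?_ ((heq_of_eq h).trans (castHom_heq _ _ _).symm))
  refine hcomp (by simp) (by simp) (by simp) ?_ (castHom_heq _ _ _)
  refine HEq.trans (hop₂ _ (by simp) (by simp) (by simp) (by simp) ?_ ?_) (wl_op₂ _ _ _ _).symm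
  · exact (hwl (by simp) rfl rfl HEq.rfl).trans (comp_wl _ _ _)
  · rw [whiskerLeft_id]; exact hid (by simp)

@[simps]
def id (f : ActHom s t) : ActHom₂ f f where
  toLaxHom₂ := LaxHom₂.id f.toLaxHom
  map_act := by simp [op₂_id]

@[simps]
def comp {f g h : ActHom s t} (σ : ActHom₂ f g) (τ : ActHom₂ g h) : ActHom₂ f h where
  toLaxHom₂ := LaxHom₂.comp σ.toLaxHom₂ τ.toLaxHom₂
  map_act := by
    have e : 𝟙 (snd M.carrier X) = 𝟙 (snd M.carrier X) ≫ 𝟙 (snd M.carrier X) :=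
      (Category.comp_id _).symm
    rw [LaxHom₂.comp_hom, whiskerLeft_comp, e, op₂_comp, assoc₂, τ.map_act, σ.map_act]

/-- The 2-cell given by an equality of morphisms of actions. -/
def ofEq {f g : ActHom s t} (h : f = g) (σ : LaxHom₂ f.toLaxHom g.toLaxHom)
    (hσ : σ.hom = eqToHom (congrArg (fun k => k.toLaxHom.hom) h)) : ActHom₂ f g where
  toLaxHom₂ := σ
  map_act := by
    subst h
    rw [hσ]
    simp [op₂_id]

/-- Left whiskering of transformations. -/
@[simps]
def whiskerLeft (f : ActHom s t) {g h : ActHom t r} (τ : ActHom₂ g h) :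
    ActHom₂ (f.comp g) (f.comp h) where
  toLaxHom₂ := LaxHom₂.whiskerLeft f.toLaxHom τ.toLaxHom₂
  map_act := by
    have e := τ.map_act_at (fst M.carrier X ≫ f.toLaxHom.hom) (snd M.carrier X)
    have key : op₂ r.act ((fst M.carrier X ≫ f.toLaxHom.hom) ◁ τ.toLaxHom₂.hom)
          (𝟙 (snd M.carrier X)) ≫
        (actAt h.ξ (fst M.carrier X ≫ f.toLaxHom.hom) (snd M.carrier X) ≫ f.ξ) =
        actAt g.ξ (fst M.carrier X ≫ f.toLaxHom.hom) (snd M.carrier X) ≫ f.ξ := by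
      rw [reassoc_of% e]
    refine eq_of_heq (HEq.trans ?_ ((heq_of_eq key).trans (ActHom.compξ_heq _ _).symm))
    exact hcomp (by simp) (by simp) (by simp) (hop₂ _ (by simp) (by simp) (by simp) (by simp)
      (comp_wl _ _ _).symm HEq.rfl) (ActHom.compξ_heq _ _)

/-- Right whiskering of transformations. -/
@[simps]
def whiskerRight {f g : ActHom s t} (τ : ActHom₂ f g) (h : ActHom t r) :
    ActHom₂ (f.comp h) (g.comp h) where
  toLaxHom₂ := LaxHom₂.whiskerRight τ.toLaxHom₂ h.toLaxHom
  map_act := by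
    have e := actAt_naturality h.ξ (fst M.carrier X ◁ τ.toLaxHom₂.hom) (𝟙 (snd M.carrier X))
    have key : op₂ r.act ((fst M.carrier X ◁ τ.toLaxHom₂.hom) ▷ h.toLaxHom.hom)
          (𝟙 (snd M.carrier X)) ≫
        (actAt h.ξ (fst M.carrier X ≫ g.toLaxHom.hom) (snd M.carrier X) ≫ g.ξ) =
        actAt h.ξ (fst M.carrier X ≫ f.toLaxHom.hom) (snd M.carrier X) ≫ f.ξ := by
      rw [reassoc_of% e, τ.map_act]
    refine eq_of_heq (HEq.trans ?_ ((heq_of_eq key).trans (ActHom.compξ_heq _ _).symm))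
    exact hcomp (by simp) (by simp) (by simp) (hop₂ _ (by simp) (by simp) (by simp) (by simp)
      (wl_wr _ _ _).symm HEq.rfl) (ActHom.compξ_heq _ _)

end ActHom₂

/-- The 0-cells of `Act_l Mon_l(A, X)`: a monoidal object together with a lax action on `X`. -/
structure LaxAction {A : Type u} [Bicategory.{w, v} A] [Bicategory.Strict A] [FiniteProducts A]
    (X : A) where
  mon : MonoidalObject A
  action : Action mon X

namespace LaxAction

variable {A : Type u} [Bicategory.{w, v} A] [Bicategory.Strict A] [FiniteProducts A] {X : A}

instance : CategoryStruct (LaxAction X) where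
  Hom s t := ActHom s.action t.action
  id s := ActHom.id s.action
  comp f g := ActHom.comp f g

instance (s t : LaxAction X) : Category (s ⟶ t) where
  Hom f g := ActHom₂ f g
  id f := ActHom₂.id f
  comp σ τ := ActHom₂.comp σ τ
  id_comp _ := ActHom₂.ext (Category.id_comp _)
  comp_id _ := ActHom₂.ext (Category.comp_id _)
  assoc _ _ _ := ActHom₂.ext (Category.assoc _ _ _)

/-- The lax monoidal 1-cell underlying a morphism of actions. -/
def under {s t : LaxAction X} (f : s ⟶ t) : s.mon ⟶ t.mon := ActHom.toLaxHom f

theorem eqToHom_hom {M N : MonoidalObject A} {F G : M ⟶ N} (h : F = G) :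
    LaxHom₂.hom (eqToHom h) = eqToHom (congrArg LaxHom.hom h) := by
  subst h; rfl

/-- An invertible 2-cell of `Act_l Mon_l(A, X)` given by an equality of 1-cells. -/
def isoOfEq {s t : LaxAction X} {f g : s ⟶ t} (h : f = g)
    (e : under f ≅ under g)
    (he : e = eqToIso (congrArg under h)) : f ≅ g where
  hom := ActHom₂.ofEq h e.hom (by rw [he]; exact eqToHom_hom (congrArg under h))
  inv := ActHom₂.ofEq h.symm e.inv (by rw [he]; exact eqToHom_hom (congrArg under h.symm))
  hom_inv_id := ActHom₂.ext (congrArg LaxHom₂.hom e.hom_inv_id)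
  inv_hom_id := ActHom₂.ext (congrArg LaxHom₂.hom e.inv_hom_id)

/-- The 2-category `Act_l Mon_l(A, X)` of lax actions of monoidal objects on `X`. -/
instance : Bicategory (LaxAction X) where
  whiskerLeft f _ _ τ := ActHom₂.whiskerLeft f τ
  whiskerRight τ h := ActHom₂.whiskerRight τ h
  associator f g h := isoOfEq (ActHom.comp_assoc' f g h) (α_ (under f) (under g) (under h))
    (Strict.associator_eqToIso _ _ _)
  leftUnitor f := isoOfEq (ActHom.id_comp' f) (λ_ (under f)) (Strict.leftUnitor_eqToIso _)
  rightUnitor f := isoOfEq (ActHom.comp_id' f) (ρ_ (under f)) (Strict.rightUnitor_eqToIso _)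
  whiskerLeft_id _ _ := ActHom₂.ext (whiskerLeft_id _ _)
  whiskerLeft_comp _ _ _ _ _ _ := ActHom₂.ext (whiskerLeft_comp _ _ _)
  id_whiskerLeft _ := ActHom₂.ext (id_whiskerLeft _)
  comp_whiskerLeft _ _ _ _ _ := ActHom₂.ext (comp_whiskerLeft _ _ _)
  id_whiskerRight _ _ := ActHom₂.ext (id_whiskerRight _ _)
  comp_whiskerRight _ _ _ := ActHom₂.ext (comp_whiskerRight _ _ _)
  whiskerRight_id _ := ActHom₂.ext (whiskerRight_id _)
  whiskerRight_comp _ _ _ := ActHom₂.ext (whiskerRight_comp _ _ _)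
  whisker_assoc _ _ _ _ _ := ActHom₂.ext (whisker_assoc _ _ _)
  whisker_exchange _ _ := ActHom₂.ext (whisker_exchange _ _)
  pentagon _ _ _ _ := ActHom₂.ext (Bicategory.pentagon _ _ _ _)
  triangle _ _ := ActHom₂.ext (Bicategory.triangle _ _)

theorem isoOfEq_eq {s t : LaxAction X} {f g : s ⟶ t} (h : f = g)
    (e : under f ≅ under g)
    (he : e = eqToIso (congrArg under h)) : isoOfEq h e he = eqToIso h := by
  subst h; subst he; rfl

instance : Bicategory.Strict (LaxAction X) where
  id_comp f := ActHom.id_comp' f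
  comp_id f := ActHom.comp_id' f
  assoc f g h := ActHom.comp_assoc' f g h
  leftUnitor_eqToIso _ := isoOfEq_eq _ _ _
  rightUnitor_eqToIso _ := isoOfEq_eq _ _ _
  associator_eqToIso _ _ _ := isoOfEq_eq _ _ _

end LaxAction

/-! Exponentials -/

section Exp

variable {A : Type u} [Bicategory.{w, v} A] [FiniteProducts A]

/-- The 1-cell `ev ∘ (r × 1) : E × X ⟶ Y` for `r : E ⟶ H` and `ev : H × X ⟶ Y`. -/
def evAt {H X Y E : A} (ev : prod H X ⟶ Y) (r : E ⟶ H) : prod E X ⟶ Y :=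
  op ev (fst E X ≫ r) (snd E X)

/-- The 2-cell `ev ∘ (σ × 1)`. -/
def evAt₂ {H X Y E : A} (ev : prod H X ⟶ Y) {r r' : E ⟶ H} (σ : r ⟶ r') :
    evAt ev r ⟶ evAt ev r' :=
  op₂ ev (fst E X ◁ σ) (𝟙 (snd E X))

/-- An exponential `Y ^ X` in the strict 2-categorical sense: for all `E`, the functor
`ev ∘ (- × 1) : A(E, Y ^ X) ⥤ A(E × X, Y)` is an isomorphism of categories. -/
structure Exponential (X Y : A) where
  obj : A
  ev : prod obj X ⟶ Y
  curry {E : A} (f : prod E X ⟶ Y) : E ⟶ obj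
  evAt_curry {E : A} (f : prod E X ⟶ Y) : evAt ev (curry f) = f
  evAt_injective {E : A} {r r' : E ⟶ obj} : evAt ev r = evAt ev r' → r = r'
  curry₂ {E : A} {r r' : E ⟶ obj} (σ : evAt ev r ⟶ evAt ev r') : r ⟶ r'
  evAt₂_curry₂ {E : A} {r r' : E ⟶ obj} (σ : evAt ev r ⟶ evAt ev r') : evAt₂ ev (curry₂ σ) = σ
  evAt₂_injective {E : A} {r r' : E ⟶ obj} {σ τ : r ⟶ r'} : evAt₂ ev σ = evAt₂ ev τ → σ = τ

end Exp

namespace Exponential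

variable {A : Type u} [Bicategory.{w, v} A] [Bicategory.Strict A] [FiniteProducts A] {X : A}

/-- The composition 1-cell `X ^ X × X ^ X ⟶ X ^ X`, the transpose of `(f, g, x) ↦ f (g x)`. -/
def compose (H : Exponential X X) : prod H.obj H.obj ⟶ H.obj :=
  H.curry (op H.ev (fst (prod H.obj H.obj) X ≫ fst H.obj H.obj)
    (op H.ev (fst (prod H.obj H.obj) X ≫ snd H.obj H.obj) (snd (prod H.obj H.obj) X)))

/-- The 1-cell `1 ⟶ X ^ X`, the transpose of the identity of `X`. -/
def identity (H : Exponential X X) : (one : A) ⟶ H.obj :=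
  H.curry (snd one X)

theorem op_ev (H : Exponential X X) {E : A} (r : E ⟶ H.obj) (x : E ⟶ X) :
    op H.ev r x = pair (𝟙 E) x ≫ evAt H.ev r := by
  simp [evAt]

theorem op_ev_comp (H : Exponential X X) {D E : A} (f : E ⟶ D) (r : D ⟶ H.obj) (x : E ⟶ X) :
    op H.ev (f ≫ r) x = pair f x ≫ evAt H.ev r := by
  simp [evAt]

theorem ev_compose (H : Exponential X X) {E : A} (a b : E ⟶ H.obj) (x : E ⟶ X) :
    op H.ev (op H.compose a b) x = op H.ev a (op H.ev b x) := by
  rw [show op H.compose a b = pair a b ≫ H.compose from rfl, op_ev_comp, compose, evAt_curry]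
  simp

theorem ev_identity (H : Exponential X X) {E : A} (x : E ⟶ X) :
    op H.ev (const H.identity E) x = x := by
  rw [const, op_ev_comp, identity, evAt_curry, pair_snd]

theorem ext_op (H : Exponential X X) {E : A} {r r' : E ⟶ H.obj}
    (h : op H.ev (fst E X ≫ r) (snd E X) = op H.ev (fst E X ≫ r') (snd E X)) : r = r' :=
  H.evAt_injective h

theorem compose_assoc (H : Exponential X X) {E : A} (a b c : E ⟶ H.obj) :
    op H.compose a (op H.compose b c) = op H.compose (op H.compose a b) c :=
  H.ext_op (by simp [ev_compose])

theorem identity_compose (H : Exponential X X) {E : A} (a : E ⟶ H.obj) :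
    op H.compose (const H.identity E) a = a :=
  H.ext_op (by simp [ev_compose, ev_identity])

theorem compose_identity (H : Exponential X X) {E : A} (a : E ⟶ H.obj) :
    op H.compose a (const H.identity E) = a :=
  H.ext_op (by simp [ev_compose, ev_identity])

end Exponential

section EqToHom

variable {A : Type u} [Bicategory.{w, v} A] [Bicategory.Strict A] [FiniteProducts A]

theorem castHom_eqToHom {C : Type*} [Category C] {a b a' b' : C} (h : a = b) (ha : a = a')
    (hb : b = b') : castHom (eqToHom h) ha hb = eqToHom (ha.symm.trans (h.trans hb)) := by
  simp [castHom]

theorem op₂_eqToHom {E X Y Z : A} (m : prod X Y ⟶ Z) {a a' : E ⟶ X} {b b' : E ⟶ Y} (h : a = a')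
    (k : b = b') : op₂ m (eqToHom h) (eqToHom k) = eqToHom (by rw [h, k]) := by
  subst h k; simp [op₂_id]

end EqToHom

namespace Exponential

variable {A : Type u} [Bicategory.{w, v} A] [Bicategory.Strict A] [FiniteProducts A] {X : A}

/-- The (strict) monoidal object `X ^ X` of endomorphisms of `X`: its tensor is composition, its
unit is the identity and its coherence 2-cells are identities. -/
@[reducible] def monoidalObject (H : Exponential X X) : MonoidalObject A where
  carrier := H.obj
  tensor := H.compose
  unit := H.identity
  assoc := eqToIso (H.compose_assoc _ _ _)
  lam := eqToIso (H.identity_compose _)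
  rho := eqToIso (H.compose_identity _)
  pentagon := by
    simp only [assocAt, eqToIso.hom, whiskerLeft_eqToHom, castHom_eqToHom, ← eqToHom_refl _ rfl,
      op₂_eqToHom, eqToHom_trans]
  triangle := by
    simp only [assocAt, leftUnitAt, rightUnitAt, eqToIso.hom, whiskerLeft_eqToHom,
      castHom_eqToHom, ← eqToHom_refl _ rfl, op₂_eqToHom, eqToHom_trans]

end Exponential

section Results

variable {A : Type u} [Bicategory.{w, v} A] [Bicategory.Strict A] [FiniteProducts A]

/-- A strong monoidal 1-cell: the structure 2-cells are invertible. -/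
def LaxHom.IsStrong {M N : MonoidalObject A} (F : LaxHom M N) : Prop :=
  IsIso F.φ ∧ IsIso F.φ₀

/-- A strong action: the structure 2-cells are invertible. -/
def Action.IsStrong {M : MonoidalObject A} {X : A} (s : Action M X) : Prop :=
  IsIso s.ψ ∧ IsIso s.ψ₀

theorem castHom_rfl {C : Type*} [Category C] {a b : C} (σ : a ⟶ b) (ha : a = a) (hb : b = b) :
    castHom σ ha hb = σ := eq_of_heq (castHom_heq σ ha hb)

end Results

/-- The forgetful strict 2-functor from the lax slice. -/
def LaxSlice.proj {B : Type u} [Bicategory.{w, v} B] [Bicategory.Strict B] (Z : B) :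
    StrictPseudofunctor (LaxSlice Z) B :=
  StrictPseudofunctor.mk'' {
    obj := fun r => r.left
    map := fun f => LaxSlice.Hom.left f
    map₂ := fun σ => LaxSlice.Hom₂.left σ
    map_id := fun _ => rfl
    map_comp := fun _ _ => rfl
    map₂_whisker_left := fun f _ _ η =>
      (castHom_rfl (LaxSlice.Hom.left f ◁ LaxSlice.Hom₂.left η) rfl rfl).symm
    map₂_whisker_right := fun η g =>
      (castHom_rfl (LaxSlice.Hom₂.left η ▷ LaxSlice.Hom.left g) rfl rfl).symm
  }

/-- The monoidal transformation underlying a 2-cell of `Act_l Mon_l(A, X)`. -/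
def LaxAction.under₂ {A : Type u} [Bicategory.{w, v} A] [Bicategory.Strict A] [FiniteProducts A]
    {X : A} {s t : LaxAction X} {f g : s ⟶ t} (σ : f ⟶ g) :
    LaxAction.under f ⟶ LaxAction.under g := ActHom₂.toLaxHom₂ σ

/-- The forgetful strict 2-functor from lax actions to monoidal objects. -/
def LaxAction.forget {A : Type u} [Bicategory.{w, v} A] [Bicategory.Strict A] [FiniteProducts A]
    (X : A) : StrictPseudofunctor (LaxAction X) (MonoidalObject A) :=
  StrictPseudofunctor.mk'' {
    obj := fun s => s.mon
    map := fun f => LaxAction.under f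
    map₂ := fun σ => LaxAction.under₂ σ
    map_id := fun _ => rfl
    map_comp := fun _ _ => rfl
    map₂_whisker_left := fun f _ _ η =>
      (castHom_rfl (LaxAction.under f ◁ LaxAction.under₂ η) rfl rfl).symm
    map₂_whisker_right := fun η g =>
      (castHom_rfl (LaxAction.under₂ η ▷ LaxAction.under g) rfl rfl).symm
  }

/-- An isomorphism of 2-categories: a strict 2-functor with a strict inverse. -/
def IsIsomorphism {B : Type*} [Bicategory B] {C : Type*} [Bicategory C]
    (Φ : StrictPseudofunctor B C) : Prop :=
  ∃ Ψ : StrictPseudofunctor C B,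
    Φ.comp Ψ = StrictPseudofunctor.id B ∧ Ψ.comp Φ = StrictPseudofunctor.id C

/-- The lax action `s` of `M` on `X` corresponds to the lax monoidal 1-cell `r : M ⟶ X ^ X` under
the exponential adjunction: `act = ev ∘ (r × 1)`, the 2-cell `ψ` is the transpose of `φ` (after the
identification of `(M × M) × X` with `M × (M × X)`) and `ψ₀` is the transpose of `φ₀` (after the
identification of `X` with `1 × X`). -/
structure IsTranspose {A : Type u} [Bicategory.{w, v} A] [Bicategory.Strict A] [FiniteProducts A]
    {X : A} (H : Exponential X X) {M : MonoidalObject A} (r : LaxHom M H.monoidalObject)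
    (s : Action M X) : Prop where
  act : s.act = evAt H.ev r.hom
  ψ : HEq s.ψ (pair (pair (p₁ M.carrier M.carrier X) (p₂ _ _ _)) (p₃ _ _ _) ◁ evAt₂ H.ev r.φ)
  ψ₀ : HEq s.ψ₀ (pair (toOne X) (𝟙 X) ◁ evAt₂ H.ev r.φ₀)

end TwoCat

/-! The universal property of `X ^ X` is an isomorphism of categories between `A(E, X ^ X)` and `A(E
× X, X)`, for every `E`, given by `r ↦ ev ∘ (r × 1)`. It turns composition into iterated evaluation,
`(a ∘ b)(x) = a(b(x))`, and the unit of `X ^ X` into `x ↦ x`; this holds for 1-cells and, by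
`op₂_ev_compose`, for 2-cells. With `A ⋆ x = r(A)(x)`, a 2-cell `r(A) ∘ r(B) ⟶ r(A ⊗ B)` is
therefore the same thing as a 2-cell `A ⋆ (B ⋆ x) ⟶ (A ⊗ B) ⋆ x`, and a 2-cell `1 ⟶ r(I)` the same
thing as `x ⟶ I ⋆ x`.

The axioms correspond as well. The coherence 2-cells of `X ^ X` are identities and disappear under
transposition, so the associativity axiom of a lax monoidal 1-cell becomes the pentagon-shaped axiom
of an action (`Transposes.assoc_left`, `Transposes.assoc_right`), and the unit axioms become the
unit axioms of an action (`Transposes.lam`, `Transposes.rho`). Transposition is faithful on 2-cells,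
so the translation works in both directions. It is also full, so it reflects isomorphisms, and
strong 1-cells correspond to strong actions (`Transposes.isIso_iff`).

For 1-cells, `θ : r' ∘ F ⟶ r` transposes to `ξ`, and monoidality of `θ` transposes to the two axioms
on `ξ`: `θ ⊗ θ` is split into `θ` on the inner variable followed by `θ` on the outer one
(`HomTransposes.tensor_left`). For 2-cells, `map_act_iff` compares the two conditions on the same
`τ`. Throughout, `F` and `τ` are left unchanged, and transposition respects identities and
composites, so the bijections form a strict 2-functor with a strict inverse.

Equalities of 1-cells such as `(a ∘ b)(x) = a(b(x))` are rarely definitional. Hence 2-cells are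
compared by `HEq`, one factor of a composite at a time, and `simp` checks that the boundaries agree.
-/

namespace TwoCat

open FiniteProducts

/-! ### Evaluation of 1-cells and 2-cells at a stage. -/

section Stages

variable {A : Type u} [Bicategory.{w, v} A] [Bicategory.Strict A] [FiniteProducts A]

/-- Together with `comp_evAt`, this reduces the boundaries of transposed 2-cells to evaluations at a
stage, where `ev_compose` and `ev_identity` apply. -/
theorem op_evAt {K X Y D E : A} (ev : prod K X ⟶ Y) (F : D ⟶ K) (a : E ⟶ D) (x : E ⟶ X) :
    op (evAt ev F) a x = op ev (a ≫ F) x := by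
  simp [evAt, op]

theorem comp_evAt {K X Y D E : A} (ev : prod K X ⟶ Y) (F : D ⟶ K) (f : E ⟶ prod D X) :
    f ≫ evAt ev F = op ev (f ≫ fst D X ≫ F) (f ≫ snd D X) := by
  simp [evAt]

/-- With `evAt₂_comp`, transposition is a functor on each hom-category. This is what lets it reflect
isomorphisms. -/
theorem evAt₂_id {K X Y E : A} (ev : prod K X ⟶ Y) (r : E ⟶ K) :
    evAt₂ ev (𝟙 r) = 𝟙 (evAt ev r) := by
  rw [evAt₂, whiskerLeft_id, op₂_id]; rfl

theorem evAt₂_comp {K X Y E : A} (ev : prod K X ⟶ Y) {r s t : E ⟶ K} (σ : r ⟶ s) (τ : s ⟶ t) :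
    evAt₂ ev (σ ≫ τ) = evAt₂ ev σ ≫ evAt₂ ev τ := by
  have h := op₂_comp ev (fst E X ◁ σ) (𝟙 (snd E X)) (fst E X ◁ τ) (𝟙 (snd E X))
  rw [← whiskerLeft_comp, Category.comp_id] at h
  exact h

/-- Splits the transpose of a composite into the transposes of its factors, so that an axiom can be
translated factor by factor. -/
theorem op₂_comp_id {E X Y Z : A} (m : prod X Y ⟶ Z) {a b c : E ⟶ X} (σ : a ⟶ b) (τ : b ⟶ c)
    (y : E ⟶ Y) : op₂ m (σ ≫ τ) (𝟙 y) = op₂ m σ (𝟙 y) ≫ op₂ m τ (𝟙 y) := by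
  rw [← op₂_comp, Category.comp_id]

/-- Whiskering with `evAt ev F` on the right. -/
theorem op₂_evAt {K X Y D E : A} (ev : prod K X ⟶ Y) (F : D ⟶ K) {a a' : E ⟶ D}
    {x x' : E ⟶ X} (σ : a ⟶ a') (τ : x ⟶ x') :
    HEq (op₂ (evAt ev F) σ τ) (op₂ ev (σ ▷ F) τ) := by
  refine (wr_op _ _ _ _).trans (hop₂ _ (by simp) (by simp) (by simp) (by simp) ?_ ?_)
  · exact (wr_comp _ _ _).trans (hwr (by simp) (by simp) rfl (pair₂_fst _ _))
  · exact pair₂_snd _ _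

/-- The component of `evAt₂ ev σ` at `f`. -/
theorem wl_evAt₂ {K X Y D E : A} (ev : prod K X ⟶ Y) {r r' : E ⟶ K} (σ : r ⟶ r')
    (f : D ⟶ prod E X) {a : D ⟶ E} {x : D ⟶ X} (ha : f ≫ fst E X = a) (hx : f ≫ snd E X = x) :
    HEq (f ◁ evAt₂ ev σ) (op₂ ev (a ◁ σ) (𝟙 x)) := by
  subst ha hx
  refine (wl_op₂ _ _ _ _).trans (hop₂ _ (by simp) (by simp) (by simp) (by simp)
    (comp_wl _ _ _).symm ?_)
  rw [whiskerLeft_id]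

end Stages

/-! ### The monoidal structure of `X ^ X` under evaluation. -/

namespace Exponential

variable {A : Type u} [Bicategory.{w, v} A] [Bicategory.Strict A] [FiniteProducts A] {X : A}
  (H : Exponential X X)

/-- The 2-dimensional form of `ev_compose`. The 2-cell `op₂ H.compose σ τ` is a whiskering of `⟨σ,
τ⟩` with `compose`, whose transpose is the explicit term `f (g x)`; whiskering with that term can be
computed one projection at a time. -/
theorem op₂_ev_compose {E : A} {a a' b b' : E ⟶ H.obj} {x x' : E ⟶ X} (σ : a ⟶ a') (τ : b ⟶ b')
    (υ : x ⟶ x') : HEq (op₂ H.ev (op₂ H.compose σ τ) υ) (op₂ H.ev σ (op₂ H.ev τ υ)) := by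
  refine (op₂_evAt H.ev H.compose (pair₂ σ τ) υ).symm.trans ?_
  rw [compose, evAt_curry]
  refine (wr_op _ _ _ _).trans (hop₂ _ (by simp) (by simp) (by simp) (by simp) ?_ ?_)
  · exact (wr_comp _ _ _).trans ((hwr (by simp) (by simp) rfl (pair₂_fst _ _)).trans
      (pair₂_fst _ _))
  · refine (wr_op _ _ _ _).trans (hop₂ _ (by simp) (by simp) (by simp) (by simp) ?_ ?_)
    · exact (wr_comp _ _ _).trans ((hwr (by simp) (by simp) rfl (pair₂_fst _ _)).trans
        (pair₂_snd _ _))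
    · exact pair₂_snd _ _

/-- Faithfulness of transposition, tested on 2-cells that are equal up to transport. -/
theorem ext_heq {E : A} {r r' : E ⟶ H.obj} {σ τ : r ⟶ r'}
    (h : HEq (op₂ H.ev (fst E X ◁ σ) (𝟙 (snd E X))) (op₂ H.ev (fst E X ◁ τ) (𝟙 (snd E X)))) :
    σ = τ :=
  H.evAt₂_injective (eq_of_heq h)

/-- With its two unit analogues, this exhibits the coherence of `X ^ X` at each stage as an
`eqToHom`, which `wl_eqToHom` then transposes to an identity. -/
theorem assocAt_monoidalObject {E : A} (a b c : E ⟶ H.obj) :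
    assocAt H.monoidalObject.assoc.hom a b c = eqToHom (H.compose_assoc a b c) := by
  simp only [assocAt, eqToIso.hom, whiskerLeft_eqToHom, castHom_eqToHom]

theorem leftUnitAt_monoidalObject {E : A} (a : E ⟶ H.obj) :
    leftUnitAt H.monoidalObject.lam.hom a = eqToHom (H.identity_compose a) := by
  simp only [leftUnitAt, eqToIso.hom, whiskerLeft_eqToHom, castHom_eqToHom]

theorem rightUnitAt_monoidalObject {E : A} (a : E ⟶ H.obj) :
    rightUnitAt H.monoidalObject.rho.hom a = eqToHom (H.compose_identity a) := by
  simp only [rightUnitAt, eqToIso.hom, whiskerLeft_eqToHom, castHom_eqToHom]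

/-- A 2-cell given by an equality transposes to an identity, up to transport. -/
theorem wl_eqToHom {D E : A} (f : D ⟶ E) {r r' : E ⟶ H.obj} (h : r = r') (x : D ⟶ X) :
    HEq (op₂ H.ev (f ◁ eqToHom h) (𝟙 x)) (𝟙 (op H.ev (f ≫ r) x)) := by
  subst h; rw [eqToHom_refl, whiskerLeft_id, op₂_id]

end Exponential

/-! ### The relation between structure 2-cells and their transposes, at all stages. -/

/-- The raw form of the correspondence of structure 2-cells under transposition, at all stages. -/
structure Transposes {A : Type u} [Bicategory.{w, v} A] [Bicategory.Strict A] [FiniteProducts A]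
    {X : A} (H : Exponential X X) {M : MonoidalObject A} {F : M.carrier ⟶ H.obj}
    (φ : op H.compose (fst M.carrier M.carrier ≫ F) (snd M.carrier M.carrier ≫ F) ⟶
      op M.tensor (fst M.carrier M.carrier) (snd M.carrier M.carrier) ≫ F)
    (φ₀ : H.identity ⟶ M.unit ≫ F) {act : prod M.carrier X ⟶ X}
    (ψ : op act (p₁ M.carrier M.carrier X) (op act (p₂ _ _ _) (p₃ _ _ _)) ⟶
      op act (op M.tensor (p₁ _ _ _) (p₂ _ _ _)) (p₃ _ _ _))
    (ψ₀ : 𝟙 X ⟶ op act (const M.unit X) (𝟙 X)) : Prop where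
  act : act = evAt H.ev F
  assocAt {E : A} (a b : E ⟶ M.carrier) (x : E ⟶ X) :
    HEq (assocAt ψ a b x) (op₂ H.ev (laxAt φ a b) (𝟙 x))
  leftCounitAt {E : A} (x : E ⟶ X) :
    HEq (leftCounitAt ψ₀ x) (op₂ H.ev (constAt φ₀ E) (𝟙 x))

namespace Transposes

variable {A : Type u} [Bicategory.{w, v} A] [Bicategory.Strict A] [FiniteProducts A]
    {X : A} {H : Exponential X X} {M : MonoidalObject A} {F : M.carrier ⟶ H.obj}
    {φ : op H.compose (fst M.carrier M.carrier ≫ F) (snd M.carrier M.carrier ≫ F) ⟶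
      op M.tensor (fst M.carrier M.carrier) (snd M.carrier M.carrier) ≫ F}
    {φ₀ : H.identity ⟶ M.unit ≫ F} {act : prod M.carrier X ⟶ X}
    {ψ : op act (p₁ M.carrier M.carrier X) (op act (p₂ _ _ _) (p₃ _ _ _)) ⟶
      op act (op M.tensor (p₁ _ _ _) (p₂ _ _ _)) (p₃ _ _ _)}
    {ψ₀ : 𝟙 X ⟶ op act (const M.unit X) (𝟙 X)}

/-- It suffices to know the correspondence at the universal stage: the components at `(a, b, x)`
arise by whiskering along `⟨a, ⟨b, x⟩⟩`, and this composed with the reassociation is `⟨⟨a, b⟩, x⟩`.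
-/
theorem of_heq (h : act = evAt H.ev F)
    (hψ : HEq ψ (pair (pair (p₁ M.carrier M.carrier X) (p₂ _ _ _)) (p₃ _ _ _) ◁ evAt₂ H.ev φ))
    (hψ₀ : HEq ψ₀ (pair (toOne X) (𝟙 X) ◁ evAt₂ H.ev φ₀)) : Transposes H φ φ₀ ψ ψ₀ where
  act := h
  assocAt a b x := by
    subst h
    refine (assocAt_heq _ _ _ _).trans ((hwl rfl (by simp [op_evAt, comp_evAt, H.ev_compose])
      (by simp [op_evAt, comp_evAt]) hψ).trans ((comp_wl _ _ _).symm.trans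
      ((wl_evAt₂ H.ev φ _ (a := pair a b) (x := x) (by simp) (by simp)).trans
        (hop₂ _ (by simp) (by simp) rfl rfl (castHom_heq _ _ _).symm HEq.rfl))))
  leftCounitAt {E} x := by
    subst h
    refine (castHom_heq _ _ _).trans ((hwl rfl (by
      simp [comp_evAt]; exact (H.ev_identity _).symm) (by simp [op_evAt, comp_evAt])
      hψ₀).trans ((comp_wl _ _ _).symm.trans
      ((wl_evAt₂ H.ev φ₀ _ (a := toOne E) (x := x) (by simpa using toOne_uniq _) (by simp)).trans
        (hop₂ _ rfl (by simp) rfl rfl (castHom_heq _ _ _).symm HEq.rfl))))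

theorem op_act (T : Transposes H φ φ₀ ψ ψ₀) {E : A} (a : E ⟶ M.carrier) (x : E ⟶ X) :
    op act a x = op H.ev (a ≫ F) x := by
  rw [T.act, op_evAt]

theorem op₂_act (T : Transposes H φ φ₀ ψ ψ₀) {E : A} {a a' : E ⟶ M.carrier}
    {x x' : E ⟶ X} (σ : a ⟶ a') (τ : x ⟶ x') : HEq (op₂ act σ τ) (op₂ H.ev (σ ▷ F) τ) := by
  obtain rfl := T.act
  exact op₂_evAt _ _ _ _

end Transposes

namespace Transposes

variable {A : Type u} [Bicategory.{w, v} A] [Bicategory.Strict A] [FiniteProducts A]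
    {X : A} {H : Exponential X X} {M : MonoidalObject A} {F : M.carrier ⟶ H.obj}
    {φ : op H.compose (fst M.carrier M.carrier ≫ F) (snd M.carrier M.carrier ≫ F) ⟶
      op M.tensor (fst M.carrier M.carrier) (snd M.carrier M.carrier) ≫ F}
    {φ₀ : H.identity ⟶ M.unit ≫ F} {act : prod M.carrier X ⟶ X}
    {ψ : op act (p₁ M.carrier M.carrier X) (op act (p₂ _ _ _) (p₃ _ _ _)) ⟶
      op act (op M.tensor (p₁ _ _ _) (p₂ _ _ _)) (p₃ _ _ _)}
    {ψ₀ : 𝟙 X ⟶ op act (const M.unit X) (𝟙 X)}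

/-- In this group of lemmas each kind of factor in the lax monoidal axioms is pulled back along `f`,
evaluated at `x` and identified as a factor of an action axiom. The names `a'`, `b'` for the pulled
back variables keep the results free of unreduced composites. -/
theorem wl_laxAt (T : Transposes H φ φ₀ ψ ψ₀) {D E : A} (f : D ⟶ E) {a b : E ⟶ M.carrier}
    {a' b' : D ⟶ M.carrier} (x : D ⟶ X) (ha : f ≫ a = a') (hb : f ≫ b = b') :
    HEq (op₂ H.ev (f ◁ laxAt φ a b) (𝟙 x)) (TwoCat.assocAt ψ a' b' x) := by
  subst ha hb
  exact (hop₂ _ (by simp) (by simp) rfl rfl (TwoCat.wl_laxAt φ f a b) HEq.rfl).trans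
    (T.assocAt _ _ _).symm

/-- Transposition of a 2-cell `σ ⊗ 1` of `X ^ X` on which a 2-cell `φ(a, b)` acts. -/
theorem wl_op₂_laxAt (T : Transposes H φ φ₀ ψ ψ₀) {D E : A} (f : D ⟶ E) {a b c : E ⟶ M.carrier}
    {a' b' c' : D ⟶ M.carrier} (x : D ⟶ X) (ha : f ≫ a = a') (hb : f ≫ b = b')
    (hc : f ≫ c = c') :
    HEq (op₂ H.ev (f ◁ op₂ H.compose (laxAt φ a b) (𝟙 (c ≫ F))) (𝟙 x))
      (TwoCat.assocAt ψ a' b' (op act c' x)) := by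
  subst ha hb hc
  have e : op H.ev (f ≫ c ≫ F) x = op act (f ≫ c) x := by rw [T.op_act, Strict.assoc]
  refine (hop₂ _ (by simp) (by simp) rfl rfl (wl_op₂ _ _ _ _) HEq.rfl).trans
    ((H.op₂_ev_compose _ _ _).trans (HEq.trans ?_ (T.assocAt _ _ _).symm))
  refine hop₂ _ (by simp) (by simp) e e (TwoCat.wl_laxAt _ _ _ _) ?_
  rw [whiskerLeft_id, op₂_id]
  exact hid e

/-- By `op₂_ev_compose`, tensoring with an identity on the left in `X ^ X` means evaluating the
other factor first, hence acting on its transpose. -/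
theorem wl_id_op₂_laxAt (T : Transposes H φ φ₀ ψ ψ₀) {D E : A} (f : D ⟶ E)
    {a b c : E ⟶ M.carrier} {a' b' c' : D ⟶ M.carrier} (x : D ⟶ X) (ha : f ≫ a = a')
    (hb : f ≫ b = b') (hc : f ≫ c = c') :
    HEq (op₂ H.ev (f ◁ op₂ H.compose (𝟙 (a ≫ F)) (laxAt φ b c)) (𝟙 x))
      (op₂ act (𝟙 a') (TwoCat.assocAt ψ b' c' x)) := by
  subst ha hb hc
  refine (hop₂ _ (by simp) (by simp) rfl rfl (wl_op₂ _ _ _ _) HEq.rfl).trans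
    ((H.op₂_ev_compose _ _ _).trans (HEq.trans ?_ (T.op₂_act _ _).symm))
  refine hop₂ _ (by simp) (by simp) (by simp [T.op_act, H.ev_compose]) (by simp [T.op_act]) ?_
    (T.wl_laxAt f x rfl rfl)
  rw [whiskerLeft_id, id_whiskerRight]
  exact hid (by simp)

theorem wl_whiskerRight (T : Transposes H φ φ₀ ψ ψ₀) {D E : A} (f : D ⟶ E)
    {a b : E ⟶ M.carrier} {a' b' : D ⟶ M.carrier} (σ : a ⟶ b) {σ' : a' ⟶ b'} (x : D ⟶ X)
    (ha : f ≫ a = a') (hb : f ≫ b = b') (h : HEq (f ◁ σ) σ') :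
    HEq (op₂ H.ev (f ◁ (σ ▷ F)) (𝟙 x)) (op₂ act σ' (𝟙 x)) := by
  subst ha hb; cases h
  exact (hop₂ _ (by simp) (by simp) rfl rfl (wl_wr _ _ _).symm HEq.rfl).trans (T.op₂_act _ _).symm

theorem wl_op₂_constAt (T : Transposes H φ φ₀ ψ ψ₀) {D E : A} (f : D ⟶ E)
    {a : E ⟶ M.carrier} {a' : D ⟶ M.carrier} (x : D ⟶ X) (ha : f ≫ a = a') :
    HEq (op₂ H.ev (f ◁ op₂ H.compose (constAt φ₀ E) (𝟙 (a ≫ F))) (𝟙 x))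
      (TwoCat.leftCounitAt ψ₀ (op act a' x)) := by
  subst ha
  have e : op H.ev (f ≫ a ≫ F) x = op act (f ≫ a) x := by rw [T.op_act, Strict.assoc]
  refine (hop₂ _ (by simp) (by simp) rfl rfl (wl_op₂ _ _ _ _) HEq.rfl).trans
    ((H.op₂_ev_compose _ _ _).trans (HEq.trans ?_ (T.leftCounitAt _).symm))
  refine hop₂ _ (by simp) (by simp) e e (wl_constAt _ _) ?_
  rw [whiskerLeft_id, op₂_id]
  exact hid e

/-- The unit 2-cell sits in the inner position here and becomes `1 ⋆ ψ₀`. In `wl_op₂_constAt` it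
sits in the outer position, and there `ψ₀` is taken at the point `a ⋆ x`. -/
theorem wl_id_op₂_constAt (T : Transposes H φ φ₀ ψ ψ₀) {D E : A} (f : D ⟶ E)
    {a : E ⟶ M.carrier} {a' : D ⟶ M.carrier} (x : D ⟶ X) (ha : f ≫ a = a') :
    HEq (op₂ H.ev (f ◁ op₂ H.compose (𝟙 (a ≫ F)) (constAt φ₀ E)) (𝟙 x))
      (op₂ act (𝟙 a') (TwoCat.leftCounitAt ψ₀ x)) := by
  subst ha
  refine (hop₂ _ (by simp) (by simp) rfl rfl (wl_op₂ _ _ _ _) HEq.rfl).trans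
    ((H.op₂_ev_compose _ _ _).trans (HEq.trans ?_ (T.op₂_act _ _).symm))
  refine hop₂ _ (by simp) (by simp) (by simp [H.ev_identity]) (by simp [T.op_act]) ?_ ?_
  · rw [whiskerLeft_id, id_whiskerRight]
    exact hid (by simp)
  · exact (hop₂ _ (by simp) (by simp) rfl rfl (wl_constAt _ _) HEq.rfl).trans
      (T.leftCounitAt _).symm

/-! ### Transposes of the axioms of a lax monoidal 1-cell. -/

/-- The transpose of one side of the associativity axiom of a lax monoidal 1-cell. -/
theorem assoc_left (T : Transposes H φ φ₀ ψ ψ₀) {D : A}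
    (f : D ⟶ prod M.carrier (prod M.carrier M.carrier)) {a b c : D ⟶ M.carrier} (x : D ⟶ X)
    (ha : f ≫ p₁ _ _ _ = a) (hb : f ≫ p₂ _ _ _ = b) (hc : f ≫ p₃ _ _ _ = c) :
    HEq (op₂ H.ev (f ◁ (TwoCat.assocAt H.monoidalObject.assoc.hom (p₁ _ _ _ ≫ F) (p₂ _ _ _ ≫ F)
          (p₃ _ _ _ ≫ F) ≫
        op₂ H.compose (laxAt φ (p₁ _ _ _) (p₂ _ _ _)) (𝟙 (p₃ _ _ _ ≫ F)) ≫
          laxAt φ (op M.tensor (p₁ _ _ _) (p₂ _ _ _)) (p₃ _ _ _))) (𝟙 x))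
      (TwoCat.assocAt ψ a b (op act c x) ≫ TwoCat.assocAt ψ (op M.tensor a b) c x) := by
  -- The monoidal side has three factors and the action side two. The extra factor is the
  -- associativity 2-cell of `X ^ X`, whose transpose is an identity.
  have key : 𝟙 _ ≫ TwoCat.assocAt ψ a b (op act c x) ≫ TwoCat.assocAt ψ (op M.tensor a b) c x =
      TwoCat.assocAt ψ a b (op act c x) ≫ TwoCat.assocAt ψ (op M.tensor a b) c x :=
    Category.id_comp _
  refine HEq.trans ?_ (heq_of_eq key)
  rw [H.assocAt_monoidalObject, whiskerLeft_comp, whiskerLeft_comp, op₂_comp_id, op₂_comp_id]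
  have e₁ : op H.ev (f ≫ op H.compose (p₁ _ _ _ ≫ F) (op H.compose (p₂ _ _ _ ≫ F)
      (p₃ _ _ _ ≫ F))) x = op act a (op act b (op act c x)) := by
    simp [← ha, ← hb, ← hc, T.op_act, H.ev_compose]
  refine hcomp e₁ (by simp [← ha, ← hb, ← hc, T.op_act, H.ev_compose])
    (by simp [← ha, ← hb, ← hc, T.op_act]) ?_
    (hcomp (by simp [← ha, ← hb, ← hc, T.op_act, H.ev_compose])
      (by simp [← ha, ← hb, ← hc, T.op_act, H.ev_compose])
      (by simp [← ha, ← hb, ← hc, T.op_act]) (T.wl_op₂_laxAt f x ha hb hc)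
      (T.wl_laxAt f x (by simp [← ha, ← hb]) hc))
  exact (H.wl_eqToHom f _ x).trans (hid e₁)

/-- The transpose of the other side of the associativity axiom of a lax monoidal 1-cell. -/
theorem assoc_right (T : Transposes H φ φ₀ ψ ψ₀) {D : A}
    (f : D ⟶ prod M.carrier (prod M.carrier M.carrier)) {a b c : D ⟶ M.carrier} (x : D ⟶ X)
    (ha : f ≫ p₁ _ _ _ = a) (hb : f ≫ p₂ _ _ _ = b) (hc : f ≫ p₃ _ _ _ = c) :
    HEq (op₂ H.ev (f ◁ (op₂ H.compose (𝟙 (p₁ _ _ _ ≫ F)) (laxAt φ (p₂ _ _ _) (p₃ _ _ _)) ≫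
        laxAt φ (p₁ _ _ _) (op M.tensor (p₂ _ _ _) (p₃ _ _ _)) ≫ M.assoc.hom ▷ F)) (𝟙 x))
      (op₂ act (𝟙 a) (TwoCat.assocAt ψ b c x) ≫ TwoCat.assocAt ψ a (op M.tensor b c) x ≫
        op₂ act (TwoCat.assocAt M.assoc.hom a b c) (𝟙 x)) := by
  rw [whiskerLeft_comp, whiskerLeft_comp, op₂_comp_id, op₂_comp_id]
  refine hcomp (by simp [← ha, ← hb, ← hc, T.op_act, H.ev_compose])
    (by simp [← ha, ← hb, ← hc, T.op_act, H.ev_compose])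
    (by simp [← ha, ← hb, ← hc, T.op_act]) (T.wl_id_op₂_laxAt f x ha hb hc)
    (hcomp (by simp [← ha, ← hb, ← hc, T.op_act, H.ev_compose])
      (by simp [← ha, ← hb, ← hc, T.op_act])
      (by simp [← ha, ← hb, ← hc, T.op_act]) (T.wl_laxAt f x ha (by simp [← hb, ← hc]))
      (T.wl_whiskerRight f _ x (by simp [← ha, ← hb, ← hc]) (by simp [← ha, ← hb, ← hc]) ?_))
  -- It remains to see that `f` is the tuple `⟨a, ⟨b, c⟩⟩`, so that `f ◁ M.assoc.hom` is the
  -- component of the associativity 2-cell there.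
  refine (hwl ?_ rfl rfl HEq.rfl).trans (assocAt_heq _ _ _ _).symm
  exact pair_uniq (by simp [← ha, p₁]) (pair_uniq (by simp [← hb, p₂]) (by simp [← hc, p₃]))

/-- The transpose of the left unit axiom of a lax monoidal 1-cell. -/
theorem lam (T : Transposes H φ φ₀ ψ ψ₀) {D : A} (a : D ⟶ M.carrier) (x : D ⟶ X) :
    HEq (op₂ H.ev (a ◁ (op₂ H.compose (constAt φ₀ M.carrier) (𝟙 (𝟙 M.carrier ≫ F)) ≫
        laxAt φ (const M.unit M.carrier) (𝟙 M.carrier) ≫ M.lam.hom ▷ F)) (𝟙 x))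
      (TwoCat.leftCounitAt ψ₀ (op act a x) ≫ TwoCat.assocAt ψ (const M.unit _) a x ≫
        op₂ act (leftUnitAt M.lam.hom a) (𝟙 x)) := by
  rw [whiskerLeft_comp, whiskerLeft_comp, op₂_comp_id, op₂_comp_id]
  exact hcomp (by simp [T.op_act, H.ev_compose, H.ev_identity])
    (by simp [T.op_act, H.ev_compose]) (by simp [T.op_act])
    (T.wl_op₂_constAt a x (by simp))
    (hcomp (by simp [T.op_act, H.ev_compose]) (by simp [T.op_act])
      (by simp [T.op_act]) (T.wl_laxAt a x (by simp) (by simp))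
      (T.wl_whiskerRight a _ x (by simp) (by simp) (castHom_heq _ _ _).symm))

/-- The transpose of the right unit axiom of a lax monoidal 1-cell. -/
theorem rho (T : Transposes H φ φ₀ ψ ψ₀) {D : A} (a : D ⟶ M.carrier) (x : D ⟶ X) :
    HEq (op₂ H.ev (a ◁ (op₂ H.compose (𝟙 (𝟙 M.carrier ≫ F)) (constAt φ₀ M.carrier) ≫
        laxAt φ (𝟙 M.carrier) (const M.unit M.carrier) ≫ M.rho.hom ▷ F)) (𝟙 x))
      (op₂ act (𝟙 a) (TwoCat.leftCounitAt ψ₀ x) ≫ TwoCat.assocAt ψ a (const M.unit _) x ≫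
        op₂ act (rightUnitAt M.rho.hom a) (𝟙 x)) := by
  rw [whiskerLeft_comp, whiskerLeft_comp, op₂_comp_id, op₂_comp_id]
  exact hcomp (by simp [T.op_act, H.ev_compose, H.ev_identity])
    (by simp [T.op_act, H.ev_compose]) (by simp [T.op_act])
    (T.wl_id_op₂_constAt a x (by simp))
    (hcomp (by simp [T.op_act, H.ev_compose]) (by simp [T.op_act])
      (by simp [T.op_act]) (T.wl_laxAt a x (by simp) (by simp))
      (T.wl_whiskerRight a _ x (by simp) (by simp) (castHom_heq _ _ _).symm))

/-- Here and in `rightUnit`, the strict unit of `X ^ X` accounts for the identity on the right of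
the unit axioms of an action. -/
theorem leftUnit (T : Transposes H φ φ₀ ψ ψ₀) {D : A} (a : D ⟶ M.carrier) (x : D ⟶ X) :
    HEq (op₂ H.ev (a ◁ leftUnitAt H.monoidalObject.lam.hom (𝟙 M.carrier ≫ F)) (𝟙 x))
      (𝟙 (op act a x)) := by
  rw [H.leftUnitAt_monoidalObject]
  exact (H.wl_eqToHom _ _ x).trans (hid (by simp [T.op_act, H.ev_compose, H.ev_identity]))

theorem rightUnit (T : Transposes H φ φ₀ ψ ψ₀) {D : A} (a : D ⟶ M.carrier) (x : D ⟶ X) :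
    HEq (op₂ H.ev (a ◁ rightUnitAt H.monoidalObject.rho.hom (𝟙 M.carrier ≫ F)) (𝟙 x))
      (𝟙 (op act a x)) := by
  rw [H.rightUnitAt_monoidalObject]
  exact (H.wl_eqToHom _ _ x).trans (hid (by simp [T.op_act, H.ev_compose, H.ev_identity]))

end Transposes

/-! ### Associativity of an action at an arbitrary stage. -/

namespace Action

variable {A : Type u} [Bicategory.{w, v} A] [Bicategory.Strict A] [FiniteProducts A]
  {X : A} {M : MonoidalObject A} (s : Action M X)

/-- The axiom is stated over `M × (M × (M × X))`, whereas faithfulness of transposition tests over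
`(M × (M × M)) × X`; a version at all stages bridges the two bracketings. -/
theorem act_assoc_at {E : A} (a b c : E ⟶ M.carrier) (x : E ⟶ X) :
    op₂ s.act (𝟙 a) (assocAt s.ψ b c x) ≫ assocAt s.ψ a (op M.tensor b c) x ≫
      op₂ s.act (assocAt M.assoc.hom a b c) (𝟙 x) =
    assocAt s.ψ a b (op s.act c x) ≫ assocAt s.ψ (op M.tensor a b) c x := by
  have h := congrArg (fun σ => pair a (pair b (pair c x)) ◁ σ) s.act_assoc
  simp only [whiskerLeft_comp] at h
  refine eq_of_heq (HEq.trans ?_ ((heq_of_eq h).trans ?_))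
  · refine hcomp (by simp [q₁, q₂, q₃, q₄]) (by simp [q₁, q₂, q₃, q₄]) (by simp [q₁, q₂, q₃, q₄]) ?_
      (hcomp (by simp [q₁, q₂, q₃, q₄]) (by simp [q₁, q₂, q₃, q₄]) (by simp [q₁, q₂, q₃, q₄]) ?_ ?_)
    · refine HEq.trans (hop₂ _ (by simp [q₁]) (by simp [q₁]) (by simp [q₂, q₃, q₄])
        (by simp [q₂, q₃, q₄]) ?_ ?_) (wl_op₂ _ _ _ _).symm
      · rw [whiskerLeft_id]; exact hid (by simp [q₁])
      · exact (hassocAt _ (by simp [q₂]) (by simp [q₃]) (by simp [q₄])).trans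
          (wl_assocAt _ _ _ _ _).symm
    · exact (hassocAt _ (by simp [q₁]) (by simp [q₂, q₃]) (by simp [q₄])).trans
        (wl_assocAt _ _ _ _ _).symm
    · refine HEq.trans (hop₂ _ (by simp [q₁, q₂, q₃]) (by simp [q₁, q₂, q₃]) (by simp [q₄])
        (by simp [q₄]) ?_ ?_) (wl_op₂ _ _ _ _).symm
      · exact (hassocAt _ (by simp [q₁]) (by simp [q₂]) (by simp [q₃])).trans
          (wl_assocAt _ _ _ _ _).symm
      · rw [whiskerLeft_id]; exact hid (by simp [q₄])
  · refine hcomp (by simp [q₁, q₂, q₃, q₄]) (by simp [q₁, q₂, q₃, q₄])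
      (by simp [q₁, q₂, q₃, q₄]) ?_ ?_
    · exact (wl_assocAt _ _ _ _ _).trans
        (hassocAt _ (by simp [q₁]) (by simp [q₂]) (by simp [q₃, q₄]))
    · exact (wl_assocAt _ _ _ _ _).trans
        (hassocAt _ (by simp [q₁, q₂]) (by simp [q₃]) (by simp [q₄]))

end Action

/-! ### Lax monoidal 1-cells into `X ^ X` and lax actions on `X`. -/

namespace Exponential

variable {A : Type u} [Bicategory.{w, v} A] [Bicategory.Strict A] [FiniteProducts A] {X : A}
  (H : Exponential X X) {M : MonoidalObject A}

/-- The transpose of the tensor 2-cell of a lax monoidal 1-cell with values in `X ^ X`. -/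
def actψ {F : M.carrier ⟶ H.obj}
    (φ : op H.compose (fst M.carrier M.carrier ≫ F) (snd M.carrier M.carrier ≫ F) ⟶
      op M.tensor (fst M.carrier M.carrier) (snd M.carrier M.carrier) ≫ F) :
    op (evAt H.ev F) (p₁ M.carrier M.carrier X) (op (evAt H.ev F) (p₂ _ _ _) (p₃ _ _ _)) ⟶
      op (evAt H.ev F) (op M.tensor (p₁ _ _ _) (p₂ _ _ _)) (p₃ _ _ _) :=
  castHom (pair (pair (p₁ M.carrier M.carrier X) (p₂ _ _ _)) (p₃ _ _ _) ◁ evAt₂ H.ev φ)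
    (by simp [op_evAt, comp_evAt, H.ev_compose]) (by simp [op_evAt, comp_evAt])

/-- The transpose of the unit 2-cell of a lax monoidal 1-cell with values in `X ^ X`. -/
def actψ₀ {F : M.carrier ⟶ H.obj} (φ₀ : H.identity ⟶ M.unit ≫ F) :
    𝟙 X ⟶ op (evAt H.ev F) (const M.unit X) (𝟙 X) :=
  castHom (pair (toOne X) (𝟙 X) ◁ evAt₂ H.ev φ₀)
    (by simp [comp_evAt]; exact H.ev_identity _) (by simp [op_evAt, comp_evAt])

theorem transposes_act {F : M.carrier ⟶ H.obj}
    (φ : op H.compose (fst M.carrier M.carrier ≫ F) (snd M.carrier M.carrier ≫ F) ⟶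
      op M.tensor (fst M.carrier M.carrier) (snd M.carrier M.carrier) ≫ F)
    (φ₀ : H.identity ⟶ M.unit ≫ F) : Transposes H φ φ₀ (H.actψ φ) (H.actψ₀ φ₀) :=
  .of_heq rfl (castHom_heq _ _ _) (castHom_heq _ _ _)

/-- The lax action corresponding to a lax monoidal 1-cell with values in `X ^ X`. -/
@[simps]
def toAction (r : LaxHom M H.monoidalObject) : Action M X where
  act := evAt H.ev r.hom
  ψ := H.actψ r.φ
  ψ₀ := H.actψ₀ r.φ₀
  act_assoc := by
    have T := H.transposes_act r.φ r.φ₀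
    -- The axiom is pulled back to the first three projections of `M × (M × (M × X))` and evaluated
    -- at the fourth.
    have h := congrArg (fun σ => op₂ H.ev (pair (q₁ M.carrier M.carrier M.carrier X)
      (pair (q₂ _ _ _ _) (q₃ _ _ _ _)) ◁ σ) (𝟙 (q₄ _ _ _ _))) r.map_assoc
    exact eq_of_heq ((T.assoc_right _ _ (by simp) (by simp) (by simp)).symm.trans
      ((heq_of_eq h.symm).trans (T.assoc_left _ _ (by simp) (by simp) (by simp))))
  act_lam := by
    have T := H.transposes_act r.φ r.φ₀
    -- The unit axioms of an action live over `M × X`, so evaluating at the two projections gives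
    -- exactly their form.
    have h := congrArg (fun σ => op₂ H.ev (fst M.carrier X ◁ σ) (𝟙 (snd _ _))) r.map_lam
    exact eq_of_heq ((T.lam _ _).symm.trans ((heq_of_eq h).trans (T.leftUnit _ _)))
  act_rho := by
    have T := H.transposes_act r.φ r.φ₀
    have h := congrArg (fun σ => op₂ H.ev (fst M.carrier X ◁ σ) (𝟙 (snd _ _))) r.map_rho
    exact eq_of_heq ((T.rho _ _).symm.trans ((heq_of_eq h).trans (T.rightUnit _ _)))

theorem transposes_toAction (r : LaxHom M H.monoidalObject) :
    Transposes H r.φ r.φ₀ (H.toAction r).ψ (H.toAction r).ψ₀ :=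
  H.transposes_act _ _

theorem isTranspose_toAction (r : LaxHom M H.monoidalObject) :
    IsTranspose H r (H.toAction r) :=
  ⟨rfl, by rw [toAction_ψ, actψ]; exact castHom_heq _ _ _,
    by rw [toAction_ψ₀, actψ₀]; exact castHom_heq _ _ _⟩

theorem op_ev_curry (f : prod M.carrier X ⟶ X) {E : A} (a : E ⟶ M.carrier) (x : E ⟶ X) :
    op H.ev (a ≫ H.curry f) x = op f a x := by
  rw [← op_evAt, evAt_curry]

/-- The tensor 2-cell with transpose `ψ`. -/
def homφ {act : prod M.carrier X ⟶ X}
    (ψ : op act (p₁ M.carrier M.carrier X) (op act (p₂ _ _ _) (p₃ _ _ _)) ⟶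
      op act (op M.tensor (p₁ _ _ _) (p₂ _ _ _)) (p₃ _ _ _)) :
    op H.compose (fst M.carrier M.carrier ≫ H.curry act) (snd M.carrier M.carrier ≫ H.curry act) ⟶
      op M.tensor (fst M.carrier M.carrier) (snd M.carrier M.carrier) ≫ H.curry act :=
  H.curry₂ (castHom (assocAt ψ (fst (prod M.carrier M.carrier) X ≫ fst _ _)
    (fst (prod M.carrier M.carrier) X ≫ snd _ _) (snd _ _))
    (by simp only [evAt, comp_op, H.ev_compose, ← Strict.assoc, op_ev_curry])
    (by simp only [evAt, comp_op, ← Strict.assoc, op_ev_curry]))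

/-- The unit 2-cell with transpose `ψ₀`. -/
def homφ₀ {act : prod M.carrier X ⟶ X} (ψ₀ : 𝟙 X ⟶ op act (const M.unit X) (𝟙 X)) :
    H.identity ⟶ M.unit ≫ H.curry act :=
  H.curry₂ (castHom (leftCounitAt ψ₀ (snd one X))
    (by rw [identity, evAt_curry])
    (by rw [evAt, ← Strict.assoc, op_ev_curry, const, toOne_uniq (fst _ _)]))

/-- The 2-cell `homφ ψ` is defined from the component of `ψ` over `(M × M) × X`. Whiskering back
along the reassociation from `M × (M × X)` puts the component at the three projections, which is `ψ`
itself. -/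
theorem transposes_hom {act : prod M.carrier X ⟶ X}
    (ψ : op act (p₁ M.carrier M.carrier X) (op act (p₂ _ _ _) (p₃ _ _ _)) ⟶
      op act (op M.tensor (p₁ _ _ _) (p₂ _ _ _)) (p₃ _ _ _))
    (ψ₀ : 𝟙 X ⟶ op act (const M.unit X) (𝟙 X)) :
    Transposes H (H.homφ ψ) (H.homφ₀ ψ₀) ψ ψ₀ := by
  refine .of_heq (H.evAt_curry act).symm ?_ ?_
  · rw [homφ, evAt₂_curry₂]
    refine HEq.trans ?_ (hwl rfl ?_ ?_ (castHom_heq _ _ _)).symm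
    · refine HEq.trans ?_ (wl_assocAt _ _ _ _ _).symm
      exact (heq_of_eq (assocAt_p ψ).symm).trans (hassocAt _ (by simp) (by simp) (by simp))
    · simp only [evAt, comp_op, H.ev_compose, ← Strict.assoc, op_ev_curry]
    · simp only [evAt, comp_op, ← Strict.assoc, op_ev_curry]
  · rw [homφ₀, evAt₂_curry₂]
    refine HEq.trans ?_ (hwl rfl ?_ ?_ (castHom_heq _ _ _)).symm
    · refine HEq.trans ?_ (wl_leftCounitAt _ _ _).symm
      refine HEq.trans ?_ (castHom_heq _ _ _).symm
      rw [pair_snd]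
      exact (id_wl _).symm
    · rw [identity, evAt_curry]
    · rw [evAt, ← Strict.assoc, op_ev_curry, const, toOne_uniq (fst _ _)]

/-- The lax monoidal 1-cell with values in `X ^ X` corresponding to a lax action. -/
@[simps]
def ofAction (s : Action M X) : LaxHom M H.monoidalObject where
  hom := H.curry s.act
  φ := H.homφ s.ψ
  φ₀ := H.homφ₀ s.ψ₀
  map_assoc := by
    have T := H.transposes_hom s.ψ s.ψ₀
    -- Faithfulness reduces the axiom to its transpose, and there it is the action axiom read from
    -- right to left.
    exact H.ext_heq ((T.assoc_left _ _ rfl rfl rfl).trans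
      ((heq_of_eq (s.act_assoc_at _ _ _ _).symm).trans (T.assoc_right _ _ rfl rfl rfl).symm))
  map_lam := by
    have T := H.transposes_hom s.ψ s.ψ₀
    -- No version at a general stage is needed: faithfulness tests over `M × X`, where `act_lam` is
    -- stated.
    exact H.ext_heq ((T.lam _ _).trans ((heq_of_eq s.act_lam).trans (T.leftUnit _ _).symm))
  map_rho := by
    have T := H.transposes_hom s.ψ s.ψ₀
    exact H.ext_heq ((T.rho _ _).trans ((heq_of_eq s.act_rho).trans (T.rightUnit _ _).symm))

theorem transposes_ofAction (s : Action M X) :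
    Transposes H (H.ofAction s).φ (H.ofAction s).φ₀ s.ψ s.ψ₀ :=
  H.transposes_hom _ _

end Exponential

/-! ### Invertibility under transposition: strong 1-cells and strong actions. -/

theorem isIso_castHom {C : Type*} [Category C] {a b a' b' : C} {σ : a ⟶ b} (ha : a = a')
    (hb : b = b') : IsIso (castHom σ ha hb) ↔ IsIso σ := by
  subst ha hb; rw [castHom_rfl]

theorem isIso_heq {C : Type*} [Category C] {a b a' b' : C} {σ : a ⟶ b} {τ : a' ⟶ b'} (ha : a = a')
    (hb : b = b') (h : HEq σ τ) : IsIso σ ↔ IsIso τ := by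
  subst ha hb; cases h; rfl

section

variable {A : Type u} [Bicategory.{w, v} A] [Bicategory.Strict A] [FiniteProducts A]

/-- The projections form the generic point, and the component of a 2-cell there is the 2-cell
itself. -/
theorem assocAt_ext {X Y Z U V W : A} {m : prod X V ⟶ W} {n : prod Y Z ⟶ V} {m' : prod U Z ⟶ W}
    {k : prod X Y ⟶ U}
    {α β : op m (p₁ X Y Z) (op n (p₂ X Y Z) (p₃ X Y Z)) ⟶
      op m' (op k (p₁ X Y Z) (p₂ X Y Z)) (p₃ X Y Z)}
    (h : assocAt α (p₁ X Y Z) (p₂ X Y Z) (p₃ X Y Z) = assocAt β (p₁ X Y Z) (p₂ X Y Z) (p₃ X Y Z)) :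
    α = β := by
  rwa [assocAt_p, assocAt_p] at h

theorem leftCounitAt_id {X Y : A} {m : prod X Y ⟶ Y} {u : (one : A) ⟶ X}
    (l : 𝟙 Y ⟶ op m (const u Y) (𝟙 Y)) : leftCounitAt l (𝟙 Y) = l :=
  eq_of_heq ((castHom_heq _ _ _).trans (id_wl _))

theorem isIso_assocAt {X Y Z U V W : A} {m : prod X V ⟶ W} {n : prod Y Z ⟶ V} {m' : prod U Z ⟶ W}
    {k : prod X Y ⟶ U}
    (α : op m (p₁ X Y Z) (op n (p₂ X Y Z) (p₃ X Y Z)) ⟶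
      op m' (op k (p₁ X Y Z) (p₂ X Y Z)) (p₃ X Y Z)) [IsIso α]
    {E : A} (a : E ⟶ X) (b : E ⟶ Y) (c : E ⟶ Z) : IsIso (assocAt α a b c) :=
  (isIso_castHom _ _).2 inferInstance

theorem isIso_leftCounitAt {X Y : A} {m : prod X Y ⟶ Y} {u : (one : A) ⟶ X}
    (l : 𝟙 Y ⟶ op m (const u Y) (𝟙 Y)) [IsIso l] {E : A} (a : E ⟶ Y) :
    IsIso (leftCounitAt l a) :=
  (isIso_castHom _ _).2 inferInstance

theorem isIso_pair₂ {E X Y : A} {a a' : E ⟶ X} {b b' : E ⟶ Y} (σ : a ⟶ a') (τ : b ⟶ b')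
    [IsIso σ] [IsIso τ] : IsIso (pair₂ σ τ) :=
  ⟨pair₂ (inv σ) (inv τ), by rw [← pair₂_comp, IsIso.hom_inv_id, IsIso.hom_inv_id, pair₂_id],
    by rw [← pair₂_comp, IsIso.inv_hom_id, IsIso.inv_hom_id, pair₂_id]⟩

theorem isIso_op₂ {E X Y Z : A} (m : prod X Y ⟶ Z) {a a' : E ⟶ X} {b b' : E ⟶ Y} (σ : a ⟶ a')
    (τ : b ⟶ b') [IsIso σ] [IsIso τ] : IsIso (op₂ m σ τ) :=
  have := isIso_pair₂ σ τ
  inferInstanceAs (IsIso (pair₂ σ τ ▷ m))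

/-- Fully faithful functors reflect isomorphisms: the inverse is lifted by fullness, and the two
identities by faithfulness. -/
theorem Exponential.isIso_of_evAt₂ {X Y : A} (H : Exponential X Y) {E : A} {r r' : E ⟶ H.obj}
    (σ : r ⟶ r') [IsIso (evAt₂ H.ev σ)] : IsIso σ :=
  ⟨H.curry₂ (inv (evAt₂ H.ev σ)),
    H.evAt₂_injective (by rw [evAt₂_comp, H.evAt₂_curry₂, IsIso.hom_inv_id, evAt₂_id]),
    H.evAt₂_injective (by rw [evAt₂_comp, H.evAt₂_curry₂, IsIso.inv_hom_id, evAt₂_id])⟩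

end

namespace Transposes

variable {A : Type u} [Bicategory.{w, v} A] [Bicategory.Strict A] [FiniteProducts A]
    {X : A} {H : Exponential X X} {M : MonoidalObject A} {F : M.carrier ⟶ H.obj}
    {φ : op H.compose (fst M.carrier M.carrier ≫ F) (snd M.carrier M.carrier ≫ F) ⟶
      op M.tensor (fst M.carrier M.carrier) (snd M.carrier M.carrier) ≫ F}
    {φ₀ : H.identity ⟶ M.unit ≫ F} {act : prod M.carrier X ⟶ X}
    {ψ : op act (p₁ M.carrier M.carrier X) (op act (p₂ _ _ _) (p₃ _ _ _)) ⟶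
      op act (op M.tensor (p₁ _ _ _) (p₂ _ _ _)) (p₃ _ _ _)}
    {ψ₀ : 𝟙 X ⟶ op act (const M.unit X) (𝟙 X)}

/-- Recovers the full transpose of `φ` from `ψ`. With `evAt₂_φ₀`, it shows that `ψ` and `ψ₀`
determine `φ` and `φ₀`, and it is how invertibility passes back from an action. -/
theorem evAt₂_φ (T : Transposes H φ φ₀ ψ ψ₀) :
    HEq (evAt₂ H.ev φ) (TwoCat.assocAt ψ (fst (prod M.carrier M.carrier) X ≫ fst _ _)
      (fst (prod M.carrier M.carrier) X ≫ snd _ _) (snd _ _)) := by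
  have h := T.wl_laxAt (fst (prod M.carrier M.carrier) X) (a := fst M.carrier M.carrier)
    (b := snd M.carrier M.carrier) (snd _ _) rfl rfl
  rw [laxAt_fst_snd] at h
  exact h

theorem evAt₂_φ₀ (T : Transposes H φ φ₀ ψ ψ₀) :
    HEq (evAt₂ H.ev φ₀) (TwoCat.leftCounitAt ψ₀ (snd one X)) :=
  HEq.trans (hop₂ _ (by simp [const, toOne_uniq (fst one X)]) (by simp [toOne_uniq (fst one X)])
    rfl rfl
    (by rw [toOne_uniq (fst one X)]; exact (castHom_heq _ _ _).symm) HEq.rfl)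
    (T.leftCounitAt (snd one X)).symm

theorem isIso_iff (T : Transposes H φ φ₀ ψ ψ₀) : (IsIso φ ∧ IsIso φ₀) ↔ (IsIso ψ ∧ IsIso ψ₀) := by
  constructor
  · rintro ⟨_, _⟩
    constructor
    · have h := T.assocAt (p₁ M.carrier M.carrier X) (p₂ _ _ _) (p₃ _ _ _)
      rw [assocAt_p] at h
      have : IsIso (laxAt φ (p₁ M.carrier M.carrier X) (p₂ _ _ _)) :=
        (isIso_castHom _ _).2 inferInstance
      exact (isIso_heq (by simp [T.op_act, H.ev_compose]) (by simp [T.op_act])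
        h).2 (isIso_op₂ _ _ _)
    · have h := T.leftCounitAt (𝟙 X)
      rw [leftCounitAt_id] at h
      have : IsIso (constAt φ₀ X) := (isIso_castHom _ _).2 inferInstance
      exact (isIso_heq (by simp [H.ev_identity]) (by simp [T.op_act]) h).2 (isIso_op₂ _ _ _)
  · rintro ⟨_, _⟩
    constructor
    · have := (isIso_heq (by simp [evAt, T.op_act, H.ev_compose]) (by simp [evAt, T.op_act])
        T.evAt₂_φ).2 (isIso_assocAt _ _ _ _)
      exact H.isIso_of_evAt₂ φ
    · have := (isIso_heq (by rw [Exponential.identity, H.evAt_curry])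
        (by simp [evAt, T.op_act, toOne_uniq (fst one X)]) T.evAt₂_φ₀).2 (isIso_leftCounitAt _ _)
      exact H.isIso_of_evAt₂ φ₀

end Transposes

/-! ### The correspondence on 0-cells is bijective. -/

namespace Exponential

variable {A : Type u} [Bicategory.{w, v} A] [Bicategory.Strict A] [FiniteProducts A] {X : A}
  (H : Exponential X X) {M N : MonoidalObject A}

/-- Transposition is injective on 1-cells and faithful on 2-cells, so an action is related by
`Transposes` to at most one lax monoidal 1-cell. `toAction_eq` is the converse uniqueness, and the
two together make the constructions mutually inverse. -/
theorem ofAction_eq {r : LaxHom M H.monoidalObject} {s : Action M X}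
    (T : Transposes H r.φ r.φ₀ s.ψ s.ψ₀) : H.ofAction s = r := by
  have T' := H.transposes_ofAction s
  obtain ⟨F, φ, φ₀, _, _, _⟩ := r
  -- The underlying 1-cells have to be identified before the 2-cells over them can be compared.
  have hF : F = H.curry s.act := H.evAt_injective (T.act.symm.trans T'.act)
  subst hF
  refine LaxHom.hext rfl (heq_of_eq ?_) (heq_of_eq ?_)
  · exact H.evAt₂_injective (eq_of_heq (T'.evAt₂_φ.trans T.evAt₂_φ.symm))
  · exact H.evAt₂_injective (eq_of_heq (T'.evAt₂_φ₀.trans T.evAt₂_φ₀.symm))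

theorem toAction_eq {r : LaxHom M H.monoidalObject} {s : Action M X}
    (T : Transposes H r.φ r.φ₀ s.ψ s.ψ₀) : H.toAction r = s := by
  have T' := H.transposes_toAction r
  obtain ⟨act, ψ, ψ₀, _, _, _⟩ := s
  obtain rfl := T.act
  refine Action.ext rfl (heq_of_eq ?_) (heq_of_eq ?_)
  · exact assocAt_ext (eq_of_heq ((T'.assocAt _ _ _).trans (T.assocAt _ _ _).symm))
  · have h := eq_of_heq ((T'.leftCounitAt (𝟙 X)).trans (T.leftCounitAt (𝟙 X)).symm)
    rwa [leftCounitAt_id, leftCounitAt_id] at h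

theorem ofAction_toAction (r : LaxHom M H.monoidalObject) : H.ofAction (H.toAction r) = r :=
  H.ofAction_eq (H.transposes_toAction r)

theorem toAction_ofAction (s : Action M X) : H.toAction (H.ofAction s) = s :=
  H.toAction_eq (H.transposes_ofAction s)

theorem isStrong_iff (r : LaxHom M H.monoidalObject) : r.IsStrong ↔ (H.toAction r).IsStrong :=
  (H.transposes_toAction r).isIso_iff

end Exponential

/-! ### Transposing the 2-cell component of a 1-cell. -/

theorem ActHom.map_unit_at {A : Type u} [Bicategory.{w, v} A] [Bicategory.Strict A]
    [FiniteProducts A] {X : A} {M N : MonoidalObject A} {s : Action M X} {t : Action N X}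
    (f : ActHom s t) {E : A} (x : E ⟶ X) :
    leftCounitAt t.ψ₀ x ≫ op₂ t.act (constAt f.toLaxHom.φ₀ E) (𝟙 x) ≫
      actAt f.ξ (const M.unit E) x = leftCounitAt s.ψ₀ x := by
  have h := congrArg (fun σ => x ◁ σ) f.map_unit
  simp only [whiskerLeft_comp] at h
  refine eq_of_heq (HEq.trans ?_ ((heq_of_eq h).trans (castHom_heq _ _ _).symm))
  refine hcomp (by simp) (by simp) (by simp) (castHom_heq _ _ _)
    (hcomp (by simp) (by simp) (by simp) ?_ ?_)
  · refine HEq.trans (hop₂ _ (by simp) (by simp) (by simp) (by simp) ?_ ?_) (wl_op₂ _ _ _ _).symm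
    · exact (wl_constAt _ _).symm
    · rw [whiskerLeft_id]; exact hid (by simp)
  · exact (hactAt _ (by simp) (by simp)).trans (wl_actAt _ _ _ _).symm

/-- Any `f` into `M × M` is the pairing of its two components, so `laxAt_compφ` applies to
whiskering along `f`. -/
theorem LaxHom.wl_compφ {A : Type u} [Bicategory.{w, v} A] [Bicategory.Strict A]
    [FiniteProducts A] {M N P : MonoidalObject A} (F : LaxHom M N) (G : LaxHom N P) {D : A}
    (f : D ⟶ prod M.carrier M.carrier) {a b : D ⟶ M.carrier} (ha : f ≫ fst _ _ = a)
    (hb : f ≫ snd _ _ = b) :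
    HEq (f ◁ compφ F G) (laxAt G.φ (a ≫ F.hom) (b ≫ F.hom) ≫ laxAt F.φ a b ▷ G.hom) := by
  subst ha hb
  refine HEq.trans ?_ (laxAt_compφ F G _ _)
  exact (hwl (by simp [comp_fst_pair]) rfl rfl HEq.rfl).trans (castHom_heq _ _ _).symm

/-- A 2-cell `θ : r' ∘ F ⟶ r` between 1-cells with values in `X ^ X` and a 2-cell
`ξ : F(A) ⋆' X ⟶ A ⋆ X` correspond to each other under transposition. -/
structure HomTransposes {A : Type u} [Bicategory.{w, v} A] [Bicategory.Strict A]
    [FiniteProducts A] {X : A} (H : Exponential X X) {M N : MonoidalObject A}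
    {r : LaxHom M H.monoidalObject} {r' : LaxHom N H.monoidalObject} {s : Action M X}
    {t : Action N X} (F : M.carrier ⟶ N.carrier) (θ : F ≫ r'.hom ⟶ r.hom)
    (ξ : op t.act (fst M.carrier X ≫ F) (snd M.carrier X) ⟶
      op s.act (fst M.carrier X) (snd M.carrier X)) : Prop where
  left : Transposes H r.φ r.φ₀ s.ψ s.ψ₀
  right : Transposes H r'.φ r'.φ₀ t.ψ t.ψ₀
  heq : HEq ξ (evAt₂ H.ev θ)

namespace HomTransposes

variable {A : Type u} [Bicategory.{w, v} A] [Bicategory.Strict A]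
    [FiniteProducts A] {X : A} {H : Exponential X X} {M N : MonoidalObject A}
    {r : LaxHom M H.monoidalObject} {r' : LaxHom N H.monoidalObject} {s : Action M X}
    {t : Action N X}

/-- Passes from the universal comparison of `ξ` with `θ` to every stage, as `Transposes.of_heq` does
for the structure 2-cells. -/
theorem actAt {F : M.carrier ⟶ N.carrier} {θ : F ≫ r'.hom ⟶ r.hom}
    {ξ : op t.act (fst M.carrier X ≫ F) (snd M.carrier X) ⟶
      op s.act (fst M.carrier X) (snd M.carrier X)} (T : HomTransposes H F θ ξ) {E : A}
    (a : E ⟶ M.carrier) (x : E ⟶ X) : HEq (actAt ξ a x) (op₂ H.ev (a ◁ θ) (𝟙 x)) := by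
  refine (castHom_heq _ _ _).trans ((hwl rfl ?_ ?_ T.heq).trans
    (wl_evAt₂ H.ev θ _ (by simp) (by simp)))
  · simp [T.right.op_act, evAt]
  · simp [T.left.op_act, evAt]

theorem wl_whiskerLeft {F : M.carrier ⟶ N.carrier} {θ : F ≫ r'.hom ⟶ r.hom}
    {ξ : op t.act (fst M.carrier X ≫ F) (snd M.carrier X) ⟶
      op s.act (fst M.carrier X) (snd M.carrier X)} (T : HomTransposes H F θ ξ) {D E : A}
    (f : D ⟶ E) {a : E ⟶ M.carrier} {a' : D ⟶ M.carrier} (x : D ⟶ X) (ha : f ≫ a = a') :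
    HEq (op₂ H.ev (f ◁ (a ◁ θ)) (𝟙 x)) (TwoCat.actAt ξ a' x) := by
  subst ha
  exact (hop₂ _ (by simp) (by simp) rfl rfl (comp_wl _ _ _).symm HEq.rfl).trans (T.actAt _ _).symm

variable {F : LaxHom M N} {θ : F.hom ≫ r'.hom ⟶ r.hom}
    {ξ : op t.act (fst M.carrier X ≫ F.hom) (snd M.carrier X) ⟶
      op s.act (fst M.carrier X) (snd M.carrier X)}

/-- The side of monoidality containing `θ ⊗ θ`. Under evaluation `θ ⊗ θ` becomes `ξ` used twice, and
`r.φ` becomes the structure 2-cell of the source action. -/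
theorem tensor_left (T : HomTransposes H F.hom θ ξ) {D : A}
    (f : D ⟶ prod M.carrier M.carrier) {a b : D ⟶ M.carrier} (x : D ⟶ X)
    (ha : f ≫ fst _ _ = a) (hb : f ≫ snd _ _ = b) :
    HEq (op₂ H.ev (f ◁ (op₂ H.compose (fst M.carrier M.carrier ◁ θ)
        (snd M.carrier M.carrier ◁ θ) ≫ r.φ)) (𝟙 x))
      (op₂ t.act (𝟙 (a ≫ F.hom)) (TwoCat.actAt ξ b x) ≫ TwoCat.actAt ξ a (op s.act b x) ≫
        assocAt s.ψ a b x) := by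
  subst ha hb
  rw [whiskerLeft_comp, op₂_comp_id, ← assoc₂]
  refine hcomp (by simp [T.right.op_act, H.ev_compose])
    (by simp [T.left.op_act, H.ev_compose]) (by simp [T.left.op_act]) ?_ ?_
  · refine (hop₂ _ (by simp) (by simp) rfl rfl (wl_op₂ _ _ _ _) HEq.rfl).trans
      ((H.op₂_ev_compose _ _ _).trans ?_)
    -- By functoriality in two variables the pair can be split in either order. The inner `θ` comes
    -- first because the axiom for `ξ` starts with `1 ⋆' ξ`.
    have key : op₂ H.ev (𝟙 (f ≫ fst _ _ ≫ F.hom ≫ r'.hom))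
          (op₂ H.ev (f ◁ (snd M.carrier M.carrier ◁ θ)) (𝟙 x)) ≫
        op₂ H.ev (f ◁ (fst M.carrier M.carrier ◁ θ)) (𝟙 _) =
        op₂ H.ev (f ◁ (fst M.carrier M.carrier ◁ θ))
          (op₂ H.ev (f ◁ (snd M.carrier M.carrier ◁ θ)) (𝟙 x)) := by
      rw [← op₂_comp, Category.id_comp, Category.comp_id]
    refine (heq_of_eq key.symm).trans (hcomp (by simp [T.right.op_act])
      (by simp [T.right.op_act, T.left.op_act]) (by simp [T.left.op_act]) ?_ ?_)
    · refine HEq.trans (hop₂ _ (by simp) (by simp) (by simp [T.right.op_act])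
        (by simp [T.left.op_act]) ?_ (T.wl_whiskerLeft f x rfl)) (T.right.op₂_act _ _).symm
      rw [id_whiskerRight]; exact hid (by simp)
    · have e : op H.ev (f ≫ snd M.carrier M.carrier ≫ r.hom) x =
          op s.act (f ≫ snd M.carrier M.carrier) x := by simp [T.left.op_act]
      exact (hop₂ _ rfl rfl e e HEq.rfl (hid e)).trans (T.wl_whiskerLeft f _ rfl)
  · have h := T.left.wl_laxAt f x (a := fst M.carrier M.carrier) (b := snd M.carrier M.carrier)
      rfl rfl
    rwa [laxAt_fst_snd] at h

/-- The tensor 2-cell of `r' ∘ F` is `r'.φ` at `(F a, F b)` followed by the image of `F.φ`. These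
transpose to the structure 2-cell of the target action and to `φ ⋆' 1`, and `θ` at `a ⊗ b` supplies
the last `ξ`. -/
theorem tensor_right (T : HomTransposes H F.hom θ ξ) {D : A}
    (f : D ⟶ prod M.carrier M.carrier) {a b : D ⟶ M.carrier} (x : D ⟶ X)
    (ha : f ≫ fst _ _ = a) (hb : f ≫ snd _ _ = b) :
    HEq (op₂ H.ev (f ◁ ((F.comp r').φ ≫ op M.tensor (fst _ _) (snd _ _) ◁ θ)) (𝟙 x))
      (assocAt t.ψ (a ≫ F.hom) (b ≫ F.hom) x ≫ op₂ t.act (laxAt F.φ a b) (𝟙 x) ≫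
        TwoCat.actAt ξ (op M.tensor a b) x) := by
  rw [whiskerLeft_comp, op₂_comp_id, ← assoc₂]
  refine hcomp (by simp [← ha, ← hb, T.right.op_act, H.ev_compose])
    (by simp [← ha, ← hb, T.right.op_act]) (by simp [← ha, ← hb, T.left.op_act]) ?_
    (T.wl_whiskerLeft f x (by simp [← ha, ← hb]))
  refine (hop₂ _ (by simp [← ha, ← hb]) (by simp [← ha, ← hb]) rfl rfl
    (F.wl_compφ r' f ha hb) HEq.rfl).trans ?_
  rw [op₂_comp_id]
  exact hcomp (by simp [T.right.op_act, H.ev_compose])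
    (by simp [T.right.op_act]) (by simp [T.right.op_act]) (T.right.assocAt _ _ _).symm
    (T.right.op₂_act _ _).symm

theorem unit_left (T : HomTransposes H F.hom θ ξ) {D : A} (f : D ⟶ one) (x : D ⟶ X) :
    HEq (op₂ H.ev (f ◁ ((F.comp r').φ₀ ≫ M.unit ◁ θ)) (𝟙 x))
      (leftCounitAt t.ψ₀ x ≫ op₂ t.act (constAt F.φ₀ D) (𝟙 x) ≫
        TwoCat.actAt ξ (const M.unit D) x) := by
  obtain rfl := toOne_uniq f
  rw [whiskerLeft_comp, op₂_comp_id, ← assoc₂]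
  refine hcomp (H.ev_identity _) (by simp [T.right.op_act]) (by simp [T.left.op_act]) ?_
    (T.wl_whiskerLeft _ x rfl)
  refine (hop₂ _ rfl (by simp) rfl rfl
    ((castHom_heq _ _ _).symm.trans (F.constAt_compφ₀ r' D)) HEq.rfl).trans ?_
  refine (heq_of_eq (op₂_comp_id H.ev (constAt r'.φ₀ D) (constAt F.φ₀ D ▷ r'.hom) x)).trans ?_
  exact hcomp (by simp [H.ev_identity]) (by simp [T.right.op_act]) (by simp [T.right.op_act])
    (T.right.leftCounitAt _).symm (T.right.op₂_act _ _).symm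

end HomTransposes

/-- Supplies the transpose of the right-hand side of the unit axiom for `θ`; `unit_left` supplies
that of the left-hand side. -/
theorem Transposes.wl_φ₀ {A : Type u} [Bicategory.{w, v} A] [Bicategory.Strict A]
    [FiniteProducts A] {X : A} {H : Exponential X X} {M : MonoidalObject A}
    {r : LaxHom M H.monoidalObject} {s : Action M X} (T : Transposes H r.φ r.φ₀ s.ψ s.ψ₀)
    {D : A} (f : D ⟶ one) (x : D ⟶ X) :
    HEq (op₂ H.ev (f ◁ r.φ₀) (𝟙 x)) (TwoCat.leftCounitAt s.ψ₀ x) := by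
  obtain rfl := toOne_uniq f
  exact (hop₂ _ rfl (by simp) rfl rfl (castHom_heq _ _ _).symm HEq.rfl).trans
    (T.leftCounitAt x).symm

/-! ### 1-cells and 2-cells of the lax slice against those of actions. -/

namespace Exponential

variable {A : Type u} [Bicategory.{w, v} A] [Bicategory.Strict A]
    [FiniteProducts A] {X : A} {H : Exponential X X} {M N P : MonoidalObject A}
    {r : LaxHom M H.monoidalObject} {r' : LaxHom N H.monoidalObject}
    {r'' : LaxHom P H.monoidalObject} {s : Action M X}
    {t : Action N X} {q : Action P X}

/-- The morphism of actions corresponding to a monoidal transformation `r' ∘ F ⟶ r`. -/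
def toActHom (T : Transposes H r.φ r.φ₀ s.ψ s.ψ₀) (T' : Transposes H r'.φ r'.φ₀ t.ψ t.ψ₀)
    (F : LaxHom M N) (θ : LaxHom₂ (F.comp r') r) : ActHom s t where
  toLaxHom := F
  ξ := castHom (evAt₂ H.ev θ.hom) (by simp [evAt, T'.op_act]) (by simp [evAt, T.op_act])
  map_act := by
    have K : HomTransposes H F.hom θ.hom _ := ⟨T, T', castHom_heq (evAt₂ H.ev θ.hom)
      (by simp [evAt, T'.op_act]) (by simp [evAt, T.op_act])⟩
    have h := congrArg (fun σ => op₂ H.ev (pair (p₁ M.carrier M.carrier X) (p₂ _ _ _) ◁ σ)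
      (𝟙 (p₃ _ _ _))) θ.map_tensor
    have e := eq_of_heq ((K.tensor_right _ _ (pair_fst _ _) (pair_snd _ _)).symm.trans
      ((heq_of_eq h.symm).trans (K.tensor_left _ _ (pair_fst _ _) (pair_snd _ _))))
    -- The transposed axiom was taken at the projections, so its last factor is `s.ψ` itself.
    rwa [assocAt_p] at e
  map_unit := by
    have K : HomTransposes H F.hom θ.hom _ := ⟨T, T', castHom_heq (evAt₂ H.ev θ.hom)
      (by simp [evAt, T'.op_act]) (by simp [evAt, T.op_act])⟩
    have h := congrArg (fun σ => op₂ H.ev (toOne X ◁ σ) (𝟙 (𝟙 X))) θ.map_unit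
    have e := eq_of_heq ((K.unit_left _ _).symm.trans ((heq_of_eq h).trans (T.wl_φ₀ _ _)))
    rwa [leftCounitAt_id, leftCounitAt_id] at e

theorem toActHom_ξ (T : Transposes H r.φ r.φ₀ s.ψ s.ψ₀) (T' : Transposes H r'.φ r'.φ₀ t.ψ t.ψ₀)
    (F : LaxHom M N) (θ : LaxHom₂ (F.comp r') r) :
    HEq (toActHom T T' F θ).ξ (evAt₂ H.ev θ.hom) :=
  castHom_heq (evAt₂ H.ev θ.hom) (by simp [evAt, T'.op_act]) (by simp [evAt, T.op_act])

/-- The monoidal transformation corresponding to a morphism of actions. -/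
def ofActHom (T : Transposes H r.φ r.φ₀ s.ψ s.ψ₀) (T' : Transposes H r'.φ r'.φ₀ t.ψ t.ψ₀)
    (f : ActHom s t) : LaxHom₂ (f.toLaxHom.comp r') r where
  hom := H.curry₂ (castHom f.ξ (by simp [evAt, T'.op_act]) (by simp [evAt, T.op_act]))
  map_tensor := by
    have K : HomTransposes H f.toLaxHom.hom _ f.ξ := ⟨T, T', (castHom_heq f.ξ
      (by simp [evAt, T'.op_act]) (by simp [evAt, T.op_act])).symm.trans
        (heq_of_eq (H.evAt₂_curry₂ _).symm)⟩
    -- The same two translations as in `toActHom`, now used with faithfulness to pull the axiom for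
    -- `ξ` back to monoidality of `θ`.
    exact H.ext_heq ((K.tensor_left _ _ rfl rfl).trans
      ((heq_of_eq (f.map_act_at _ _ _).symm).trans (K.tensor_right _ _ rfl rfl).symm))
  map_unit := by
    have K : HomTransposes H f.toLaxHom.hom _ f.ξ := ⟨T, T', (castHom_heq f.ξ
      (by simp [evAt, T'.op_act]) (by simp [evAt, T.op_act])).symm.trans
        (heq_of_eq (H.evAt₂_curry₂ _).symm)⟩
    exact H.ext_heq ((K.unit_left _ _).trans
      ((heq_of_eq (f.map_unit_at _)).trans (T.wl_φ₀ _ _).symm))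

theorem evAt₂_ofActHom (T : Transposes H r.φ r.φ₀ s.ψ s.ψ₀)
    (T' : Transposes H r'.φ r'.φ₀ t.ψ t.ψ₀) (f : ActHom s t) :
    HEq (evAt₂ H.ev (ofActHom T T' f).hom) f.ξ :=
  (heq_of_eq (H.evAt₂_curry₂ _)).trans (castHom_heq _ _ _)

/-- The condition on a 2-cell of actions is the transpose of the condition on a 2-cell of the lax
slice. -/
theorem map_act_iff (T : Transposes H r.φ r.φ₀ s.ψ s.ψ₀) (T' : Transposes H r'.φ r'.φ₀ t.ψ t.ψ₀)
    {F G : M.carrier ⟶ N.carrier} {θ : F ≫ r'.hom ⟶ r.hom} {κ : G ≫ r'.hom ⟶ r.hom}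
    {ξ : op t.act (fst M.carrier X ≫ F) (snd M.carrier X) ⟶
      op s.act (fst M.carrier X) (snd M.carrier X)}
    {ζ : op t.act (fst M.carrier X ≫ G) (snd M.carrier X) ⟶
      op s.act (fst M.carrier X) (snd M.carrier X)}
    (hξ : HEq ξ (evAt₂ H.ev θ)) (hζ : HEq ζ (evAt₂ H.ev κ)) (τ : F ⟶ G) :
    op₂ t.act (fst M.carrier X ◁ τ) (𝟙 (snd M.carrier X)) ≫ ζ = ξ ↔
      τ ▷ r'.hom ≫ κ = θ := by
  have e : HEq (op₂ t.act (fst M.carrier X ◁ τ) (𝟙 (snd M.carrier X)) ≫ ζ)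
      -- The left side of the action condition is the transpose of the left side of the slice
      -- condition; both implications then follow from faithfulness of `evAt₂`.
      (evAt₂ H.ev (τ ▷ r'.hom ≫ κ)) := by
    rw [evAt₂_comp]
    refine hcomp (by simp [evAt, T'.op_act]) (by simp [evAt, T'.op_act])
      (by simp [evAt, T.op_act]) ((T'.op₂_act _ _).trans ?_) hζ
    exact hop₂ _ (by simp) (by simp) rfl rfl (wl_wr _ _ _) HEq.rfl
  constructor
  · intro h
    exact H.evAt₂_injective (eq_of_heq (e.symm.trans ((heq_of_eq h).trans hξ)))
  · intro h
    rw [h] at e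
    exact eq_of_heq (e.trans hξ.symm)

/-- Composites of morphisms of actions correspond to composites in the lax slice. -/
theorem compξ_heq_evAt₂ (T : Transposes H r.φ r.φ₀ s.ψ s.ψ₀)
    (T' : Transposes H r'.φ r'.φ₀ t.ψ t.ψ₀) (T'' : Transposes H r''.φ r''.φ₀ q.ψ q.ψ₀)
    (f : ActHom s t) (g : ActHom t q) {θ : f.toLaxHom.hom ≫ r'.hom ⟶ r.hom}
    {κ : g.toLaxHom.hom ≫ r''.hom ⟶ r'.hom} (hf : HEq f.ξ (evAt₂ H.ev θ))
    (hg : HEq g.ξ (evAt₂ H.ev κ)) :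
    HEq (ActHom.compξ f g) (evAt₂ H.ev ((α_ f.toLaxHom.hom g.toLaxHom.hom r''.hom).hom ≫
      f.toLaxHom.hom ◁ κ ≫ θ)) := by
  have K : HomTransposes H g.toLaxHom.hom κ g.ξ := ⟨T', T'', hg⟩
  -- Composition in the lax slice carries an associator, absent from `compξ`. In a strict 2-category
  -- it transposes to an identity, which is inserted here to match it.
  have key : 𝟙 _ ≫ actAt g.ξ (fst M.carrier X ≫ f.toLaxHom.hom) (snd M.carrier X) ≫ f.ξ =
    actAt g.ξ (fst M.carrier X ≫ f.toLaxHom.hom) (snd M.carrier X) ≫ f.ξ := Category.id_comp _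
  refine (f.compξ_heq g).trans ((heq_of_eq key.symm).trans ?_)
  rw [evAt₂_comp, evAt₂_comp, Strict.associator_eqToIso]
  have e : op q.act ((fst M.carrier X ≫ f.toLaxHom.hom) ≫ g.toLaxHom.hom) (snd M.carrier X) =
    evAt H.ev ((f.toLaxHom.hom ≫ g.toLaxHom.hom) ≫ r''.hom) := by simp [evAt, T''.op_act]
  refine hcomp e (by simp [evAt, T''.op_act]) (by simp [evAt, T.op_act])
    (HEq.trans (hid (by simp [T''.op_act])) (H.wl_eqToHom _ (Strict.assoc _ _ _) _).symm)
    (hcomp (by simp [evAt, T''.op_act]) (by simp [evAt, T'.op_act])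
      (by simp [evAt, T.op_act]) ((K.actAt _ _).trans ?_) hf)
  exact hop₂ _ (by simp) (by simp) rfl rfl (comp_wl _ _ _) HEq.rfl

/-- The identity of an action corresponds to the identity in the lax slice. -/
theorem idξ_heq_evAt₂ (T : Transposes H r.φ r.φ₀ s.ψ s.ψ₀) :
    HEq (ActHom.idξ s) (evAt₂ H.ev (λ_ r.hom).hom) := by
  rw [Strict.leftUnitor_eqToIso]
  exact (ActHom.idξ_heq s).trans ((hid (by simp [T.op_act])).trans
    (H.wl_eqToHom _ (Strict.id_comp _) _).symm)

end Exponential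

/-! ### Equality of strict 2-functors and of cells over propositionally equal 0-cells. -/

/-- Strict 2-functors that agree on 0-cells, 1-cells and 2-cells are equal. -/
theorem strictPseudofunctor_ext {B : Type*} [Bicategory B] {C : Type*} [Bicategory C]
    {F G : StrictPseudofunctor B C} (h₀ : ∀ a, F.obj a = G.obj a)
    (h₁ : ∀ {a b : B} (f : a ⟶ b), HEq (F.map f) (G.map f))
    (h₂ : ∀ {a b : B} {f g : a ⟶ b} (η : f ⟶ g), HEq (F.map₂ η) (G.map₂ η)) : F = G := by
  obtain ⟨⟨⟨⟨⟨⟨Fo, Fm⟩, F₂⟩, _, _⟩, Fi, Fc, _, _, _, _, _⟩, _, hFi⟩, _, hFc⟩ := F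
  obtain ⟨⟨⟨⟨⟨⟨Go, Gm⟩, G₂⟩, _, _⟩, Gi, Gc, _, _, _, _, _⟩, _, hGi⟩, _, hGc⟩ := G
  obtain rfl : Fo = Go := funext h₀
  obtain rfl : @Fm = @Gm := by
    funext a b f; exact eq_of_heq (h₁ f)
  obtain rfl : @F₂ = @G₂ := by
    funext a b f g η; exact eq_of_heq (h₂ η)
  -- The comparison 2-cells for identities and composites are `eqToIso`s by strictness, so they
  -- carry no further data.
  obtain rfl : Fi = Gi := by
    funext a; exact (hFi a).trans (hGi a).symm
  obtain rfl : @Fc = @Gc := by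
    funext a b c f g; exact (hFc f g).trans (hGc f g).symm
  rfl

namespace LaxSlice

/-- The whiskering conditions on a strict 2-functor contain transports along `map_comp`; these do
not affect the underlying 2-cell. -/
theorem hom₂_left_eqToHom_comp {B : Type u} [Bicategory.{w, v} B] {Z : B} {b c : LaxSlice Z}
    {f f' g' g : b ⟶ c} (h : f = f') (σ : f' ⟶ g') (h' : g' = g) :
    HEq (Hom₂.left (eqToHom h ≫ σ ≫ eqToHom h')) (Hom₂.left σ) := by
  subst h h'; rw [eqToHom_refl, eqToHom_refl, Category.id_comp, Category.comp_id]

/-- A round trip of transposition returns a 0-cell equal to the original only propositionally.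
Fixing `M` and `N` and varying just the structure 1-cells lets those equalities be substituted; the
variants for 2-cells and for actions serve the same purpose. -/
theorem hom_heq {B : Type u} [Bicategory.{w, v} B] {Z : B} {M N : B} {r s : M ⟶ Z}
    {r' s' : N ⟶ Z} (h : r = s) (h' : r' = s') {f : (⟨M, r⟩ : LaxSlice Z) ⟶ ⟨N, r'⟩}
    {g : (⟨M, s⟩ : LaxSlice Z) ⟶ ⟨N, s'⟩} (hl : Hom.left f = Hom.left g)
    (hθ : HEq (Hom.θ f) (Hom.θ g)) : HEq f g := by
  subst h h'; exact heq_of_eq (Hom.hext hl hθ)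

theorem hom₂_heq {B : Type u} [Bicategory.{w, v} B] {Z : B} {M N : B} {r s : M ⟶ Z}
    {r' s' : N ⟶ Z} (h : r = s) (h' : r' = s') {f f' : (⟨M, r⟩ : LaxSlice Z) ⟶ ⟨N, r'⟩}
    {g g' : (⟨M, s⟩ : LaxSlice Z) ⟶ ⟨N, s'⟩} (hf : HEq f g) (hf' : HEq f' g') {σ : f ⟶ f'}
    {τ : g ⟶ g'} (hl : HEq (Hom₂.left σ) (Hom₂.left τ)) : HEq σ τ := by
  subst h h'; cases hf; cases hf'; exact heq_of_eq (Hom₂.ext (eq_of_heq hl))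

end LaxSlice

section

variable {A : Type u} [Bicategory.{w, v} A] [Bicategory.Strict A] [FiniteProducts A]

theorem LaxHom₂.heq_of_hom {M N : MonoidalObject A} {F G F' G' : LaxHom M N} (hF : F = F')
    (hG : G = G') {σ : LaxHom₂ F G} {τ : LaxHom₂ F' G'} (h : HEq σ.hom τ.hom) : HEq σ τ := by
  subst hF hG; exact heq_of_eq (LaxHom₂.ext (eq_of_heq h))

namespace LaxAction

variable {X : A}

theorem under₂_eqToHom {s t : LaxAction X} {f g : s ⟶ t} (h : f = g) :
    under₂ (eqToHom h) = eqToHom (congrArg under h) := by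
  subst h; rfl

theorem hom₂_ext {s t : LaxAction X} {f g : s ⟶ t} {σ τ : f ⟶ g} (h : under₂ σ = under₂ τ) :
    σ = τ :=
  ActHom₂.ext (congrArg LaxHom₂.hom h)

theorem hom_heq {M N : MonoidalObject A} {s s' : Action M X} {t t' : Action N X} (h : s = s')
    (h' : t = t') {f : (⟨M, s⟩ : LaxAction X) ⟶ ⟨N, t⟩} {g : (⟨M, s'⟩ : LaxAction X) ⟶ ⟨N, t'⟩}
    (hl : under f = under g) (hξ : HEq (ActHom.ξ f) (ActHom.ξ g)) : HEq f g := by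
  subst h h'; exact heq_of_eq (ActHom.hext hl hξ)

theorem hom₂_heq {M N : MonoidalObject A} {s s' : Action M X} {t t' : Action N X} (h : s = s')
    (h' : t = t') {f f' : (⟨M, s⟩ : LaxAction X) ⟶ ⟨N, t⟩}
    {g g' : (⟨M, s'⟩ : LaxAction X) ⟶ ⟨N, t'⟩} (hf : HEq f g) (hf' : HEq f' g') {σ : f ⟶ f'}
    {τ : g ⟶ g'} (hl : HEq (under₂ σ) (under₂ τ)) : HEq σ τ := by
  subst h h'; cases hf; cases hf'; exact heq_of_eq (hom₂_ext (eq_of_heq hl))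

end LaxAction

/-! ### Transposition as an isomorphism of 2-categories. -/

namespace Exponential

variable {X : A} (H : Exponential X X)

/-- Faithfulness of transposition across boundaries that agree only propositionally, as happens for
`θ` after a round trip. -/
theorem evAt₂_heq {E : A} {a a' b b' : E ⟶ H.obj} {σ : a ⟶ a'} {τ : b ⟶ b'} (h : a = b)
    (h' : a' = b') (e : HEq (evAt₂ H.ev σ) (evAt₂ H.ev τ)) : HEq σ τ := by
  subst h h'; exact heq_of_eq (H.evAt₂_injective (eq_of_heq e))

/-- The action of the lax slice over `X ^ X` on 1-cells. -/
def toActionHom {r r' : LaxSlice H.monoidalObject} (f : r ⟶ r') :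
    (⟨r.left, H.toAction r.arr⟩ : LaxAction X) ⟶ ⟨r'.left, H.toAction r'.arr⟩ :=
  toActHom (H.transposes_toAction _) (H.transposes_toAction _) (LaxSlice.Hom.left f)
    (LaxSlice.Hom.θ f)

theorem toActionHom_ξ {r r' : LaxSlice H.monoidalObject} (f : r ⟶ r') :
    HEq (ActHom.ξ (H.toActionHom f)) (evAt₂ H.ev (LaxHom₂.hom (LaxSlice.Hom.θ f))) :=
  toActHom_ξ _ _ _ _

theorem toActionHom_id (r : LaxSlice H.monoidalObject) : H.toActionHom (𝟙 r) = 𝟙 _ :=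
  ActHom.hext rfl ((H.toActionHom_ξ _).trans
    (idξ_heq_evAt₂ (H.transposes_toAction r.arr)).symm)

theorem toActionHom_comp {a b c : LaxSlice H.monoidalObject} (f : a ⟶ b) (g : b ⟶ c) :
    H.toActionHom (f ≫ g) = H.toActionHom f ≫ H.toActionHom g :=
  ActHom.hext rfl ((H.toActionHom_ξ _).trans
    (compξ_heq_evAt₂ (H.transposes_toAction a.arr) (H.transposes_toAction b.arr)
      (H.transposes_toAction c.arr) (H.toActionHom f) (H.toActionHom g) (H.toActionHom_ξ f)
      (H.toActionHom_ξ g)).symm)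

/-- The action of the lax slice over `X ^ X` on 2-cells. -/
def toActionHom₂ {r r' : LaxSlice H.monoidalObject} {f g : r ⟶ r'} (σ : f ⟶ g) :
    H.toActionHom f ⟶ H.toActionHom g :=
  ActHom₂.mk (LaxSlice.Hom₂.left σ)
    ((map_act_iff (H.transposes_toAction _) (H.transposes_toAction _) (H.toActionHom_ξ f)
      (H.toActionHom_ξ g) _).2 (congrArg LaxHom₂.hom (LaxSlice.Hom₂.w σ)))

/-- Exponential transposition, as a strict 2-functor from the lax slice over `X ^ X`. -/
def transposition : StrictPseudofunctor (LaxSlice H.monoidalObject) (LaxAction X) :=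
  StrictPseudofunctor.mk'' {
    obj := fun r => ⟨r.left, H.toAction r.arr⟩
    map := fun f => H.toActionHom f
    map₂ := fun σ => H.toActionHom₂ σ
    map_id := H.toActionHom_id
    map_comp := H.toActionHom_comp
    map₂_whisker_left := fun f g g' η => LaxAction.hom₂_ext (by
      change _ = LaxAction.under₂ (eqToHom _) ≫ LaxAction.under₂ (H.toActionHom f ◁
        H.toActionHom₂ η) ≫ LaxAction.under₂ (eqToHom _)
      rw [LaxAction.under₂_eqToHom, LaxAction.under₂_eqToHom]
      -- The underlying lax monoidal 1-cells agree by definition, so after applying `under₂` the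
      -- transports run along reflexive equalities.
      exact (castHom_rfl (LaxSlice.Hom.left f ◁ LaxSlice.Hom₂.left η) rfl rfl).symm)
    map₂_whisker_right := fun η g => LaxAction.hom₂_ext (by
      change _ = LaxAction.under₂ (eqToHom _) ≫ LaxAction.under₂ (H.toActionHom₂ η ▷
        H.toActionHom g) ≫ LaxAction.under₂ (eqToHom _)
      rw [LaxAction.under₂_eqToHom, LaxAction.under₂_eqToHom]
      exact (castHom_rfl (LaxSlice.Hom₂.left η ▷ LaxSlice.Hom.left g) rfl rfl).symm)
  }

/-- The 1-cell of the lax slice over `X ^ X` corresponding to a morphism of actions. -/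
def ofActionHom {s t : LaxAction X} (f : s ⟶ t) :
    (⟨s.mon, H.ofAction s.action⟩ : LaxSlice H.monoidalObject) ⟶ ⟨t.mon, H.ofAction t.action⟩ :=
  LaxSlice.Hom.mk (LaxAction.under f)
    (ofActHom (H.transposes_ofAction _) (H.transposes_ofAction _) f)

theorem ofActionHom_θ {s t : LaxAction X} (f : s ⟶ t) :
    HEq (ActHom.ξ f) (evAt₂ H.ev (LaxHom₂.hom (LaxSlice.Hom.θ (H.ofActionHom f)))) :=
  (evAt₂_ofActHom (H.transposes_ofAction s.action) (H.transposes_ofAction t.action) f).symm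

theorem ofActionHom_id (s : LaxAction X) : H.ofActionHom (𝟙 s) = 𝟙 _ :=
  LaxSlice.Hom.hext rfl (heq_of_eq (LaxHom₂.ext (H.evAt₂_injective (eq_of_heq
    ((H.ofActionHom_θ (𝟙 s)).symm.trans (idξ_heq_evAt₂ (H.transposes_ofAction s.action)))))))

theorem ofActionHom_comp {a b c : LaxAction X} (f : a ⟶ b) (g : b ⟶ c) :
    H.ofActionHom (f ≫ g) = H.ofActionHom f ≫ H.ofActionHom g :=
  LaxSlice.Hom.hext rfl (heq_of_eq (LaxHom₂.ext (H.evAt₂_injective (eq_of_heq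
    ((H.ofActionHom_θ (f ≫ g)).symm.trans (compξ_heq_evAt₂ (H.transposes_ofAction a.action)
      (H.transposes_ofAction b.action) (H.transposes_ofAction c.action) f g (H.ofActionHom_θ f)
      (H.ofActionHom_θ g)))))))

/-- The 2-cell of the lax slice over `X ^ X` corresponding to a 2-cell of actions. -/
def ofActionHom₂ {s t : LaxAction X} {f g : s ⟶ t} (σ : f ⟶ g) :
    H.ofActionHom f ⟶ H.ofActionHom g :=
  LaxSlice.Hom₂.mk (LaxAction.under₂ σ) (LaxHom₂.ext
    ((map_act_iff (H.transposes_ofAction _) (H.transposes_ofAction _) (H.ofActionHom_θ f)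
      (H.ofActionHom_θ g) _).1 (ActHom₂.map_act σ)))

/-- Exponential transposition, as a strict 2-functor to the lax slice over `X ^ X`. -/
def transpositionInv : StrictPseudofunctor (LaxAction X) (LaxSlice H.monoidalObject) :=
  StrictPseudofunctor.mk'' {
    obj := fun s => ⟨s.mon, H.ofAction s.action⟩
    map := fun f => H.ofActionHom f
    map₂ := fun σ => H.ofActionHom₂ σ
    map_id := H.ofActionHom_id
    map_comp := H.ofActionHom_comp
    map₂_whisker_left := fun f g g' η => LaxSlice.Hom₂.ext (eq_of_heq
      (LaxSlice.hom₂_left_eqToHom_comp (H.ofActionHom_comp f g)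
        (H.ofActionHom f ◁ H.ofActionHom₂ η) (H.ofActionHom_comp f g').symm).symm)
    map₂_whisker_right := fun {_ _ _ f f'} η g => LaxSlice.Hom₂.ext (eq_of_heq
      (LaxSlice.hom₂_left_eqToHom_comp (H.ofActionHom_comp f g)
        (H.ofActionHom₂ η ▷ H.ofActionHom g) (H.ofActionHom_comp f' g).symm).symm)
  }

theorem ofActionHom_toActionHom {r r' : LaxSlice H.monoidalObject} (f : r ⟶ r') :
    HEq (H.ofActionHom (H.toActionHom f)) f :=
  LaxSlice.hom_heq (H.ofAction_toAction r.arr) (H.ofAction_toAction r'.arr) rfl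
    (LaxHom₂.heq_of_hom (congrArg (LaxHom.comp (LaxSlice.Hom.left f)) (H.ofAction_toAction r'.arr))
      (H.ofAction_toAction r.arr)
      (H.evAt₂_heq (congrArg (fun k => LaxHom.hom (LaxHom.comp (LaxSlice.Hom.left f) k))
        (H.ofAction_toAction r'.arr)) (congrArg LaxHom.hom (H.ofAction_toAction r.arr))
        ((H.ofActionHom_θ (H.toActionHom f)).symm.trans (H.toActionHom_ξ f))))

theorem toActionHom_ofActionHom {s t : LaxAction X} (f : s ⟶ t) :
    HEq (H.toActionHom (H.ofActionHom f)) f :=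
  LaxAction.hom_heq (H.toAction_ofAction s.action) (H.toAction_ofAction t.action) rfl
    ((H.toActionHom_ξ (H.ofActionHom f)).trans (H.ofActionHom_θ f).symm)

theorem transposition_isIsomorphism : IsIsomorphism H.transposition := by
  refine ⟨H.transpositionInv, strictPseudofunctor_ext (fun r => ?_) (fun f => ?_) (fun σ => ?_),
    strictPseudofunctor_ext (fun s => ?_) (fun f => ?_) (fun σ => ?_)⟩
  · exact congrArg (LaxSlice.mk r.left) (H.ofAction_toAction r.arr)
  · exact H.ofActionHom_toActionHom f
  -- A 2-cell is determined by its underlying monoidal transformation, which neither construction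
  -- changes.
  · exact LaxSlice.hom₂_heq (H.ofAction_toAction _) (H.ofAction_toAction _)
      (H.ofActionHom_toActionHom _) (H.ofActionHom_toActionHom _) HEq.rfl
  · exact congrArg (LaxAction.mk s.mon) (H.toAction_ofAction s.action)
  · exact H.toActionHom_ofActionHom f
  · exact LaxAction.hom₂_heq (H.toAction_ofAction _) (H.toAction_ofAction _)
      (H.toActionHom_ofActionHom _) (H.toActionHom_ofActionHom _) HEq.rfl

end Exponential

end

end TwoCat

theorem mainTheorem4 {A : Type u} [Bicategory.{w, v} A] [Bicategory.Strict A]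
    [TwoCat.FiniteProducts A] (X : A) (H : TwoCat.Exponential X X) :
    ∃ Φ : StrictPseudofunctor (TwoCat.LaxSlice H.monoidalObject) (TwoCat.LaxAction X),
      TwoCat.IsIsomorphism Φ ∧
      Φ.comp (TwoCat.LaxAction.forget X) = TwoCat.LaxSlice.proj H.monoidalObject ∧
      (∀ r : TwoCat.LaxSlice H.monoidalObject,
        ∃ s : TwoCat.Action r.left X, Φ.obj r = ⟨r.left, s⟩ ∧ TwoCat.IsTranspose H r.arr s) ∧
      (∀ {r r' : TwoCat.LaxSlice H.monoidalObject} (f : r ⟶ r'),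
        HEq (TwoCat.ActHom.ξ (Φ.map f))
          (TwoCat.evAt₂ H.ev (TwoCat.LaxHom₂.hom (TwoCat.LaxSlice.Hom.θ f)))) ∧
      (∀ r : TwoCat.LaxSlice H.monoidalObject,
        TwoCat.LaxHom.IsStrong r.arr ↔ (Φ.obj r).action.IsStrong) :=
  ⟨H.transposition, H.transposition_isIsomorphism,
    -- Compatibility with the forgetful 2-functors is definitional at each level, because only the
    -- structure over `M`, `F` and `τ` is transposed.
    TwoCat.strictPseudofunctor_ext (fun _ => rfl) (fun _ => HEq.rfl) (fun _ => HEq.rfl),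
    fun r => ⟨H.toAction r.arr, rfl, H.isTranspose_toAction r.arr⟩,
    fun f => H.toActionHom_ξ f, fun r => H.isStrong_iff r.arr⟩
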